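/- **Theorem (Phase transition in the high imbalance regime).** Let $a,b,c>0$ be constants with $a-c<1$. For every dimension $d$ let $\pi_d\in(0,1)$, $\mu_d\in\mathbb R^d$ and $n_d\in\mathbb N$ be such that, as $d\to\infty$, $$\pi_d\asymp d^{-a},\qquad \|\mu_d\|_2^2\asymp d^{b},\qquad n_d\asymp d^{c+1}.$$ Let $(x_1,y_1),\dots,(x_{n_d},y_{n_d})$ and a test point $(x_{\rm test},y_{\rm test})$ be i.i.d. from the following mixture: $\mathbb P(y=+1)=1-\mathbb P(y=-1)=\pi_d$ and $x=y\mu_d+z$, where $z\in\mathbb R^d$ is independent of $y$ and has independent (not necessarily identically distributed) coordinates $z_j$ with $\mathbb E z_j=0$, $\operatorname{Var}(z_j)=1$ and $\|z_j\|_{\psi_2}:=\inf\{K>0:\mathbb E\exp(z_j^2/K^2)\le 2\}\le C$, for a constant $C$ that does not depend on $d$ and $j$. For $\tau_d>0$ let $(\hat\beta,\hat\beta_0,\hat\kappa)$ be an optimal solution (depending measurably on the training data) of the margin-rebalanced SVM $$\max_{\beta\in\mathbb R^d,\ \beta_0,\kappa\in\mathbb R}\ \kappa\quad\text{subject to}\quad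 y_i(\langle x_i,\beta\rangle+\beta_0)\ge\tau_d\kappa\ \ (y_i=+1),\quad y_i(\langle x_i,\beta\rangle+\beta_0)\ge\kappa\ \ (y_i=-1),\quad \|\beta\|_2\le 1$$ whenever both labels occur in the training set (if only one label occurs, the problem is unbounded and $(\hat\beta,\hat\beta_0)$ is an arbitrary measurable function of the training data). Put $\hat f(x)=\langle x,\hat\beta\rangle+\hat\beta_0$ and $$\mathrm{Err}_+=\mathbb P(\hat f(x_{\rm test})\le 0\mid y_{\rm test}=+1),\quad \mathrm{Err}_-=\mathbb P(\hat f(x_{\rm test})>0\mid y_{\rm test}=-1),\quad \mathrm{Err}_{\rm b}=\tfrac12\mathrm{Err}_++\tfrac12\mathrm{Err}_-,$$ where the probabilities are over both the training data and the test point. Then, as $d\to\infty$: 1. (High signal) If $a-c<b$ and $1\le\tau_d\ll d^{b/2}$, then $\mathrm{Err}_+=o(1)$ and $\mathrm{Err}_-=o(1)$. 2. (Moderate signal) Let $b<a-c<2b$. If $d^{a-b-c}\ll\tau_d\ll d^{(a-c)/2}$, then $\mathrm{Err}_+=o(1)$ and $\mathrm{Err}_-=o(1)$. If $\tau_d\asymp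 1$, then $\mathrm{Err}_+=1-o(1)$ and $\mathrm{Err}_-=o(1)$. 3. (Low signal) If $a-c>2b$, then for every choice of $\tau_d>0$, $\mathrm{Err}_{\rm b}\ge\frac12-o(1)$. Here $u_d\ll v_d$ means $u_d=o(v_d)$ and $u_d\asymp v_d$ means that $u_d/v_d$ is eventually bounded above and below by positive constants. -/

import Mathlib

open MeasureTheory ProbabilityTheory Filter Asymptotics
open scoped ENNReal NNReal Topology

namespace HighImbalance

/-- A labelled data point `(x, y)`; the label `true` stands for `y = +1` (minority class) and
`false` for `y = -1` (majority class). -/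
abbrev Point (d : ℕ) : Type := EuclideanSpace ℝ (Fin d) × Bool

/-- The numerical value `±1` of a label. -/
def label (y : Bool) : ℝ := if y then 1 else -1

/-! ### The two-component sub-gaussian mixture model -/

/-- The sub-gaussian norm `inf {K > 0 : 𝔼[exp (X² / K²)] ≤ 2}` of a real random variable `X` with
law `ν` (equal to `∞` if there is no such `K`). -/
noncomputable def psi2Norm (ν : Measure ℝ) : ℝ≥0∞ :=
  ⨅ (K : ℝ) (_ : 0 < K ∧ ∫⁻ x, ENNReal.ofReal (Real.exp (x ^ 2 / K ^ 2)) ∂ν ≤ 2), ENNReal.ofReal K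

/-- The laws `ν j` of the coordinates of the noise vector: centred, of unit variance, and of
sub-gaussian norm at most `C`. -/
structure IsSubGaussianNoise {d : ℕ} (C : ℝ≥0) (ν : Fin d → Measure ℝ) : Prop where
  isProbabilityMeasure : ∀ j, IsProbabilityMeasure (ν j)
  mean_eq_zero : ∀ j, ∫ x, x ∂(ν j) = 0
  variance_eq_one : ∀ j, variance (fun x : ℝ => x) (ν j) = 1
  psi2Norm_le : ∀ j, psi2Norm (ν j) ≤ (C : ℝ≥0∞)

/-- The law of a label `y` with `ℙ(y = +1) = π` and `ℙ(y = -1) = 1 - π`. -/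
noncomputable def labelLaw (π : ℝ) : Measure Bool :=
  ENNReal.ofReal π • Measure.dirac true + ENNReal.ofReal (1 - π) • Measure.dirac false

/-- The law of a noise vector `z` in `ℝᵈ` with independent coordinates `z j ∼ ν j`. -/
noncomputable def noiseLaw {d : ℕ} (ν : Fin d → Measure ℝ) : Measure (EuclideanSpace ℝ (Fin d)) :=
  (Measure.pi ν).map (WithLp.toLp 2)

/-- The law of a data point `(x, y)`, where `x = y μ + z` and the label `y` and the noise `z` are
independent. -/
noncomputable def dataLaw {d : ℕ} (π : ℝ) (μ : EuclideanSpace ℝ (Fin d)) (ν : Fin d → Measure ℝ) :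
    Measure (Point d) :=
  ((labelLaw π).prod (noiseLaw ν)).map fun w => (label w.1 • μ + w.2, w.1)

/-- The joint law of `n` i.i.d. training points and of an independent test point. -/
noncomputable def jointLaw {d : ℕ} (n : ℕ) (π : ℝ) (μ : EuclideanSpace ℝ (Fin d))
    (ν : Fin d → Measure ℝ) : Measure ((Fin n → Point d) × Point d) :=
  (Measure.pi fun _ : Fin n => dataLaw π μ ν).prod (dataLaw π μ ν)

/-- The high imbalance regime `π ≍ d ^ (-a)`, `‖μ‖² ≍ d ^ b`, `n ≍ d ^ (c + 1)` as `d → ∞`. -/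
structure IsImbalanced (a b c : ℝ) (π : ℕ → ℝ) (μ : (d : ℕ) → EuclideanSpace ℝ (Fin d))
    (n : ℕ → ℕ) : Prop where
  ratio : π =Θ[atTop] fun d : ℕ => (d : ℝ) ^ (-a)
  signal : (fun d : ℕ => ‖μ d‖ ^ 2) =Θ[atTop] fun d : ℕ => (d : ℝ) ^ b
  sampleSize : (fun d : ℕ => (n d : ℝ)) =Θ[atTop] fun d : ℕ => (d : ℝ) ^ (c + 1)

/-! ### The margin-rebalanced support vector machine -/

/-- The constraints of the margin-rebalanced SVM on the training set `S`. -/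
structure IsFeasible {d n : ℕ} (τ : ℝ) (S : Fin n → Point d) (β : EuclideanSpace ℝ (Fin d))
    (β₀ κ : ℝ) : Prop where
  minority : ∀ i, (S i).2 = true → τ * κ ≤ label (S i).2 * (inner ℝ (S i).1 β + β₀)
  majority : ∀ i, (S i).2 = false → κ ≤ label (S i).2 * (inner ℝ (S i).1 β + β₀)
  norm_le_one : ‖β‖ ≤ 1

/-- `(β, β₀, κ)` is an optimal solution of the margin-rebalanced SVM: it maximizes `κ` under the
constraints. -/
def IsSVMSolution {d n : ℕ} (τ : ℝ) (S : Fin n → Point d) (β : EuclideanSpace ℝ (Fin d))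
    (β₀ κ : ℝ) : Prop :=
  IsFeasible τ S β β₀ κ ∧ ∀ β' β₀' κ', IsFeasible τ S β' β₀' κ' → κ' ≤ κ

/-- A margin-rebalanced SVM as a (measurable) map from training sets to parameters `(β, β₀)`.
If only one class is present, then the margin `κ` is unbounded, there is no optimal solution, and
the parameters are unconstrained. -/
structure IsSVM {d n : ℕ} (τ : ℝ)
    (svm : (Fin n → Point d) → EuclideanSpace ℝ (Fin d) × ℝ) : Prop where
  measurable : Measurable svm
  optimal : ∀ S : Fin n → Point d, (∃ i, (S i).2 = true) → (∃ i, (S i).2 = false) →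
    ∃ κ, IsSVMSolution τ S (svm S).1 (svm S).2 κ

/-- The linear score `⟨x, β⟩ + β₀`. -/
noncomputable def logit {d : ℕ} (θ : EuclideanSpace ℝ (Fin d) × ℝ) (x : EuclideanSpace ℝ (Fin d)) :
    ℝ :=
  inner ℝ x θ.1 + θ.2

/-! ### Test errors (the probabilities are over the training set and the test point) -/

/-- Minority error `ℙ(f(x_test) ≤ 0 | y_test = +1)`. -/
noncomputable def errPlus {d n : ℕ} (π : ℝ) (μ : EuclideanSpace ℝ (Fin d)) (ν : Fin d → Measure ℝ)
    (svm : (Fin n → Point d) → EuclideanSpace ℝ (Fin d) × ℝ) : ℝ :=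
  (cond (jointLaw n π μ ν) {w | w.2.2 = true}).real {w | logit (svm w.1) w.2.1 ≤ 0}

/-- Majority error `ℙ(f(x_test) > 0 | y_test = -1)`. -/
noncomputable def errMinus {d n : ℕ} (π : ℝ) (μ : EuclideanSpace ℝ (Fin d)) (ν : Fin d → Measure ℝ)
    (svm : (Fin n → Point d) → EuclideanSpace ℝ (Fin d) × ℝ) : ℝ :=
  (cond (jointLaw n π μ ν) {w | w.2.2 = false}).real {w | 0 < logit (svm w.1) w.2.1}

/-- Balanced error. -/
noncomputable def errBal {d n : ℕ} (π : ℝ) (μ : EuclideanSpace ℝ (Fin d)) (ν : Fin d → Measure ℝ)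
    (svm : (Fin n → Point d) → EuclideanSpace ℝ (Fin d) × ℝ) : ℝ :=
  1 / 2 * errPlus π μ ν svm + 1 / 2 * errMinus π μ ν svm

end HighImbalance

/-! Write `N ≈ n π` for the number of minority points and `ℓ = √(d / N) ≍ d ^ ((a - c) / 2)` for the
size of the mean of their noise vectors; the mean noise of the majority is negligible. Along any
fixed direction the noise is of order one, so the unit vector `v / ‖v‖` along the difference `v` of
the two class centres separates the classes with a gap `(1 + τ) κ` of at least `‖v‖` up to lower
order, and `μ / ‖μ‖` gives a gap of `2 ‖μ‖`. Averaging the constraints of an optimal `β` over the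
majority shows `⟪-μ, β⟫ + β₀ ≤ -κ + O(1)`, so the majority is classified correctly as soon as `κ`
is large; averaging over the minority shows that `⟪μ, β⟫ + β₀` is at least `τ κ` minus the norm of
the mean noise of the minority.

If `‖μ‖ ≫ ℓ`, the margin beats the mean noise. If `‖μ‖ ≪ ℓ`, then the surplus of `‖v‖` over the mean
noise of the minority is of order `‖μ‖ ^ 2 / ℓ ≍ d ^ (b - (a - c) / 2)`. It diverges for
`a - c < 2 b`, and it exceeds the part `‖v‖ / (1 + τ)` of the gap which goes to the majority exactly
when `τ ≫ d ^ (a - b - c)`; for bounded `τ` the intercept is pulled towards the majority and the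
minority is lost. For `a - c > 2 b` the surplus vanishes: `β` is nearly parallel to the mean noise
of the minority, a direction which is essentially independent of the majority. Some majority points
then have arbitrarily large noise along `β`, and classifying them correctly pushes the scores of
fresh minority points to `-∞`, whatever `τ` is. -/

namespace HighImbalance

section SubGaussian

variable {Ω : Type*} {mΩ : MeasurableSpace Ω} {P : Measure Ω} {X : Ω → ℝ} {v : ℝ≥0}

lemma exp_le_add_exp_sq (x : ℝ) : Real.exp x ≤ x + Real.exp (x ^ 2) := by
  have hsq : x ^ 2 + 1 ≤ Real.exp (x ^ 2) := Real.add_one_le_exp _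
  rcases le_total 1 x with hx | hx
  · have : Real.exp x ≤ Real.exp (x ^ 2) := Real.exp_le_exp.2 (by nlinarith)
    linarith
  · rcases le_total (-1) x with hx' | hx'
    · have := (abs_le.1 (Real.abs_exp_sub_one_sub_id_le (abs_le.2 ⟨hx', hx⟩))).2
      linarith
    · have : Real.exp x ≤ 1 := Real.exp_le_one_iff.2 (by linarith)
      nlinarith

lemma exp_mul_le_one_sub_add {r : ℝ} (hr₀ : 0 ≤ r) (hr₁ : r ≤ 1) (x : ℝ) :
    Real.exp (r * x) ≤ 1 - r + r * Real.exp x := by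
  simpa using convexOn_exp.2 (Set.mem_univ 0) (Set.mem_univ x) (sub_nonneg.2 hr₁) hr₀ (by ring)

lemma integrable_exp_mul_sq (hX : AEMeasurable X P)
    (hexp : Integrable (fun ω => Real.exp (X ω ^ 2)) P) {r : ℝ} (hr₁ : r ≤ 1) :
    Integrable (fun ω => Real.exp (r * X ω ^ 2)) P := by
  refine hexp.mono' (by fun_prop) (Eventually.of_forall fun ω => ?_)
  rw [Real.norm_of_nonneg (Real.exp_pos _).le, Real.exp_le_exp]
  nlinarith [sq_nonneg (X ω)]

lemma integral_exp_mul_sq_le [IsProbabilityMeasure P] (hX : AEMeasurable X P)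
    (hexp : Integrable (fun ω => Real.exp (X ω ^ 2)) P)
    (hle : ∫ ω, Real.exp (X ω ^ 2) ∂P ≤ 2) {r : ℝ} (hr₀ : 0 ≤ r) (hr₁ : r ≤ 1) :
    ∫ ω, Real.exp (r * X ω ^ 2) ∂P ≤ Real.exp r :=
  calc ∫ ω, Real.exp (r * X ω ^ 2) ∂P
      ≤ ∫ ω, (1 - r + r * Real.exp (X ω ^ 2)) ∂P :=
        integral_mono (integrable_exp_mul_sq hX hexp hr₁)
          ((integrable_const _).add (hexp.const_mul r)) fun ω => exp_mul_le_one_sub_add hr₀ hr₁ _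
    _ = 1 - r + r * ∫ ω, Real.exp (X ω ^ 2) ∂P := by
        rw [integral_add (integrable_const _) (hexp.const_mul r), integral_const_mul]
        simp
    _ ≤ r + 1 := by linarith [mul_le_mul_of_nonneg_left hle hr₀]
    _ ≤ Real.exp r := Real.add_one_le_exp r

lemma exp_mul_le_exp_mul_exp (t x : ℝ) :
    Real.exp (t * x) ≤ Real.exp (t ^ 2 / 2) * Real.exp (1 / 2 * x ^ 2) := by
  rw [← Real.exp_add, Real.exp_le_exp]
  linarith [two_mul_le_add_sq t x]

lemma integrable_exp_mul_of_integrable_exp_sq (hX : AEMeasurable X P)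
    (hexp : Integrable (fun ω => Real.exp (X ω ^ 2)) P) (t : ℝ) :
    Integrable (fun ω => Real.exp (t * X ω)) P :=
  ((integrable_exp_mul_sq hX hexp (r := 1 / 2) (by norm_num)).const_mul _).mono' (by fun_prop)
    (Eventually.of_forall fun ω => by
      simpa only [Real.norm_of_nonneg (Real.exp_pos _).le] using exp_mul_le_exp_mul_exp t (X ω))

lemma mgf_le_of_integral_exp_sq_le [IsProbabilityMeasure P] (hX : AEMeasurable X P)
    (hexp : Integrable (fun ω => Real.exp (X ω ^ 2)) P)
    (hle : ∫ ω, Real.exp (X ω ^ 2) ∂P ≤ 2) (hmean : ∫ ω, X ω ∂P = 0) (t : ℝ) :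
    mgf X P t ≤ Real.exp (t ^ 2) := by
  have hint := integrable_exp_mul_of_integrable_exp_sq hX hexp
  rcases le_total (t ^ 2) 1 with ht | ht
  · have hintX : Integrable X P := integrable_of_mem_interior_integrableExpSet (by
      rw [show integrableExpSet X P = Set.univ from Set.eq_univ_of_forall hint, interior_univ]
      trivial)
    calc ∫ ω, Real.exp (t * X ω) ∂P
        ≤ ∫ ω, (t * X ω + Real.exp (t ^ 2 * X ω ^ 2)) ∂P :=
          integral_mono (hint t) ((hintX.const_mul t).add (integrable_exp_mul_sq hX hexp ht))
            fun ω => by simpa only [mul_pow] using exp_le_add_exp_sq (t * X ω)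
      _ = ∫ ω, Real.exp (t ^ 2 * X ω ^ 2) ∂P := by
          rw [integral_add (hintX.const_mul t) (integrable_exp_mul_sq hX hexp ht),
            integral_const_mul, hmean, mul_zero, zero_add]
      _ ≤ Real.exp (t ^ 2) := integral_exp_mul_sq_le hX hexp hle (sq_nonneg t) ht
  · calc ∫ ω, Real.exp (t * X ω) ∂P
        ≤ ∫ ω, Real.exp (t ^ 2 / 2) * Real.exp (1 / 2 * X ω ^ 2) ∂P :=
          integral_mono (hint t) ((integrable_exp_mul_sq hX hexp (by norm_num)).const_mul _)
            fun ω => exp_mul_le_exp_mul_exp t (X ω)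
      _ ≤ Real.exp (t ^ 2 / 2) * Real.exp (1 / 2) := by
          rw [integral_const_mul]
          gcongr
          exact integral_exp_mul_sq_le hX hexp hle (by norm_num) (by norm_num)
      _ ≤ Real.exp (t ^ 2) := by
          rw [← Real.exp_add, Real.exp_le_exp]
          linarith

lemma hasSubgaussianMGF_of_integral_exp_sq_le [IsProbabilityMeasure P] (hX : AEMeasurable X P)
    (hexp : Integrable (fun ω => Real.exp (X ω ^ 2)) P)
    (hle : ∫ ω, Real.exp (X ω ^ 2) ∂P ≤ 2) (hmean : ∫ ω, X ω ∂P = 0) :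
    HasSubgaussianMGF X 2 P where
  integrable_exp_mul := integrable_exp_mul_of_integrable_exp_sq hX hexp
  mgf_le t := by simpa using mgf_le_of_integral_exp_sq_le hX hexp hle hmean t

lemma pow_four_le_exp_add_exp (x : ℝ) : x ^ 4 ≤ 24 * (Real.exp x + Real.exp (-x)) := by
  have hpow := Real.pow_div_factorial_le_exp |x| (abs_nonneg x) 4
  have habs := Real.exp_abs_le x
  rw [Even.pow_abs (by decide)] at hpow
  norm_num [Nat.factorial] at hpow
  linarith

lemma integrable_pow_of_hasSubgaussianMGF [IsFiniteMeasure P] (h : HasSubgaussianMGF X v P)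
    (k : ℕ) :
    Integrable (fun ω => X ω ^ k) P := by
  have := (h.memLp k).integrable_norm_pow'
  exact (integrable_norm_iff (h.aestronglyMeasurable.pow k)).1 (by simpa using this)

lemma pow_four_mul_integral_pow_four_le [IsFiniteMeasure P] (h : HasSubgaussianMGF X v P)
    (t : ℝ) :
    t ^ 4 * ∫ ω, X ω ^ 4 ∂P ≤ 48 * Real.exp (v * t ^ 2 / 2) := by
  have hpos := h.integrable_exp_mul t
  have hneg := h.integrable_exp_mul (-t)
  calc t ^ 4 * ∫ ω, X ω ^ 4 ∂P = ∫ ω, (t * X ω) ^ 4 ∂P := by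
        simp only [mul_pow, integral_const_mul]
    _ ≤ ∫ ω, 24 * (Real.exp (t * X ω) + Real.exp (-t * X ω)) ∂P :=
        integral_mono (by simpa only [mul_pow] using
            (integrable_pow_of_hasSubgaussianMGF h 4).const_mul (t ^ 4))
          ((hpos.add hneg).const_mul 24)
          fun ω => by simpa only [neg_mul] using pow_four_le_exp_add_exp (t * X ω)
    _ = 24 * (mgf X P t + mgf X P (-t)) := by
        rw [integral_const_mul, integral_add hpos hneg]
        rfl
    _ ≤ 48 * Real.exp (v * t ^ 2 / 2) := by
        have := h.mgf_le t
        have := h.mgf_le (-t)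
        rw [neg_sq] at this
        linarith

lemma integral_pow_four_le [IsFiniteMeasure P] (h : HasSubgaussianMGF X v P) (hv : 0 < v) :
    ∫ ω, X ω ^ 4 ∂P ≤ 96 * v ^ 2 := by
  have hv' : (0 : ℝ) < v := hv
  have hsq : (√(v : ℝ)⁻¹) ^ 2 = (v : ℝ)⁻¹ := Real.sq_sqrt (by positivity)
  have hle := pow_four_mul_integral_pow_four_le h (√(v : ℝ)⁻¹)
  rw [show (√(v : ℝ)⁻¹) ^ 4 = ((√(v : ℝ)⁻¹) ^ 2) ^ 2 by ring, hsq, mul_inv_cancel₀ hv'.ne',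
    inv_pow, inv_mul_le_iff₀ (by positivity)] at hle
  have hexp : Real.exp (1 / 2) ≤ 2 := by
    have hsq : Real.exp (1 / 2) ^ 2 = Real.exp 1 := by rw [← Real.exp_nat_mul]; norm_num
    nlinarith [Real.exp_one_lt_d9]
  nlinarith [sq_nonneg (v : ℝ)]

lemma measureReal_lt_abs_le [IsFiniteMeasure P] (h : HasSubgaussianMGF X v P) {t : ℝ}
    (ht : 0 ≤ t) : P.real {ω | t < |X ω|} ≤ 2 * Real.exp (-t ^ 2 / (2 * v)) := by
  have hsub : {ω | t < |X ω|} ⊆ {ω | t ≤ X ω} ∪ {ω | t ≤ (-X) ω} := fun ω hω =>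
    (lt_abs.1 (show t < |X ω| from hω)).imp (fun h => h.le) fun h => h.le
  calc P.real {ω | t < |X ω|} ≤ P.real {ω | t ≤ X ω} + P.real {ω | t ≤ (-X) ω} :=
        (measureReal_mono hsub).trans (measureReal_union_le _ _)
    _ ≤ 2 * Real.exp (-t ^ 2 / (2 * v)) := by
        linarith [h.measure_ge_le ht, h.neg.measure_ge_le ht]

/-- The variance proxy of a centred random variable of sub-gaussian norm at most `C`; one is added
to `C` because the infimum in `psi2Norm` need not be attained. -/
noncomputable def varianceProxy (C : ℝ≥0) : ℝ≥0 := 2 * (C + 1) ^ 2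

lemma varianceProxy_pos (C : ℝ≥0) : 0 < varianceProxy C := by
  unfold varianceProxy; positivity

lemma lintegral_exp_sq_le_of_psi2Norm_le {C : ℝ≥0} {ν : Measure ℝ} (h : psi2Norm ν ≤ C) :
    ∫⁻ x, ENNReal.ofReal (Real.exp ((x / (C + 1 : ℝ)) ^ 2)) ∂ν ≤ 2 := by
  have hlt : psi2Norm ν < ENNReal.ofReal (C + 1 : ℝ) := by
    refine h.trans_lt ?_
    rw [← ENNReal.ofReal_coe_nnreal]
    exact (ENNReal.ofReal_lt_ofReal_iff (by positivity)).2 (by linarith)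
  simp only [psi2Norm, iInf_lt_iff] at hlt
  obtain ⟨K, ⟨hK, hKint⟩, hKlt⟩ := hlt
  have hKC : K < (C : ℝ) + 1 := (ENNReal.ofReal_lt_ofReal_iff (by positivity)).1 hKlt
  refine le_trans (lintegral_mono fun x => ENNReal.ofReal_le_ofReal (Real.exp_le_exp.2 ?_)) hKint
  rw [div_pow]
  gcongr

lemma hasSubgaussianMGF_of_psi2Norm_le {C : ℝ≥0} {ν : Measure ℝ} [IsProbabilityMeasure ν]
    (h : psi2Norm ν ≤ C) (hmean : ∫ x, x ∂ν = 0) :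
    HasSubgaussianMGF (fun x : ℝ => x) (varianceProxy C) ν := by
  have hle := lintegral_exp_sq_le_of_psi2Norm_le h
  have hnonneg : 0 ≤ᵐ[ν] fun x : ℝ => Real.exp ((x / (C + 1 : ℝ)) ^ 2) :=
    Eventually.of_forall fun x => (Real.exp_pos _).le
  have hint : Integrable (fun x : ℝ => Real.exp ((x / (C + 1 : ℝ)) ^ 2)) ν :=
    ⟨by fun_prop, by
      rw [hasFiniteIntegral_iff_ofReal hnonneg]
      exact hle.trans_lt (by simp)⟩
  have hscaled : HasSubgaussianMGF (fun x : ℝ => x / (C + 1 : ℝ)) 2 ν := by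
    refine hasSubgaussianMGF_of_integral_exp_sq_le (by fun_prop) hint ?_
      (by rw [integral_div, hmean, zero_div])
    rw [integral_eq_lintegral_of_nonneg_ae hnonneg (by fun_prop)]
    exact ENNReal.toReal_le_of_le_ofReal (by norm_num) (by simpa using hle)
  have hX := hscaled.const_mul (C + 1 : ℝ)
  convert hX using 1
  · ext x
    field_simp
  · rw [varianceProxy, mul_comm]
    rfl

end SubGaussian

section LinearCombination

variable {Ω ι : Type*} {mΩ : MeasurableSpace Ω} {P : Measure Ω} {X : ι → Ω → ℝ} {v : ℝ≥0}

lemma hasSubgaussianMGF_linearCombination (hX : iIndepFun X P)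
    (hv : ∀ i, HasSubgaussianMGF (X i) v P) (s : Finset ι) (u : ι → ℝ) {r : ℝ≥0}
    (hr : (r : ℝ) = ∑ i ∈ s, u i ^ 2) :
    HasSubgaussianMGF (fun ω => ∑ i ∈ s, u i * X i ω) (v * r) P := by
  have h := HasSubgaussianMGF.sum_of_iIndepFun (s := s)
    (hX.comp (fun i x => u i * x) fun i => by fun_prop) fun i _ => (hv i).const_mul (u i)
  convert h using 1
  · rfl
  · refine NNReal.eq ?_
    rw [NNReal.coe_mul, hr, NNReal.coe_sum, Finset.mul_sum]
    exact Finset.sum_congr rfl fun i _ => mul_comm _ _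

lemma integral_linearCombination (hint : ∀ i, Integrable (X i) P) (hmean : ∀ i, ∫ ω, X i ω ∂P = 0)
    (s : Finset ι) (u : ι → ℝ) : ∫ ω, (∑ i ∈ s, u i * X i ω) ∂P = 0 := by
  rw [integral_finsetSum _ fun i _ => (hint i).const_mul (u i)]
  exact Finset.sum_eq_zero fun i _ => by rw [integral_const_mul, hmean, mul_zero]

lemma integral_linearCombination_sq [IsProbabilityMeasure P] (hX : iIndepFun X P)
    (hL2 : ∀ i, MemLp (X i) 2 P) (hmean : ∀ i, ∫ ω, X i ω ∂P = 0)
    (hvar : ∀ i, ∫ ω, X i ω ^ 2 ∂P = 1) (s : Finset ι) (u : ι → ℝ) :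
    ∫ ω, (∑ i ∈ s, u i * X i ω) ^ 2 ∂P = ∑ i ∈ s, u i ^ 2 := by
  have hL2' : ∀ i, MemLp (fun ω => u i * X i ω) 2 P := fun i => (hL2 i).const_mul (u i)
  have hmeas : AEMeasurable (fun ω => ∑ i ∈ s, u i * X i ω) P :=
    (memLp_finsetSum s fun i _ => hL2' i).aestronglyMeasurable.aemeasurable
  have hsum : (fun ω => ∑ i ∈ s, u i * X i ω) = ∑ i ∈ s, fun ω => u i * X i ω := by
    ext ω; simp
  rw [← variance_of_integral_eq_zero hmeas
      (integral_linearCombination (fun i => (hL2 i).integrable one_le_two) hmean s u), hsum,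
    IndepFun.variance_sum (fun i _ => hL2' i) fun i _ j _ hij =>
      (hX.comp (fun i x => u i * x) fun i => by fun_prop).indepFun hij]
  refine Finset.sum_congr rfl fun i _ => ?_
  rw [variance_const_mul,
    variance_of_integral_eq_zero (hL2 i).aestronglyMeasurable.aemeasurable (hmean i), hvar, mul_one]

end LinearCombination

section TailLowerBound

lemma one_add_add_le_exp (x : ℝ) : 1 + x + x ^ 2 / 4 - x ^ 4 / 4 ≤ Real.exp x := by
  rcases le_total |x| 1 with hx | hx
  · have hexp := (abs_le.1 (Real.exp_bound hx (n := 3) (by norm_num))).1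
    norm_num [Finset.sum_range_succ, Nat.factorial] at hexp
    have : 0 ≤ |x| ^ 2 * (1 / 4 - 2 / 9 * |x| + |x| ^ 2 / 4) := by
      have : 0 ≤ 1 / 4 - 2 / 9 * |x| + |x| ^ 2 / 4 := by nlinarith [sq_nonneg (|x| - 4 / 9)]
      positivity
    nlinarith [sq_abs x]
  · rcases le_abs.1 hx with hx | hx
    · nlinarith [Real.quadratic_le_exp_of_nonneg (zero_le_one.trans hx), sq_nonneg x]
    · have : x ^ 2 ≤ x ^ 4 := by nlinarith [sq_nonneg x, mul_self_nonneg (x + 1)]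
      linarith [Real.exp_pos x]

variable {Ω : Type*} {mΩ : MeasurableSpace Ω} {P : Measure Ω} [IsProbabilityMeasure P] {v : ℝ≥0}

lemma exp_le_mgf {X : Ω → ℝ} (hX : HasSubgaussianMGF X v P) (hmean : ∫ ω, X ω ∂P = 0)
    (hvar : ∫ ω, X ω ^ 2 ∂P = 1) {s : ℝ} (hs : s ^ 2 ≤ 8)
    (hsX : s ^ 2 * ∫ ω, X ω ^ 4 ∂P ≤ 1 / 2) : Real.exp (s ^ 2 / 16) ≤ mgf X P s := by
  have hpow := integrable_pow_of_hasSubgaussianMGF hX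
  have hsX₁ : Integrable (fun ω => s * X ω) P := by simpa using (hpow 1).const_mul s
  have hlin : Integrable (fun ω => 1 + s * X ω) P := (integrable_const 1).add hsX₁
  have hquad : Integrable (fun ω => 1 + s * X ω + s ^ 2 / 4 * X ω ^ 2) P :=
    hlin.add ((hpow 2).const_mul _)
  have hexp : Real.exp (1 / 2) ≤ 2 := by
    have : Real.exp (1 / 2) ^ 2 = Real.exp 1 := by rw [← Real.exp_nat_mul]; norm_num
    nlinarith [Real.exp_one_lt_d9]
  calc Real.exp (s ^ 2 / 16) = Real.exp (s ^ 2 / 8 * (1 / 2)) := by ring_nf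
    _ ≤ 1 - s ^ 2 / 8 + s ^ 2 / 8 * Real.exp (1 / 2) :=
        exp_mul_le_one_sub_add (by positivity) (by linarith) _
    _ ≤ 1 + s ^ 2 / 4 - s ^ 2 / 4 * (s ^ 2 * ∫ ω, X ω ^ 4 ∂P) := by nlinarith [sq_nonneg s]
    _ = ∫ ω, (1 + s * X ω + s ^ 2 / 4 * X ω ^ 2 - s ^ 4 / 4 * X ω ^ 4) ∂P := by
        rw [integral_sub hquad ((hpow 4).const_mul _), integral_add hlin ((hpow 2).const_mul _),
          integral_add (integrable_const _) hsX₁]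
        simp only [integral_const_mul, hmean, hvar, integral_const, probReal_univ, smul_eq_mul]
        ring
    _ ≤ mgf X P s := integral_mono (hquad.sub ((hpow 4).const_mul _)) (hX.integrable_exp_mul s)
        fun ω => by
          have := one_add_add_le_exp (s * X ω)
          simp only
          linarith

lemma exp_mul_le_add_indicator {δ θ : ℝ} (hδ : 0 < δ) (hθ : 0 ≤ θ) (K x : ℝ) :
    Real.exp (θ * x) ≤ Real.exp (θ * K) + (δ / 2 * Real.exp (2 * θ * x) +
      1 / (2 * δ) * (Set.Ici K).indicator 1 x) := by
  rcases le_or_gt K x with hK | hK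
  · have hamgm : δ / 2 * Real.exp (2 * θ * x) + 1 / (2 * δ) - Real.exp (θ * x) =
        (δ * Real.exp (θ * x) - 1) ^ 2 / (2 * δ) := by
      rw [show 2 * θ * x = θ * x + θ * x by ring, Real.exp_add]
      field_simp
      ring
    have hnonneg : 0 ≤ (δ * Real.exp (θ * x) - 1) ^ 2 / (2 * δ) := by positivity
    rw [Set.indicator_of_mem (Set.mem_Ici.2 hK), Pi.one_apply]
    linarith [Real.exp_pos (θ * K)]
  · rw [Set.indicator_of_notMem (Set.notMem_Ici.2 hK), mul_zero, add_zero]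
    have : Real.exp (θ * x) ≤ Real.exp (θ * K) := by gcongr
    linarith [mul_pos hδ (Real.exp_pos (2 * θ * x))]

-- The Paley–Zygmund argument for `exp (θ X)`.
lemma exp_le_measureReal_of_le_mgf {X : Ω → ℝ} (hXm : Measurable X) (hX : HasSubgaussianMGF X v P)
    {θ K : ℝ} (hθ : 0 ≤ θ) (hmgf : Real.exp (θ * K) + 1 ≤ mgf X P θ) :
    Real.exp (-(2 * v * θ ^ 2)) ≤ P.real {ω | K ≤ X ω} := by
  set δ := Real.exp (-(2 * v * θ ^ 2)) with hδ
  have hδpos : 0 < δ := Real.exp_pos _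
  have hB : MeasurableSet {ω | K ≤ X ω} := measurableSet_le measurable_const hXm
  have hind : Integrable (fun ω => 1 / (2 * δ) * (Set.Ici K).indicator 1 (X ω)) P :=
    ((integrable_const (1 : ℝ)).indicator hB).const_mul _
  have hsq : Integrable (fun ω => δ / 2 * Real.exp (2 * θ * X ω)) P :=
    (hX.integrable_exp_mul (2 * θ)).const_mul _
  have hadd : Integrable (fun ω => δ / 2 * Real.exp (2 * θ * X ω) +
      1 / (2 * δ) * (Set.Ici K).indicator 1 (X ω)) P := hsq.add hind
  have hfirst : mgf X P θ ≤
      Real.exp (θ * K) + (δ / 2 * mgf X P (2 * θ) + 1 / (2 * δ) * P.real {ω | K ≤ X ω}) :=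
    calc mgf X P θ ≤ ∫ ω, (Real.exp (θ * K) + (δ / 2 * Real.exp (2 * θ * X ω) +
          1 / (2 * δ) * (Set.Ici K).indicator 1 (X ω))) ∂P :=
          integral_mono (hX.integrable_exp_mul θ) ((integrable_const _).add hadd)
            fun ω => exp_mul_le_add_indicator hδpos hθ K (X ω)
      _ = _ := by
          have hint : ∫ ω, (Set.Ici K).indicator (1 : ℝ → ℝ) (X ω) ∂P = P.real {ω | K ≤ X ω} :=
            integral_indicator_one hB
          rw [integral_add (integrable_const _) hadd, integral_add hsq hind,
            integral_const_mul, integral_const_mul, hint, integral_const, probReal_univ, one_smul]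
          rfl
  have hsecond : δ * mgf X P (2 * θ) ≤ 1 :=
    calc δ * mgf X P (2 * θ) ≤ δ * Real.exp (2 * v * θ ^ 2) := by
          gcongr
          exact (hX.mgf_le _).trans_eq (by ring_nf)
      _ = 1 := by rw [hδ, ← Real.exp_add, neg_add_cancel, Real.exp_zero]
  have : 1 / 2 ≤ 1 / (2 * δ) * P.real {ω | K ≤ X ω} := by linarith
  field_simp at this
  linarith

variable {ι : Type*} [Fintype ι]

lemma exp_le_mgf_linearCombination {X : ι → Ω → ℝ} (hXm : ∀ i, Measurable (X i))
    (hX : iIndepFun X P) (hv : ∀ i, HasSubgaussianMGF (X i) v P) (hmean : ∀ i, ∫ ω, X i ω ∂P = 0)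
    (hvar : ∀ i, ∫ ω, X i ω ^ 2 ∂P = 1) {M : ℝ} (hM : ∀ i, ∫ ω, X i ω ^ 4 ∂P ≤ M) {u : ι → ℝ}
    {θ : ℝ} (hθ : ∀ i, (θ * u i) ^ 2 ≤ 8) (hθM : ∀ i, (θ * u i) ^ 2 * M ≤ 1 / 2) :
    Real.exp (θ ^ 2 / 16 * ∑ i, u i ^ 2) ≤ mgf (fun ω => ∑ i, u i * X i ω) P θ := by
  have hmgf : mgf (fun ω => ∑ i, u i * X i ω) P θ = ∏ i, mgf (X i) P (θ * u i) := by
    have := (hX.comp (fun i x => u i * x) fun i => by fun_prop).mgf_sum (t := θ)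
      (fun i => (hXm i).const_mul (u i)) Finset.univ
    simp only [mgf, mul_assoc] at this ⊢
    simpa using this
  rw [hmgf, Finset.mul_sum, Real.exp_sum]
  refine Finset.prod_le_prod (fun i _ => (Real.exp_pos _).le) fun i _ => ?_
  rw [show θ ^ 2 / 16 * u i ^ 2 = (θ * u i) ^ 2 / 16 by ring]
  exact exp_le_mgf (hv i) (hmean i) (hvar i) (hθ i)
    ((mul_le_mul_of_nonneg_left (hM i) (sq_nonneg _)).trans (hθM i))

lemma exp_mul_add_one_le_exp_sq (K : ℝ) :
    Real.exp (16 * (|K| + 1) * K) + 1 ≤ Real.exp ((16 * (|K| + 1)) ^ 2 / 16) := by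
  have hK := abs_nonneg K
  have hle : Real.exp (16 * (|K| + 1) * K) ≤ Real.exp (16 * (|K| + 1) * |K|) := by
    gcongr
    exact le_abs_self K
  have hone : 1 ≤ Real.exp (16 * (|K| + 1) * |K|) := Real.one_le_exp (by positivity)
  have htwo : 2 ≤ Real.exp (16 * (|K| + 1)) := by
    linarith [Real.add_one_le_exp (16 * (|K| + 1))]
  rw [show (16 * (|K| + 1)) ^ 2 / 16 = 16 * (|K| + 1) * |K| + 16 * (|K| + 1) by ring,
    Real.exp_add]
  nlinarith

end TailLowerBound

section Noise

variable {d : ℕ} {C : ℝ≥0} {ν : Fin d → Measure ℝ}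

lemma inner_eq_sum_mul (z u : EuclideanSpace ℝ (Fin d)) : inner ℝ z u = ∑ l, u l * z l := by
  simp [PiLp.inner_apply]

lemma norm_sq_eq_sum_sq (u : EuclideanSpace ℝ (Fin d)) : ‖u‖ ^ 2 = ∑ l, u l ^ 2 := by
  simp [EuclideanSpace.norm_sq_eq]

namespace IsSubGaussianNoise

lemma isProbabilityMeasure_noiseLaw (hν : IsSubGaussianNoise C ν) :
    IsProbabilityMeasure (noiseLaw ν) := by
  have := hν.isProbabilityMeasure
  exact Measure.isProbabilityMeasure_map (by fun_prop)

lemma measurePreserving_coord (hν : IsSubGaussianNoise C ν) (l : Fin d) :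
    MeasurePreserving (fun z : EuclideanSpace ℝ (Fin d) => z l) (noiseLaw ν) (ν l) := by
  have := hν.isProbabilityMeasure
  refine ⟨by fun_prop, ?_⟩
  rw [noiseLaw, Measure.map_map (by fun_prop) (by fun_prop)]
  exact (measurePreserving_eval ν l).map_eq

lemma iIndepFun_coord (hν : IsSubGaussianNoise C ν) :
    iIndepFun (fun (l : Fin d) (z : EuclideanSpace ℝ (Fin d)) => z l) (noiseLaw ν) := by
  have := hν.isProbabilityMeasure
  have := hν.isProbabilityMeasure_noiseLaw
  rw [iIndepFun_iff_map_fun_eq_pi_map fun l => by fun_prop]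
  simp_rw [(hν.measurePreserving_coord _).map_eq]
  rw [noiseLaw, Measure.map_map (by fun_prop) (by fun_prop)]
  exact Measure.map_id

lemma hasSubgaussianMGF_coord (hν : IsSubGaussianNoise C ν) (l : Fin d) :
    HasSubgaussianMGF (fun z : EuclideanSpace ℝ (Fin d) => z l) (varianceProxy C)
      (noiseLaw ν) := by
  have := hν.isProbabilityMeasure l
  have h := hasSubgaussianMGF_of_psi2Norm_le (hν.psi2Norm_le l) (hν.mean_eq_zero l)
  rw [← (hν.measurePreserving_coord l).map_eq] at h
  exact h.of_map (by fun_prop)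

lemma integral_coord (hν : IsSubGaussianNoise C ν) (l : Fin d) :
    ∫ z, z l ∂(noiseLaw ν) = 0 := by
  rw [← hν.mean_eq_zero l, ← (hν.measurePreserving_coord l).map_eq,
    integral_map (by fun_prop) (by fun_prop)]

lemma integral_coord_sq (hν : IsSubGaussianNoise C ν) (l : Fin d) :
    ∫ z, z l ^ 2 ∂(noiseLaw ν) = 1 := by
  have := hν.isProbabilityMeasure l
  rw [← hν.variance_eq_one l, variance_of_integral_eq_zero (by fun_prop) (hν.mean_eq_zero l),
    ← (hν.measurePreserving_coord l).map_eq, integral_map (by fun_prop) (by fun_prop)]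

lemma memLp_coord (hν : IsSubGaussianNoise C ν) (l : Fin d) :
    MemLp (fun z : EuclideanSpace ℝ (Fin d) => z l) 2 (noiseLaw ν) :=
  (hν.hasSubgaussianMGF_coord l).memLp 2

lemma integral_coord_pow_four_le (hν : IsSubGaussianNoise C ν) (l : Fin d) :
    ∫ z, z l ^ 4 ∂(noiseLaw ν) ≤ 96 * (varianceProxy C : ℝ) ^ 2 :=
  have := hν.isProbabilityMeasure_noiseLaw
  integral_pow_four_le (hν.hasSubgaussianMGF_coord l) (varianceProxy_pos C)

lemma hasSubgaussianMGF_inner (hν : IsSubGaussianNoise C ν) (u : EuclideanSpace ℝ (Fin d)) :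
    HasSubgaussianMGF (fun z => inner ℝ z u) (varianceProxy C * ‖u‖₊ ^ 2) (noiseLaw ν) := by
  simp_rw [inner_eq_sum_mul]
  exact hasSubgaussianMGF_linearCombination hν.iIndepFun_coord hν.hasSubgaussianMGF_coord _ _
    (by simp [← norm_sq_eq_sum_sq])

lemma integral_inner (hν : IsSubGaussianNoise C ν) (u : EuclideanSpace ℝ (Fin d)) :
    ∫ z, inner ℝ z u ∂(noiseLaw ν) = 0 := by
  have := hν.isProbabilityMeasure_noiseLaw
  simp_rw [inner_eq_sum_mul]
  exact integral_linearCombination (fun l => (hν.memLp_coord l).integrable one_le_two)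
    hν.integral_coord _ _

lemma integral_inner_sq (hν : IsSubGaussianNoise C ν) (u : EuclideanSpace ℝ (Fin d)) :
    ∫ z, inner ℝ z u ^ 2 ∂(noiseLaw ν) = ‖u‖ ^ 2 := by
  have := hν.isProbabilityMeasure_noiseLaw
  simp_rw [inner_eq_sum_mul, norm_sq_eq_sum_sq]
  exact integral_linearCombination_sq hν.iIndepFun_coord hν.memLp_coord hν.integral_coord
    hν.integral_coord_sq _ _

lemma measureReal_lt_abs_inner_le (hν : IsSubGaussianNoise C ν) (u : EuclideanSpace ℝ (Fin d))
    {t : ℝ} (ht : 0 ≤ t) :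
    (noiseLaw ν).real {z | t * ‖u‖ < |inner ℝ z u|} ≤
      2 * Real.exp (-t ^ 2 / (2 * varianceProxy C)) := by
  have := hν.isProbabilityMeasure_noiseLaw
  have hv : (0 : ℝ) < varianceProxy C := varianceProxy_pos C
  rcases eq_or_ne u 0 with rfl | hu
  · simp [Real.exp_nonneg]
  have : 0 < ‖u‖ := norm_pos_iff.2 hu
  refine (measureReal_lt_abs_le (hν.hasSubgaussianMGF_inner u) (by positivity)).trans_eq ?_
  congr 2
  simp only [NNReal.coe_mul, NNReal.coe_pow, coe_nnnorm]
  field_simp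

lemma measureReal_lt_abs_inner_le_inv_sq (hν : IsSubGaussianNoise C ν)
    {u : EuclideanSpace ℝ (Fin d)} (hu : ‖u‖ ≤ 1) {A : ℝ} (hA : 0 < A) :
    (noiseLaw ν).real {z | A < |inner ℝ z u|} ≤ 1 / A ^ 2 := by
  have := hν.isProbabilityMeasure_noiseLaw
  have hsub := hν.hasSubgaussianMGF_inner u
  have hcheb := meas_ge_le_variance_div_sq (hsub.memLp 2) hA
  rw [variance_of_integral_eq_zero hsub.aemeasurable (hν.integral_inner u), hν.integral_inner_sq,
    hν.integral_inner] at hcheb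
  calc (noiseLaw ν).real {z | A < |inner ℝ z u|} ≤ ‖u‖ ^ 2 / A ^ 2 :=
        ENNReal.toReal_le_of_le_ofReal (by positivity) <| hcheb.trans' <|
          measure_mono fun z (hz : A < |inner ℝ z u|) => by simpa using hz.le
    _ ≤ 1 / A ^ 2 := by
        gcongr
        exact pow_le_one₀ (norm_nonneg u) hu

lemma memLp_coord_sq (hν : IsSubGaussianNoise C ν) (l : Fin d) :
    MemLp (fun z : EuclideanSpace ℝ (Fin d) => z l ^ 2) 2 (noiseLaw ν) := by
  have := hν.isProbabilityMeasure_noiseLaw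
  rw [memLp_two_iff_integrable_sq (by fun_prop)]
  simpa [← pow_mul] using integrable_pow_of_hasSubgaussianMGF (hν.hasSubgaussianMGF_coord l) 4

lemma memLp_norm_sq (hν : IsSubGaussianNoise C ν) :
    MemLp (fun z : EuclideanSpace ℝ (Fin d) => ‖z‖ ^ 2) 2 (noiseLaw ν) := by
  simp_rw [norm_sq_eq_sum_sq]
  exact memLp_finsetSum _ fun l _ => hν.memLp_coord_sq l

lemma integral_norm_sq (hν : IsSubGaussianNoise C ν) :
    ∫ z, ‖z‖ ^ 2 ∂(noiseLaw ν) = d := by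
  have := hν.isProbabilityMeasure_noiseLaw
  simp_rw [norm_sq_eq_sum_sq]
  rw [integral_finsetSum _ fun l _ => (hν.memLp_coord_sq l).integrable one_le_two]
  simp [hν.integral_coord_sq]

lemma variance_norm_sq_le (hν : IsSubGaussianNoise C ν) :
    variance (fun z => ‖z‖ ^ 2) (noiseLaw ν) ≤ 96 * (varianceProxy C : ℝ) ^ 2 * d := by
  have := hν.isProbabilityMeasure_noiseLaw
  have hind := hν.iIndepFun_coord.comp (fun _ x => x ^ 2) fun _ => by fun_prop
  have hsum : (fun z : EuclideanSpace ℝ (Fin d) => ‖z‖ ^ 2) = ∑ l, fun z => z l ^ 2 := by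
    ext z; simp [norm_sq_eq_sum_sq]
  rw [hsum, IndepFun.variance_sum (fun l _ => hν.memLp_coord_sq l)
    fun i _ j _ hij => hind.indepFun hij]
  calc ∑ l : Fin d, variance (fun z : EuclideanSpace ℝ (Fin d) => z l ^ 2) (noiseLaw ν)
      ≤ ∑ l : Fin d, ∫ z, z l ^ 4 ∂(noiseLaw ν) := by
        refine Finset.sum_le_sum fun l _ => (variance_le_expectation_sq (by fun_prop)).trans_eq ?_
        simp only [Pi.pow_apply, ← pow_mul]
    _ ≤ ∑ l : Fin d, 96 * (varianceProxy C : ℝ) ^ 2 :=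
        Finset.sum_le_sum fun l _ => hν.integral_coord_pow_four_le l
    _ = _ := by simp; ring

lemma measureReal_lt_abs_norm_sq_sub_le (hν : IsSubGaussianNoise C ν) {T : ℝ} (hT : 0 < T) :
    (noiseLaw ν).real {z | T < |‖z‖ ^ 2 - d|} ≤ 96 * (varianceProxy C : ℝ) ^ 2 * d / T ^ 2 := by
  have := hν.isProbabilityMeasure_noiseLaw
  have hcheb := meas_ge_le_variance_div_sq hν.memLp_norm_sq hT
  rw [hν.integral_norm_sq] at hcheb
  calc (noiseLaw ν).real {z | T < |‖z‖ ^ 2 - d|}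
      ≤ variance (fun z => ‖z‖ ^ 2) (noiseLaw ν) / T ^ 2 :=
        ENNReal.toReal_le_of_le_ofReal (div_nonneg (variance_nonneg _ _) (sq_nonneg T)) <|
          hcheb.trans' <| measure_mono fun z (hz : T < |‖z‖ ^ 2 - d|) => hz.le
    _ ≤ _ := by gcongr; exact hν.variance_norm_sq_le

lemma exp_le_mgf_inner (hν : IsSubGaussianNoise C ν) {u : EuclideanSpace ℝ (Fin d)} (hu : ‖u‖ = 1)
    {θ : ℝ} (hθ : ∀ l, (θ * u l) ^ 2 ≤ min 8 (1 / (192 * (varianceProxy C : ℝ) ^ 2))) :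
    Real.exp (θ ^ 2 / 16) ≤ mgf (fun z => inner ℝ z u) (noiseLaw ν) θ := by
  have := hν.isProbabilityMeasure_noiseLaw
  have hv : (0 : ℝ) < varianceProxy C := varianceProxy_pos C
  have hmgf := exp_le_mgf_linearCombination (fun l => by fun_prop) hν.iIndepFun_coord
    hν.hasSubgaussianMGF_coord hν.integral_coord hν.integral_coord_sq hν.integral_coord_pow_four_le
    (fun l => (hθ l).trans (min_le_left _ _)) fun l => by
      have := (hθ l).trans (min_le_right _ _)
      rw [le_div_iff₀ (by positivity)] at this
      linarith
  rw [← norm_sq_eq_sum_sq, hu, one_pow, mul_one] at hmgf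
  simpa only [inner_eq_sum_mul] using hmgf

lemma le_measureReal_inner (hν : IsSubGaussianNoise C ν) {u : EuclideanSpace ℝ (Fin d)}
    (hu : ‖u‖ = 1) {K θ : ℝ} (hK : θ = 16 * (|K| + 1))
    (hθ : ∀ l, (θ * u l) ^ 2 ≤ min 8 (1 / (192 * (varianceProxy C : ℝ) ^ 2))) :
    Real.exp (-(2 * varianceProxy C * θ ^ 2)) ≤ (noiseLaw ν).real {z | K ≤ inner ℝ z u} := by
  have := hν.isProbabilityMeasure_noiseLaw
  have hsub : HasSubgaussianMGF (fun z => inner ℝ z u) (varianceProxy C) (noiseLaw ν) := by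
    simpa [show ‖u‖₊ = 1 from NNReal.eq hu] using hν.hasSubgaussianMGF_inner u
  refine exp_le_measureReal_of_le_mgf (by fun_prop) hsub (by rw [hK]; positivity) ?_
  refine le_trans ?_ (hν.exp_le_mgf_inner hu hθ)
  rw [hK]
  exact exp_mul_add_one_le_exp_sq K

end IsSubGaussianNoise

-- Without the bound on the coordinates of `s` this fails, e.g. for Rademacher noise and `s = e₁`.
lemma exists_forall_le_measureReal_inner (C : ℝ≥0) (K : ℝ) :
    ∃ p > 0, ∃ η > 0, ∀ {d : ℕ} {ν : Fin d → Measure ℝ}, IsSubGaussianNoise C ν →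
      ∀ s : EuclideanSpace ℝ (Fin d), s ≠ 0 → (∀ l, |s l| ≤ η * ‖s‖) →
        p ≤ (noiseLaw ν).real {z | K * ‖s‖ ≤ inner ℝ z s} := by
  have hv : (0 : ℝ) < varianceProxy C := varianceProxy_pos C
  have hθ : 0 < 16 * (|K| + 1) := by positivity
  set bound := min 8 (1 / (192 * (varianceProxy C : ℝ) ^ 2))
  have hbound : 0 < bound := by positivity
  refine ⟨Real.exp (-(2 * varianceProxy C * (16 * (|K| + 1)) ^ 2)), Real.exp_pos _,
    √bound / (16 * (|K| + 1)), by positivity, fun {d ν} hν s hs hdeloc => ?_⟩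
  have hs' : 0 < ‖s‖ := norm_pos_iff.2 hs
  have hu : ‖(‖s‖⁻¹ • s : EuclideanSpace ℝ (Fin d))‖ = 1 := by
    rw [norm_smul, norm_inv, norm_norm, inv_mul_cancel₀ hs'.ne']
  have hentry : ∀ l, (16 * (|K| + 1) * (‖s‖⁻¹ • s : EuclideanSpace ℝ (Fin d)) l) ^ 2 ≤ bound := by
    intro l
    rw [← sq_abs, ← Real.sq_sqrt hbound.le]
    gcongr
    rw [abs_mul, abs_of_pos hθ, PiLp.smul_apply, smul_eq_mul, abs_mul, abs_of_pos (inv_pos.2 hs'),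
      ← le_div_iff₀' hθ, inv_mul_le_iff₀ hs', mul_comm]
    exact hdeloc l
  convert hν.le_measureReal_inner hu rfl hentry using 2
  ext z
  simp only [Set.mem_ofPred_eq, real_inner_smul_right, inv_mul_eq_div, le_div_iff₀ hs']

end Noise

section Iid

variable {ι E : Type*} [Fintype ι] [MeasurableSpace E] {ρ : Measure E} [IsProbabilityMeasure ρ]

lemma memLp_sum_eval {V : Type*} [NormedAddCommGroup V] {g : E → V} {p : ℝ≥0∞}
    (hg : MemLp g p ρ) (A : Finset ι) :
    MemLp (fun Z : ι → E => ∑ i ∈ A, g (Z i)) p (Measure.pi fun _ => ρ) :=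
  memLp_finsetSum _ fun i _ => hg.comp_measurePreserving (measurePreserving_eval (fun _ => ρ) i)

lemma integral_sum_eval {f : E → ℝ} (hf : Integrable f ρ) (A : Finset ι) :
    ∫ Z : ι → E, ∑ i ∈ A, f (Z i) ∂(Measure.pi fun _ => ρ) = A.card * ∫ z, f z ∂ρ := by
  have hint : ∀ i : ι, Integrable (fun Z : ι → E => f (Z i)) (Measure.pi fun _ => ρ) := fun i =>
    (measurePreserving_eval (fun _ => ρ) i).integrable_comp_of_integrable hf
  rw [integral_finsetSum _ fun i _ => hint i, ← nsmul_eq_mul]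
  exact Finset.sum_eq_card_nsmul fun i _ =>
    integral_comp_eval (μ := fun _ : ι => ρ) hf.aestronglyMeasurable

lemma variance_sum_eval {f : E → ℝ} (hf : MemLp f 2 ρ) (A : Finset ι) :
    variance (fun Z : ι → E => ∑ i ∈ A, f (Z i)) (Measure.pi fun _ => ρ) =
      A.card * variance f ρ := by
  have hindep := iIndepFun_pi (μ := fun _ : ι => ρ) (X := fun _ => f)
    fun _ => hf.aestronglyMeasurable.aemeasurable
  have hsum := IndepFun.variance_sum (s := A)
    (fun i _ => hf.comp_measurePreserving (measurePreserving_eval (fun _ => ρ) i))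
    fun i _ j _ hij => hindep.indepFun hij
  have hfun : (fun Z : ι → E => ∑ i ∈ A, f (Z i)) = ∑ i ∈ A, f ∘ Function.eval i := by
    ext Z; simp
  rw [hfun, hsum, ← nsmul_eq_mul]
  exact Finset.sum_eq_card_nsmul fun i _ =>
    (measurePreserving_eval (fun _ => ρ) i).variance_fun_comp hf.aestronglyMeasurable.aemeasurable

lemma integral_sum_eval_sq_le {f : E → ℝ} (hf : MemLp f 2 ρ) (A : Finset ι) :
    ∫ Z : ι → E, (∑ i ∈ A, f (Z i)) ^ 2 ∂(Measure.pi fun _ => ρ) ≤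
      A.card * ∫ z, f z ^ 2 ∂ρ + (A.card : ℝ) ^ 2 * (∫ z, f z ∂ρ) ^ 2 := by
  have hvar := variance_eq_sub (memLp_sum_eval hf A)
  rw [variance_sum_eval hf, integral_sum_eval (hf.integrable one_le_two), mul_pow] at hvar
  have hle := mul_le_mul_of_nonneg_left
    (variance_le_expectation_sq hf.aestronglyMeasurable) (Nat.cast_nonneg (α := ℝ) A.card)
  simp only [Pi.pow_apply] at hvar hle
  linarith

lemma integral_norm_sum_eval_sq_le {d : ℕ} {g : E → EuclideanSpace ℝ (Fin d)}
    (hg : MemLp g 2 ρ) (A : Finset ι) :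
    ∫ Z : ι → E, ‖∑ i ∈ A, g (Z i)‖ ^ 2 ∂(Measure.pi fun _ => ρ) ≤
      A.card * ∫ z, ‖g z‖ ^ 2 ∂ρ + (A.card : ℝ) ^ 2 * ‖∫ z, g z ∂ρ‖ ^ 2 := by
  have hcoord : ∀ l, MemLp (fun z => g z l) 2 ρ := hg.eval_piLp
  simp only [norm_sq_eq_sum_sq, WithLp.ofLp_sum, Finset.sum_apply,
    eval_integral_piLp fun l => (hcoord l).integrable one_le_two]
  rw [integral_finsetSum _ fun l _ => (memLp_sum_eval (hcoord l) A).integrable_sq,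
    integral_finsetSum _ fun l _ => (hcoord l).integrable_sq, Finset.mul_sum, Finset.mul_sum,
    ← Finset.sum_add_distrib]
  exact Finset.sum_le_sum fun l _ => integral_sum_eval_sq_le (hcoord l) A

lemma measureReal_lt_norm_sum_eval_le {d : ℕ} {g : E → EuclideanSpace ℝ (Fin d)}
    (hg : MemLp g 2 ρ) (A : Finset ι) {r : ℝ} (hr : 0 < r) :
    (Measure.pi fun _ : ι => ρ).real {Z | r < ‖∑ i ∈ A, g (Z i)‖} ≤
      (A.card * ∫ z, ‖g z‖ ^ 2 ∂ρ + (A.card : ℝ) ^ 2 * ‖∫ z, g z ∂ρ‖ ^ 2) / r ^ 2 := by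
  rw [le_div_iff₀' (by positivity)]
  calc r ^ 2 * (Measure.pi fun _ : ι => ρ).real {Z | r < ‖∑ i ∈ A, g (Z i)‖}
      ≤ r ^ 2 * (Measure.pi fun _ : ι => ρ).real {Z | r ^ 2 ≤ ‖∑ i ∈ A, g (Z i)‖ ^ 2} := by
        refine mul_le_mul_of_nonneg_left (measureReal_mono fun Z hZ => ?_) (by positivity)
        exact pow_le_pow_left₀ hr.le (le_of_lt hZ) 2
    _ ≤ ∫ Z : ι → E, ‖∑ i ∈ A, g (Z i)‖ ^ 2 ∂(Measure.pi fun _ => ρ) :=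
        mul_meas_ge_le_integral_of_nonneg (Eventually.of_forall fun _ => by positivity)
          (memLp_sum_eval hg A).norm.integrable_sq _
    _ ≤ _ := integral_norm_sum_eval_sq_le hg A

lemma measureReal_half_le_abs_card_filter_sub_le {T : Set E} [DecidablePred (· ∈ T)]
    (hT : MeasurableSet T) (hT' : 0 < ρ.real T) {A : Finset ι} (hA : A.Nonempty) :
    (Measure.pi fun _ : ι => ρ).real
        {Z | ρ.real T * A.card / 2 ≤ |((A.filter fun i => Z i ∈ T).card : ℝ) - A.card * ρ.real T|} ≤
      4 / (ρ.real T * A.card) := by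
  have hcard : (0 : ℝ) < A.card := by exact_mod_cast hA.card_pos
  have hmem : MemLp (T.indicator (1 : E → ℝ)) 2 ρ :=
    memLp_indicator_const 2 hT 1 (Or.inr (measure_ne_top _ _))
  have hcount : ∀ Z : ι → E,
      ((A.filter fun i => Z i ∈ T).card : ℝ) = ∑ i ∈ A, T.indicator (1 : E → ℝ) (Z i) := fun Z => by
    simp [Set.indicator_apply, Finset.sum_boole]
  have hvar : variance (T.indicator (1 : E → ℝ)) ρ ≤ ρ.real T := by
    refine (variance_le_expectation_sq hmem.aestronglyMeasurable).trans_eq ?_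
    rw [← integral_indicator_one hT]
    congr 1 with z
    by_cases hz : z ∈ T <;> simp [hz]
  have hcheb := meas_ge_le_variance_div_sq (memLp_sum_eval hmem A)
    (show 0 < ρ.real T * A.card / 2 by positivity)
  rw [variance_sum_eval hmem, integral_sum_eval (hmem.integrable one_le_two),
    integral_indicator_one hT] at hcheb
  simp only [hcount]
  calc _ ≤ (A.card * variance (T.indicator (1 : E → ℝ)) ρ) / (ρ.real T * A.card / 2) ^ 2 :=
        ENNReal.toReal_le_of_le_ofReal
          (div_nonneg (mul_nonneg hcard.le (variance_nonneg _ _)) (sq_nonneg _)) hcheb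
    _ ≤ (A.card * ρ.real T) / (ρ.real T * A.card / 2) ^ 2 := by gcongr
    _ = 4 / (ρ.real T * A.card) := by field_simp; ring

lemma indepFun_sum_restrict {V : Type*} [AddCommMonoid V] [MeasurableSpace V] [MeasurableAdd₂ V]
    {g : E → V} (hg : Measurable g) {A B : Finset ι} (hAB : Disjoint A B) :
    IndepFun (fun Z : ι → E => ∑ i ∈ A, g (Z i)) (fun Z (j : B) => Z j)
      (Measure.pi fun _ => ρ) := by
  have hindep := (iIndepFun_pi (μ := fun _ : ι => ρ) (X := fun _ z => z) fun _ => by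
    fun_prop).indepFun_finset A B hAB fun i => by fun_prop
  have hsum : Measurable fun W : A → E => ∑ k, g (W k) := by fun_prop
  refine (hindep.comp hsum measurable_id).congr (ae_of_all _ fun Z => ?_) (ae_of_all _ fun _ => rfl)
  exact Finset.sum_coe_sort A fun k => g (Z k)

end Iid

section Tail

section Prod

variable {α β : Type*} [MeasurableSpace α] [MeasurableSpace β] {P : Measure α} {Q : Measure β}
  [IsProbabilityMeasure P] [IsProbabilityMeasure Q] {S : Set (α × β)} {δ : ℝ}

lemma measureReal_prod_le (hS : MeasurableSet S) (hδ : ∀ a, Q.real {b | (a, b) ∈ S} ≤ δ) :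
    (P.prod Q).real S ≤ δ := by
  obtain ⟨a₀⟩ : Nonempty α := nonempty_of_isProbabilityMeasure P
  refine ENNReal.toReal_le_of_le_ofReal (measureReal_nonneg.trans (hδ a₀)) ?_
  calc P.prod Q S = ∫⁻ a, Q (Prod.mk a ⁻¹' S) ∂P := Measure.prod_apply hS
    _ ≤ ∫⁻ _, ENNReal.ofReal δ ∂P := lintegral_mono fun a =>
        ENNReal.le_ofReal_iff_toReal_le (measure_ne_top _ _)
          (measureReal_nonneg.trans (hδ a)) |>.2 (hδ a)
    _ = ENNReal.ofReal δ := by simp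

lemma measureReal_prod_le_add [Countable α] [MeasurableSingletonClass α] (hδ : 0 ≤ δ) {B : Set α}
    (h : ∀ a ∉ B, Q.real {b | (a, b) ∈ S} ≤ δ) : (P.prod Q).real S ≤ P.real B + δ := by
  -- The slices need not be measurable, so they are replaced by measurable hulls.
  set T : Set (α × β) := {w | w.1 ∉ B ∧ w.2 ∈ toMeasurable Q {b | (w.1, b) ∈ S}} with hT
  have hTm : MeasurableSet T := by
    refine measurableSet_setOfPred.2 (measurable_from_prod_countable_right fun a => ?_)
    by_cases ha : a ∈ B <;> simp [ha]
  have hTδ : (P.prod Q).real T ≤ δ := measureReal_prod_le hTm fun a => by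
    by_cases ha : a ∈ B
    · simpa [hT, ha] using hδ
    · simpa [hT, ha, Measure.real, measure_toMeasurable] using h a ha
  calc (P.prod Q).real S ≤ (P.prod Q).real (B ×ˢ Set.univ ∪ T) := by
        refine measureReal_mono fun w hw => ?_
        by_cases hwB : w.1 ∈ B
        · exact Or.inl ⟨hwB, Set.mem_univ _⟩
        · exact Or.inr ⟨hwB, subset_toMeasurable Q _ hw⟩
    _ ≤ (P.prod Q).real (B ×ˢ Set.univ) + (P.prod Q).real T := measureReal_union_le _ _
    _ ≤ P.real B + δ := by simpa [measureReal_prod_prod] using hTδ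

end Prod

variable {Ω : Type*} {mΩ : MeasurableSpace Ω} {P : Measure Ω}

lemma measureReal_indepFun_le {α β : Type*} [MeasurableSpace α] [MeasurableSpace β]
    [IsProbabilityMeasure P] {X : Ω → α} {Y : Ω → β} (h : IndepFun X Y P) (hX : Measurable X)
    (hY : Measurable Y) {S : Set (α × β)} (hS : MeasurableSet S) {δ : ℝ}
    (hδ : ∀ x, P.real {ω | (x, Y ω) ∈ S} ≤ δ) : P.real {ω | (X ω, Y ω) ∈ S} ≤ δ := by
  have := Measure.isProbabilityMeasure_map (μ := P) hX.aemeasurable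
  have := Measure.isProbabilityMeasure_map (μ := P) hY.aemeasurable
  have hlaw : P.map (fun ω => (X ω, Y ω)) = (P.map X).prod (P.map Y) :=
    (indepFun_iff_map_prod_eq_prod_map_map hX.aemeasurable hY.aemeasurable).1 h
  calc P.real {ω | (X ω, Y ω) ∈ S} = ((P.map X).prod (P.map Y)).real S := by
        rw [← hlaw, map_measureReal_apply (hX.prodMk hY) hS]; rfl
    _ ≤ δ := measureReal_prod_le hS fun x => by
        exact (map_measureReal_apply hY (measurable_prodMk_left hS)).trans_le (hδ x)

lemma measureReal_exists_mem_le {ι : Type*} (s : Finset ι) (p : ι → Ω → Prop)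
    {δ : ℝ} (h : ∀ i ∈ s, P.real {ω | p i ω} ≤ δ) :
    P.real {ω | ∃ i ∈ s, p i ω} ≤ s.card * δ := by
  have hunion : {ω | ∃ i ∈ s, p i ω} = ⋃ i ∈ s, {ω | p i ω} := by ext; simp
  rw [hunion, ← nsmul_eq_mul]
  exact (measureReal_biUnion_finset_le s _).trans (Finset.sum_le_card_nsmul s _ δ h)

end Tail

section Sample

variable {d n : ℕ} {C : ℝ≥0} {ν : Fin d → Measure ℝ}

/-- The joint law of the noise vectors of a training set of size `n`. -/
noncomputable abbrev noiseSample (n : ℕ) (ν : Fin d → Measure ℝ) :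
    Measure (Fin n → EuclideanSpace ℝ (Fin d)) :=
  Measure.pi fun _ => noiseLaw ν

namespace IsSubGaussianNoise

lemma memLp_id (hν : IsSubGaussianNoise C ν) :
    MemLp (fun z : EuclideanSpace ℝ (Fin d) => z) 2 (noiseLaw ν) :=
  MemLp.of_eval_piLp hν.memLp_coord

lemma integral_id_eq_zero (hν : IsSubGaussianNoise C ν) : ∫ z, z ∂(noiseLaw ν) = 0 := by
  have := hν.isProbabilityMeasure_noiseLaw
  ext l
  rw [eval_integral_piLp fun l => (hν.memLp_coord l).integrable one_le_two, hν.integral_coord]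
  rfl

-- Isotropy: for `a = 𝔼[z; z ∈ B]`, `‖a‖ ^ 2 = 𝔼[⟪z, a⟫; z ∈ B] ≤ (1 + 𝔼 ⟪z, a⟫ ^ 2) / 2`.
lemma norm_setIntegral_le_one (hν : IsSubGaussianNoise C ν) (B : Set (EuclideanSpace ℝ (Fin d))) :
    ‖∫ z in B, z ∂(noiseLaw ν)‖ ≤ 1 := by
  have := hν.isProbabilityMeasure_noiseLaw
  set a := ∫ z in B, z ∂(noiseLaw ν)
  have hint : Integrable (fun z => inner ℝ z a ^ 2) (noiseLaw ν) :=
    ((hν.hasSubgaussianMGF_inner a).memLp 2).integrable_sq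
  have hint' : Integrable (fun z => (1 + inner ℝ z a ^ 2) / 2) (noiseLaw ν) :=
    ((integrable_const 1).add hint).div_const 2
  have hid := hν.memLp_id.integrable one_le_two
  have hsq : ‖a‖ ^ 2 ≤ (1 + ‖a‖ ^ 2) / 2 :=
    calc ‖a‖ ^ 2 = ∫ z in B, inner ℝ z a ∂(noiseLaw ν) := by
          rw [← real_inner_self_eq_norm_sq, ← _root_.integral_inner hid.integrableOn]
          simp_rw [real_inner_comm]
      _ ≤ ∫ z in B, (1 + inner ℝ z a ^ 2) / 2 ∂(noiseLaw ν) :=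
          integral_mono (hid.inner_const a).integrableOn hint'.integrableOn fun z => by
            simp only
            linarith [two_mul_le_add_sq 1 (inner ℝ z a)]
      _ ≤ ∫ z, (1 + inner ℝ z a ^ 2) / 2 ∂(noiseLaw ν) :=
          setIntegral_le_integral hint' (ae_of_all _ fun z => by positivity)
      _ = (1 + ‖a‖ ^ 2) / 2 := by
          rw [integral_div, integral_add (integrable_const 1) hint, hν.integral_inner_sq]
          simp
  exact (sq_le_one_iff₀ (norm_nonneg a)).1 (by linarith)

lemma measureReal_lt_norm_sum_le (hν : IsSubGaussianNoise C ν) (A : Finset (Fin n)) {r : ℝ}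
    (hr : 0 < r) : (noiseSample n ν).real {Z | r < ‖∑ i ∈ A, Z i‖} ≤ A.card * d / r ^ 2 := by
  have := hν.isProbabilityMeasure_noiseLaw
  simpa [hν.integral_norm_sq, hν.integral_id_eq_zero] using
    measureReal_lt_norm_sum_eval_le hν.memLp_id A hr

lemma measureReal_lt_norm_sum_filter_le (hν : IsSubGaussianNoise C ν)
    {B : Set (EuclideanSpace ℝ (Fin d))} [DecidablePred (· ∈ B)] (hB : MeasurableSet B)
    (A : Finset (Fin n)) {r : ℝ} (hr : 0 < r) :
    (noiseSample n ν).real {Z | r < ‖∑ i ∈ A with Z i ∈ B, Z i‖} ≤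
      (A.card * d + (A.card : ℝ) ^ 2) / r ^ 2 := by
  have := hν.isProbabilityMeasure_noiseLaw
  have hbound := measureReal_lt_norm_sum_eval_le (hν.memLp_id.indicator hB) A hr
  simp only [Set.indicator_apply, ← Finset.sum_filter] at hbound
  refine hbound.trans ?_
  gcongr
  · rw [← hν.integral_norm_sq]
    refine integral_mono_of_nonneg (ae_of_all _ fun z => by positivity)
      (hν.memLp_norm_sq.integrable one_le_two) (ae_of_all _ fun z => ?_)
    by_cases hz : z ∈ B <;> simp [hz]
  · refine mul_le_of_le_one_right (by positivity) ?_
    simp_rw [← Set.indicator_apply B fun z : EuclideanSpace ℝ (Fin d) => z]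
    rw [integral_indicator hB, sq_le_one_iff₀ (norm_nonneg _)]
    exact hν.norm_setIntegral_le_one B

lemma measureReal_eval (hν : IsSubGaussianNoise C ν) (i : Fin n)
    {p : EuclideanSpace ℝ (Fin d) → Prop} (hp : MeasurableSet {z | p z}) :
    (noiseSample n ν).real {Z | p (Z i)} = (noiseLaw ν).real {z | p z} :=
  have := hν.isProbabilityMeasure_noiseLaw
  (measurePreserving_eval (fun _ : Fin n => noiseLaw ν) i).measureReal_preimage
    hp.nullMeasurableSet

lemma measureReal_exists_lt_abs_inner_le (hν : IsSubGaussianNoise C ν)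
    (u : EuclideanSpace ℝ (Fin d)) {t : ℝ} (ht : 0 ≤ t) :
    (noiseSample n ν).real {Z | ∃ i, t * ‖u‖ < |inner ℝ (Z i) u|} ≤
      n * (2 * Real.exp (-t ^ 2 / (2 * varianceProxy C))) := by
  have hunion := measureReal_exists_mem_le (P := noiseSample n ν) Finset.univ
    (fun i Z => t * ‖u‖ < |inner ℝ (Z i) u|) fun i _ =>
      (hν.measureReal_eval i (p := fun z => t * ‖u‖ < |inner ℝ z u|)
      (measurableSet_lt (by fun_prop) (by fun_prop))).trans_le
        (hν.measureReal_lt_abs_inner_le u ht)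
  simpa using hunion

lemma measureReal_lt_abs_inner_sum_erase_le (hν : IsSubGaussianNoise C ν)
    (w : EuclideanSpace ℝ (Fin d)) (A : Finset (Fin n)) (i : Fin n) {t : ℝ} (ht : 0 ≤ t) :
    (noiseSample n ν).real {Z | t * ‖∑ k ∈ A.erase i, (w + Z k)‖ <
        |inner ℝ (Z i) (∑ k ∈ A.erase i, (w + Z k))|} ≤
      2 * Real.exp (-t ^ 2 / (2 * varianceProxy C)) := by
  have := hν.isProbabilityMeasure_noiseLaw
  have hindep : IndepFun (fun Z => ∑ k ∈ A.erase i, (w + Z k)) (fun Z => Z i)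
      (noiseSample n ν) :=
    (indepFun_sum_restrict (ρ := noiseLaw ν) (g := fun z => w + z) (by fun_prop)
      (show Disjoint (A.erase i) {i} by simp)).comp measurable_id
        (measurable_pi_apply (⟨i, Finset.mem_singleton_self i⟩ : ({i} : Finset (Fin n))))
  refine measureReal_indepFun_le hindep (by fun_prop) (by fun_prop)
    (S := {p | t * ‖p.1‖ < |inner ℝ p.2 p.1|})
    (measurableSet_lt (by fun_prop) (by fun_prop)) fun u => ?_
  exact (hν.measureReal_eval i (p := fun z => t * ‖u‖ < |inner ℝ z u|)
    (measurableSet_lt (by fun_prop) (by fun_prop))).trans_le (hν.measureReal_lt_abs_inner_le u ht)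

lemma measureReal_exists_lt_abs_inner_sum_erase_le (hν : IsSubGaussianNoise C ν)
    (w : EuclideanSpace ℝ (Fin d)) (A : Finset (Fin n)) {t : ℝ} (ht : 0 ≤ t) :
    (noiseSample n ν).real {Z | ∃ i, t * ‖∑ k ∈ A.erase i, (w + Z k)‖ <
        |inner ℝ (Z i) (∑ k ∈ A.erase i, (w + Z k))|} ≤
      n * (2 * Real.exp (-t ^ 2 / (2 * varianceProxy C))) := by
  have hunion := measureReal_exists_mem_le (P := noiseSample n ν) Finset.univ
    (fun i Z => t * ‖∑ k ∈ A.erase i, (w + Z k)‖ <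
        |inner ℝ (Z i) (∑ k ∈ A.erase i, (w + Z k))|)
    fun i _ => hν.measureReal_lt_abs_inner_sum_erase_le w A i ht
  simpa using hunion

lemma measureReal_exists_lt_abs_norm_sq_sub_le (hν : IsSubGaussianNoise C ν)
    (A : Finset (Fin n)) {T : ℝ} (hT : 0 < T) :
    (noiseSample n ν).real {Z | ∃ i ∈ A, T < |‖Z i‖ ^ 2 - d|} ≤
      A.card * (96 * (varianceProxy C : ℝ) ^ 2 * d / T ^ 2) := by
  refine measureReal_exists_mem_le (P := noiseSample n ν) A
    (fun i Z => T < |‖Z i‖ ^ 2 - d|) fun i _ => ?_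
  rw [hν.measureReal_eval i (p := fun z => T < |‖z‖ ^ 2 - d|)
    (measurableSet_lt (by fun_prop) (by fun_prop))]
  exact hν.measureReal_lt_abs_norm_sq_sub_le hT

lemma measureReal_exists_lt_abs_sum_coord_le (hν : IsSubGaussianNoise C ν)
    {A : Finset (Fin n)} (hA : A.Nonempty) {t : ℝ} (ht : 0 ≤ t) :
    (noiseSample n ν).real {Z | ∃ l, t * √A.card < |(∑ i ∈ A, Z i) l|} ≤
      d * (2 * Real.exp (-t ^ 2 / (2 * varianceProxy C))) := by
  have := hν.isProbabilityMeasure_noiseLaw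
  have hv : (0 : ℝ) < varianceProxy C := varianceProxy_pos C
  have hcard : (0 : ℝ) < A.card := by exact_mod_cast hA.card_pos
  have hindep : ∀ l, iIndepFun (fun (i : Fin n) Z => Z i l) (noiseSample n ν) := fun l =>
    iIndepFun_pi (X := fun _ (z : EuclideanSpace ℝ (Fin d)) => z l) fun _ => by fun_prop
  have hsub : ∀ l (i : Fin n), HasSubgaussianMGF (fun Z => Z i l) (varianceProxy C)
      (noiseSample n ν) := fun l i => by
    have hmap := (measurePreserving_eval (fun _ : Fin n => noiseLaw ν) i).map_eq
    exact HasSubgaussianMGF.of_map (X := fun z : EuclideanSpace ℝ (Fin d) => z l)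
      (μ := noiseSample n ν) (Y := Function.eval i)
      (measurable_pi_apply i).aemeasurable (hmap.symm ▸ hν.hasSubgaussianMGF_coord l)
  have hunion := measureReal_exists_mem_le (P := noiseSample n ν) Finset.univ
    (fun l Z => t * √A.card < |(∑ i ∈ A, Z i) l|)
    (δ := 2 * Real.exp (-t ^ 2 / (2 * varianceProxy C))) fun l _ => by
      have hsum : HasSubgaussianMGF (fun Z => (∑ i ∈ A, Z i) l) (varianceProxy C * A.card)
          (noiseSample n ν) := by
        simpa using hasSubgaussianMGF_linearCombination (hindep l) (hsub l) A (fun _ => 1)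
          (r := A.card) (by simp)
      refine (measureReal_lt_abs_le hsum (by positivity)).trans_eq ?_
      congr 2
      rw [mul_pow, Real.sq_sqrt hcard.le]
      simp only [NNReal.coe_mul, NNReal.coe_natCast]
      field_simp
  simpa using hunion

end IsSubGaussianNoise

end Sample

section Exceedance

variable {d n : ℕ} {C : ℝ≥0} {ν : Fin d → Measure ℝ}

/-- The indices in `B` of the vectors whose component in the direction of `s` is at least `K`. -/
noncomputable def exceedances {ι : Type*} (K : ℝ) (s : EuclideanSpace ℝ (Fin d))
    (Z : ι → EuclideanSpace ℝ (Fin d)) (B : Finset ι) : Finset ι :=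
  B.filter fun j => K * ‖s‖ ≤ inner ℝ (Z j) s

lemma IsSubGaussianNoise.measureReal_card_exceedances_lt_le (hν : IsSubGaussianNoise C ν)
    {K p : ℝ} {s : EuclideanSpace ℝ (Fin d)} (hp : 0 < p)
    (hs : p ≤ (noiseLaw ν).real {z | K * ‖s‖ ≤ inner ℝ z s}) {B : Finset (Fin n)}
    (hB : B.Nonempty) :
    (noiseSample n ν).real {Z | (exceedances K s Z B).card < p / 2 * B.card} ≤
      4 / (p * B.card) := by
  have := hν.isProbabilityMeasure_noiseLaw
  have hcard : (0 : ℝ) < B.card := by exact_mod_cast hB.card_pos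
  have hfreq := measureReal_half_le_abs_card_filter_sub_le (ρ := noiseLaw ν)
    (T := {z | K * ‖s‖ ≤ inner ℝ z s}) (measurableSet_le (by fun_prop) (by fun_prop))
    (hp.trans_le hs) hB
  refine (measureReal_mono fun Z hZ => ?_).trans (hfreq.trans ?_)
  · simp only [Set.mem_ofPred_eq, exceedances] at hZ ⊢
    rw [abs_sub_comm]
    refine le_trans ?_ (le_abs_self _)
    have := mul_le_mul_of_nonneg_right hs hcard.le
    linarith
  · gcongr

lemma IsSubGaussianNoise.measureReal_lt_norm_sum_exceedances_le (hν : IsSubGaussianNoise C ν)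
    (K : ℝ) (s : EuclideanSpace ℝ (Fin d)) {B : Finset (Fin n)} (hB : B.Nonempty) {t : ℝ}
    (ht : 0 < t) :
    (noiseSample n ν).real {Z | t * B.card < ‖∑ j ∈ exceedances K s Z B, Z j‖} ≤
      (d / B.card + 1) / t ^ 2 := by
  have : (0 : ℝ) < B.card := by exact_mod_cast hB.card_pos
  refine (hν.measureReal_lt_norm_sum_filter_le (B := {z | K * ‖s‖ ≤ inner ℝ z s})
    (measurableSet_le (by fun_prop) (by fun_prop)) B (by positivity)).trans_eq ?_
  field_simp

lemma measurable_sum_ite_le_inner {ι V : Type*} [Fintype ι] [AddCommMonoid V]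
    [MeasurableSpace V] [MeasurableAdd₂ V] (K : ℝ) {f : EuclideanSpace ℝ (Fin d) → V}
    (hf : Measurable f) :
    Measurable fun q : EuclideanSpace ℝ (Fin d) × (ι → EuclideanSpace ℝ (Fin d)) =>
      ∑ j, if K * ‖q.1‖ ≤ inner ℝ (q.2 j) q.1 then f (q.2 j) else 0 :=
  Finset.measurable_sum _ fun j _ =>
    Measurable.ite (measurableSet_le (by fun_prop) (by fun_prop)) (by fun_prop) measurable_const

/-- No entry of `s` carries more than a fraction `η` of the norm of `s`. -/
def IsDelocalized (η : ℝ) (s : EuclideanSpace ℝ (Fin d)) : Prop :=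
  s ≠ 0 ∧ ∀ l, |s l| ≤ η * ‖s‖

/-- At least a proportion `p / 2` of the vectors with index in `B` exceed the level `K` in the
direction of `s`, and their sum is at most of order `t * #B`. -/
def IsExceeded {ι : Type*} (K p t : ℝ) (s : EuclideanSpace ℝ (Fin d))
    (Z : ι → EuclideanSpace ℝ (Fin d)) (B : Finset ι) : Prop :=
  p / 2 * B.card ≤ (exceedances K s Z B).card ∧
    ‖∑ j ∈ exceedances K s Z B, Z j‖ ≤ t * B.card

lemma measurableSet_isDelocalized_and_not_isExceeded (η K p t : ℝ) (B : Finset (Fin n)) :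
    MeasurableSet {q : EuclideanSpace ℝ (Fin d) × (B → EuclideanSpace ℝ (Fin d)) |
      IsDelocalized η q.1 ∧ ¬ IsExceeded K p t q.1 q.2 Finset.univ} := by
  have hcount := measurable_sum_ite_le_inner (d := d) (ι := B) K
    (measurable_const : Measurable fun _ => (1 : ℝ))
  have hsum := measurable_sum_ite_le_inner (d := d) (ι := B) K measurable_id
  simp only [IsDelocalized, IsExceeded, exceedances, Finset.sum_filter, Finset.card_filter,
    Nat.cast_sum, Nat.cast_ite, Nat.cast_one, Nat.cast_zero]
  refine .inter (.inter ?_ ?_) (.compl (.inter ?_ ?_))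
  · exact measurable_fst (measurableSet_singleton 0).compl
  · refine .congr (.iInter fun l => ?_) (Set.ofPred_forall _).symm
    exact measurableSet_le (by fun_prop) (by fun_prop)
  · exact measurableSet_le measurable_const hcount
  · exact measurableSet_le hsum.norm measurable_const

lemma isExceeded_restrict_iff {ι : Type*} (K p t : ℝ) (s : EuclideanSpace ℝ (Fin d))
    (Z : ι → EuclideanSpace ℝ (Fin d)) (B : Finset ι) :
    IsExceeded K p t s (fun j : B => Z j) Finset.univ ↔ IsExceeded K p t s Z B := by
  simp only [IsExceeded, exceedances, Finset.sum_filter, Finset.card_filter, Finset.card_univ,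
    Fintype.card_coe, Finset.sum_coe_sort B fun j => if K * ‖s‖ ≤ inner ℝ (Z j) s then 1 else 0,
    Finset.sum_coe_sort B fun j => if K * ‖s‖ ≤ inner ℝ (Z j) s then Z j else 0]

lemma IsSubGaussianNoise.measureReal_not_isExceeded_le (hν : IsSubGaussianNoise C ν)
    {K p : ℝ} {s : EuclideanSpace ℝ (Fin d)} (hp : 0 < p)
    (hs : p ≤ (noiseLaw ν).real {z | K * ‖s‖ ≤ inner ℝ z s}) {B : Finset (Fin n)}
    (hB : B.Nonempty) {t : ℝ} (ht : 0 < t) :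
    (noiseSample n ν).real {Z | ¬ IsExceeded K p t s Z B} ≤
      4 / (p * B.card) + (d / B.card + 1) / t ^ 2 := by
  have := hν.isProbabilityMeasure_noiseLaw
  simp only [IsExceeded, not_and_or, not_le]
  exact (measureReal_union_le _ _).trans <| add_le_add
    (hν.measureReal_card_exceedances_lt_le hp hs hB)
    (hν.measureReal_lt_norm_sum_exceedances_le K s hB ht)

lemma exists_forall_measureReal_not_isExceeded_le (C : ℝ≥0) (K : ℝ) :
    ∃ p > 0, ∃ η > 0, ∀ {d n : ℕ} {ν : Fin d → Measure ℝ}, IsSubGaussianNoise C ν →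
      ∀ {A B : Finset (Fin n)}, Disjoint A B → B.Nonempty → ∀ {t : ℝ}, 0 < t →
        (noiseSample n ν).real {Z | IsDelocalized η (∑ i ∈ A, Z i) ∧
          ¬ IsExceeded K p t (∑ i ∈ A, Z i) Z B} ≤ 4 / (p * B.card) + (d / B.card + 1) / t ^ 2 := by
  obtain ⟨p, hp, η, hη, hmain⟩ := exists_forall_le_measureReal_inner C K
  refine ⟨p, hp, η, hη, fun {d n ν} hν A B hAB hB t ht => ?_⟩
  have := hν.isProbabilityMeasure_noiseLaw
  refine (measureReal_mono fun Z hZ => ?_).trans <|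
    measureReal_indepFun_le (P := noiseSample n ν)
      (indepFun_sum_restrict measurable_id hAB) (by fun_prop) (by fun_prop)
      (measurableSet_isDelocalized_and_not_isExceeded η K p t B) fun s => ?_
  · simpa only [id_eq, Set.mem_ofPred_eq, isExceeded_restrict_iff] using hZ
  by_cases hs : IsDelocalized η s
  · simpa only [Set.mem_ofPred_eq, hs, true_and, isExceeded_restrict_iff] using
      hν.measureReal_not_isExceeded_le hp (hmain hν s hs.1 hs.2) hB ht
  · simp only [Set.mem_ofPred_eq, hs, false_and, Set.ofPred_false, measureReal_empty]
    positivity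

end Exceedance

/-! ### Geometry of the support vector machine -/

section MeanNoise

variable {ι E : Type*} [NormedAddCommGroup E] [InnerProductSpace ℝ E] {A : Finset ι} {Z : ι → E}

/-- The average of the noise vectors with index in `A`. -/
noncomputable def meanNoise (A : Finset ι) (Z : ι → E) : E :=
  (A.card : ℝ)⁻¹ • ∑ i ∈ A, Z i

lemma card_smul_meanNoise (hA : A.Nonempty) (Z : ι → E) :
    (A.card : ℝ) • meanNoise A Z = ∑ i ∈ A, Z i := by
  rw [meanNoise, smul_inv_smul₀ (by exact_mod_cast hA.card_ne_zero)]

lemma norm_meanNoise (A : Finset ι) (Z : ι → E) :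
    ‖meanNoise A Z‖ = ‖∑ i ∈ A, Z i‖ / A.card := by
  rw [meanNoise, norm_smul, norm_inv, RCLike.norm_natCast, inv_mul_eq_div]

lemma le_inner_meanNoise (hA : A.Nonempty) {a : ℝ} {u : E} (h : ∀ i ∈ A, a ≤ inner ℝ (Z i) u) :
    a ≤ inner ℝ (meanNoise A Z) u := by
  rw [meanNoise, real_inner_smul_left, sum_inner, inv_mul_eq_div,
    le_div_iff₀ (by exact_mod_cast hA.card_pos), mul_comm, ← nsmul_eq_mul]
  exact Finset.card_nsmul_le_sum _ _ _ h

lemma inner_meanNoise_le (hA : A.Nonempty) {a : ℝ} {u : E} (h : ∀ i ∈ A, inner ℝ (Z i) u ≤ a) :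
    inner ℝ (meanNoise A Z) u ≤ a := by
  have := le_inner_meanNoise (Z := Z) (u := -u) hA (a := -a) fun i hi => by
    rw [inner_neg_right]; exact neg_le_neg (h i hi)
  rwa [inner_neg_right, neg_le_neg_iff] at this

lemma abs_inner_meanNoise_sub_le (hA : A.Nonempty) {a r : ℝ} {u : E}
    (h : ∀ i ∈ A, |inner ℝ (Z i) u - a| ≤ r) : |inner ℝ (meanNoise A Z) u - a| ≤ r := by
  have hlower := le_inner_meanNoise hA fun i hi => sub_le_of_abs_sub_le_left (h i hi)
  have hupper := inner_meanNoise_le hA fun i hi =>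
    sub_le_iff_le_add'.1 (abs_le.1 (h i hi)).2
  exact abs_le.2 ⟨by linarith, by linarith⟩

lemma abs_real_inner_le_norm_of_norm_le_one {v : E} (u : E) (hv : ‖v‖ ≤ 1) :
    |inner ℝ u v| ≤ ‖u‖ :=
  (abs_real_inner_le_norm u v).trans (mul_le_of_le_one_right (norm_nonneg _) hv)

lemma norm_inv_norm_smul {u : E} (hu : 0 < ‖u‖) : ‖‖u‖⁻¹ • u‖ = 1 := by
  rw [norm_smul, norm_inv, norm_norm, inv_mul_cancel₀ hu.ne']

lemma norm_sub_inv_norm_smul_sq_le {u v : E} (hv : ‖v‖ ≤ 1) (hu : 0 < ‖u‖) {a : ℝ}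
    (h : ‖u‖ - a ≤ inner ℝ u v) : ‖v - ‖u‖⁻¹ • u‖ ^ 2 ≤ 2 * a / ‖u‖ := by
  have hinner : 2 * inner ℝ v (‖u‖⁻¹ • u) = 2 * inner ℝ u v / ‖u‖ := by
    rw [real_inner_smul_right, real_inner_comm]
    ring
  have hle : 2 - 2 * a / ‖u‖ ≤ 2 * inner ℝ u v / ‖u‖ := by
    rw [sub_le_iff_le_add, ← add_div, le_div_iff₀ hu]
    linarith
  have hsq : ‖v‖ ^ 2 ≤ 1 := pow_le_one₀ (norm_nonneg _) hv
  rw [norm_sub_sq_real, hinner, norm_inv_norm_smul hu]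
  linarith

end MeanNoise

section TrainingSet

variable {d n : ℕ} {μ : EuclideanSpace ℝ (Fin d)} {y : Fin n → Bool}
  {Z : Fin n → EuclideanSpace ℝ (Fin d)} {t : ℝ}

/-- The training set with labels `y` and noise vectors `Z`. -/
noncomputable def trainingSet (μ : EuclideanSpace ℝ (Fin d)) (y : Fin n → Bool)
    (Z : Fin n → EuclideanSpace ℝ (Fin d)) : Fin n → Point d :=
  fun i => (label (y i) • μ + Z i, y i)

/-- The indices of the points with label `+1`. -/
def minorityIdx (y : Fin n → Bool) : Finset (Fin n) := {i | y i = true}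

/-- The indices of the points with label `-1`. -/
def majorityIdx (y : Fin n → Bool) : Finset (Fin n) := {i | y i = false}

@[simp] lemma mem_minorityIdx {i : Fin n} : i ∈ minorityIdx y ↔ y i = true := by
  simp [minorityIdx]

@[simp] lemma mem_majorityIdx {i : Fin n} : i ∈ majorityIdx y ↔ y i = false := by
  simp [majorityIdx]

lemma disjoint_minorityIdx_majorityIdx (y : Fin n → Bool) :
    Disjoint (minorityIdx y) (majorityIdx y) :=
  Finset.disjoint_left.2 fun i hi hj => by simp_all

lemma card_minorityIdx_add_card_majorityIdx (y : Fin n → Bool) :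
    (minorityIdx y).card + (majorityIdx y).card = n := by
  simpa [minorityIdx, majorityIdx] using
    Finset.card_filter_add_card_filter_not (s := Finset.univ) (p := fun i => y i = true)

/-- The vector joining the centre `-μ` of the majority class to the empirical mean of the minority
class. -/
noncomputable def centerDiff (μ : EuclideanSpace ℝ (Fin d)) (y : Fin n → Bool)
    (Z : Fin n → EuclideanSpace ℝ (Fin d)) : EuclideanSpace ℝ (Fin d) :=
  (2 : ℝ) • μ + meanNoise (minorityIdx y) Z

lemma card_smul_centerDiff (hmin : (minorityIdx y).Nonempty)
    (μ : EuclideanSpace ℝ (Fin d)) (Z : Fin n → EuclideanSpace ℝ (Fin d)) :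
    ((minorityIdx y).card : ℝ) • centerDiff μ y Z =
      ∑ i ∈ minorityIdx y, ((2 : ℝ) • μ + Z i) := by
  rw [centerDiff, smul_add, card_smul_meanNoise hmin, Finset.sum_add_distrib, Finset.sum_const,
    Nat.cast_smul_eq_nsmul]

/-- The mean noise of the majority class is small, and the noise is almost orthogonal to the
signal. -/
structure IsTypical (t : ℝ) (μ : EuclideanSpace ℝ (Fin d)) (y : Fin n → Bool)
    (Z : Fin n → EuclideanSpace ℝ (Fin d)) : Prop where
  norm_meanNoise_majority_le : ‖meanNoise (majorityIdx y) Z‖ ≤ 1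
  abs_inner_signal_le : ∀ i, |inner ℝ (Z i) μ| ≤ t * ‖μ‖

/-- The noise vectors of the minority class have almost the same norm, and each noise vector is
almost orthogonal to the sum over the minority class of the other ones. -/
structure IsSpread (t : ℝ) (μ : EuclideanSpace ℝ (Fin d)) (y : Fin n → Bool)
    (Z : Fin n → EuclideanSpace ℝ (Fin d)) : Prop where
  abs_inner_sum_erase_le : ∀ i,
    |inner ℝ (Z i) (∑ k ∈ (minorityIdx y).erase i, ((2 : ℝ) • μ + Z k))| ≤
      t * ‖∑ k ∈ (minorityIdx y).erase i, ((2 : ℝ) • μ + Z k)‖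
  abs_norm_sq_sub_le : ∀ i ∈ minorityIdx y,
    |‖Z i‖ ^ 2 - d| ≤ t * √((minorityIdx y).card * d)

lemma IsSpread.abs_inner_centerDiff_le_of_mem_majorityIdx (h : IsSpread t μ y Z)
    (hmin : (minorityIdx y).Nonempty) {j : Fin n} (hj : j ∈ majorityIdx y) :
    |inner ℝ (Z j) (centerDiff μ y Z)| ≤ t * ‖centerDiff μ y Z‖ := by
  have hcard : (0 : ℝ) < (minorityIdx y).card := by exact_mod_cast hmin.card_pos
  have hnotMem : j ∉ minorityIdx y :=
    Finset.disjoint_right.1 (disjoint_minorityIdx_majorityIdx y) hj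
  have hsum := h.abs_inner_sum_erase_le j
  rw [Finset.erase_eq_of_notMem hnotMem, ← card_smul_centerDiff hmin, real_inner_smul_right,
    abs_mul, norm_smul, RCLike.norm_natCast, Nat.abs_cast, mul_left_comm] at hsum
  exact le_of_mul_le_mul_left hsum hcard

lemma IsSpread.norm_le (h : IsSpread t μ y Z) {i : Fin n} (hi : i ∈ minorityIdx y)
    (ht : t * √((minorityIdx y).card * d) ≤ d) : ‖Z i‖ ≤ 2 * √d := by
  have hupper := (abs_le.1 (h.abs_norm_sq_sub_le i hi)).2
  refine abs_le_of_sq_le_sq' ?_ (by positivity) |>.2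
  rw [mul_pow, Real.sq_sqrt (Nat.cast_nonneg d)]
  linarith

lemma IsSpread.abs_card_mul_inner_centerDiff_sub_le (h : IsSpread t μ y Z)
    (htyp : IsTypical t μ y Z) (ht : 0 ≤ t) (htd : t * √((minorityIdx y).card * d) ≤ d)
    {i : Fin n} (hi : i ∈ minorityIdx y) :
    |(minorityIdx y).card * inner ℝ (Z i) (centerDiff μ y Z) - d| ≤
      t * ((minorityIdx y).card * ‖centerDiff μ y Z‖ + 4 * ‖μ‖ + 2 * √d +
        √((minorityIdx y).card * d)) := by
  have hcard := card_smul_centerDiff ⟨i, hi⟩ μ Z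
  have herase : ∑ k ∈ (minorityIdx y).erase i, ((2 : ℝ) • μ + Z k) =
      ((minorityIdx y).card : ℝ) • centerDiff μ y Z - ((2 : ℝ) • μ + Z i) := by
    rw [hcard, ← Finset.add_sum_erase _ _ hi, add_sub_cancel_left]
  have hcross := h.abs_inner_sum_erase_le i
  have hinner : (minorityIdx y).card * inner ℝ (Z i) (centerDiff μ y Z) =
      inner ℝ (Z i) (∑ k ∈ (minorityIdx y).erase i, ((2 : ℝ) • μ + Z k)) +
        2 * inner ℝ (Z i) μ + ‖Z i‖ ^ 2 := by
    rw [herase, inner_sub_right, inner_add_right, real_inner_smul_right, real_inner_smul_right,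
      real_inner_self_eq_norm_sq]
    ring
  have hnorm : ‖∑ k ∈ (minorityIdx y).erase i, ((2 : ℝ) • μ + Z k)‖ ≤
      (minorityIdx y).card * ‖centerDiff μ y Z‖ + (2 * ‖μ‖ + 2 * √d) := by
    rw [herase]
    refine (norm_sub_le _ _).trans (add_le_add ?_ ((norm_add_le _ _).trans ?_))
    · rw [norm_smul, RCLike.norm_natCast]
    · rw [norm_smul, Real.norm_ofNat]
      linarith [h.norm_le hi htd]
  have hcross := hcross.trans (mul_le_mul_of_nonneg_left hnorm ht)
  have hsignal := htyp.abs_inner_signal_le i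
  have hsq := h.abs_norm_sq_sub_le i hi
  rw [hinner]
  rw [abs_le] at hcross hsignal hsq ⊢
  constructor <;> linarith

lemma IsSpread.abs_inner_centerDiff_sub_le (h : IsSpread t μ y Z) (htyp : IsTypical t μ y Z)
    (ht : 0 ≤ t) (htd : t ≤ √(d / (minorityIdx y).card))
    (hμ : ‖μ‖ ≤ √(d / (minorityIdx y).card)) {i : Fin n} (hi : i ∈ minorityIdx y) :
    |inner ℝ (Z i) (centerDiff μ y Z) - √(d / (minorityIdx y).card) ^ 2| ≤
      t * (‖centerDiff μ y Z‖ + 7 * √(d / (minorityIdx y).card)) := by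
  set N : ℝ := ((minorityIdx y).card : ℝ) with hN
  set l : ℝ := √(d / N) with hl
  have hN1 : 1 ≤ N := by rw [hN]; exact_mod_cast Finset.card_pos.2 ⟨i, hi⟩
  have hl0 : 0 ≤ l := Real.sqrt_nonneg _
  have hl2 : N * l ^ 2 = d := by
    rw [hl, Real.sq_sqrt (by positivity), mul_div_cancel₀ _ (by positivity)]
  have hsqrt_mul : √(N * d) = N * l := by
    rw [← hl2, show N * (N * l ^ 2) = (N * l) ^ 2 by ring, Real.sqrt_sq (by positivity)]
  have hsqrt : √d ≤ N * l := by
    rw [← hsqrt_mul]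
    exact Real.sqrt_le_sqrt (le_mul_of_one_le_left (Nat.cast_nonneg d) hN1)
  have hμN : ‖μ‖ ≤ N * l := hμ.trans (le_mul_of_one_le_left hl0 hN1)
  have hbound := h.abs_card_mul_inner_centerDiff_sub_le htyp ht (by
    rw [← hN, hsqrt_mul, ← hl2]
    nlinarith [mul_le_mul_of_nonneg_left htd (show 0 ≤ N * l by positivity)]) hi
  have hfactor : N * inner ℝ (Z i) (centerDiff μ y Z) - d =
      N * (inner ℝ (Z i) (centerDiff μ y Z) - l ^ 2) := by rw [mul_sub, hl2]
  rw [← hN, hsqrt_mul, hfactor, abs_mul, abs_of_pos (by positivity : 0 < N)] at hbound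
  refine le_of_mul_le_mul_left (hbound.trans ?_) (by positivity : 0 < N)
  calc t * (N * ‖centerDiff μ y Z‖ + 4 * ‖μ‖ + 2 * √d + N * l)
      ≤ t * (N * ‖centerDiff μ y Z‖ + 4 * (N * l) + 2 * (N * l) + N * l) := by gcongr
    _ = N * (t * (‖centerDiff μ y Z‖ + 7 * l)) := by ring

lemma inner_meanNoise_centerDiff (μ : EuclideanSpace ℝ (Fin d)) (y : Fin n → Bool)
    (Z : Fin n → EuclideanSpace ℝ (Fin d)) :
    inner ℝ (meanNoise (minorityIdx y) Z) (centerDiff μ y Z) =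
      ‖centerDiff μ y Z‖ ^ 2 - 2 * inner ℝ μ (centerDiff μ y Z) := by
  have hmean : meanNoise (minorityIdx y) Z = centerDiff μ y Z - (2 : ℝ) • μ := by
    rw [centerDiff, add_sub_cancel_left]
  rw [hmean, inner_sub_left, real_inner_smul_left, real_inner_self_eq_norm_sq]

lemma IsSpread.norm_centerDiff_mem_Icc (h : IsSpread t μ y Z) (htyp : IsTypical t μ y Z)
    (ht : 0 ≤ t) (hmin : (minorityIdx y).Nonempty)
    (htd : 112 * t ≤ √(d / (minorityIdx y).card))
    (hμ : 16 * ‖μ‖ ≤ √(d / (minorityIdx y).card)) :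
    ‖centerDiff μ y Z‖ ∈
      Set.Icc (√(d / (minorityIdx y).card) / 2) (2 * √(d / (minorityIdx y).card)) := by
  set l : ℝ := √(d / (minorityIdx y).card)
  set x : ℝ := ‖centerDiff μ y Z‖ with hx
  have := norm_nonneg μ
  have hx0 : 0 ≤ x := norm_nonneg _
  have : 0 ≤ l := Real.sqrt_nonneg _
  have hmean := abs_le.1 <| abs_inner_meanNoise_sub_le hmin fun i hi =>
    h.abs_inner_centerDiff_sub_le htyp ht (by linarith) (by linarith) hi
  rw [inner_meanNoise_centerDiff, ← hx] at hmean
  have hinner := abs_le.1 (abs_real_inner_le_norm μ (centerDiff μ y Z))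
  have htx : 112 * (t * x) ≤ l * x := by nlinarith
  have htl : 112 * (t * l) ≤ l * l := by nlinarith
  have hμx : 16 * (‖μ‖ * x) ≤ l * x := by nlinarith
  constructor
  · by_contra! hlt
    nlinarith
  · by_contra! hlt
    nlinarith

lemma IsSpread.norm_mul_le_gap (h : IsSpread t μ y Z) (htyp : IsTypical t μ y Z)
    (ht : 0 ≤ t) (htd : 112 * t ≤ √(d / (minorityIdx y).card))
    (hμ : 16 * ‖μ‖ ≤ √(d / (minorityIdx y).card)) {i j : Fin n}
    (hi : i ∈ minorityIdx y) (hj : j ∈ majorityIdx y) :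
    ‖centerDiff μ y Z‖ * (‖centerDiff μ y Z‖ - 31 * t) ≤
      2 * inner ℝ μ (centerDiff μ y Z) + inner ℝ (Z i) (centerDiff μ y Z) -
        inner ℝ (Z j) (centerDiff μ y Z) := by
  have := norm_nonneg μ
  have hmin := fun k (hk : k ∈ minorityIdx y) =>
    h.abs_inner_centerDiff_sub_le htyp ht (by linarith) (by linarith) hk
  have hmean := (abs_le.1 (abs_inner_meanNoise_sub_le ⟨i, hi⟩ hmin)).2
  rw [inner_meanNoise_centerDiff] at hmean
  have hlower := (abs_le.1 (hmin i hi)).1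
  have hmaj := (abs_le.1 (h.abs_inner_centerDiff_le_of_mem_majorityIdx ⟨i, hi⟩ hj)).2
  have hnorm := mul_le_mul_of_nonneg_left
    (h.norm_centerDiff_mem_Icc htyp ht ⟨i, hi⟩ htd hμ).1 ht
  linarith

/-- The minority class is so small that the norm of its mean noise is of the order of `l` and
dominates the signal, while the data are separated with a gap `‖centerDiff μ y Z‖ - O(t)` in the
direction of `centerDiff μ y Z`. -/
structure IsNoisy (t l : ℝ) (μ : EuclideanSpace ℝ (Fin d)) (y : Fin n → Bool)
    (Z : Fin n → EuclideanSpace ℝ (Fin d)) : Prop where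
  isTypical : IsTypical t μ y Z
  nonempty_minorityIdx : (minorityIdx y).Nonempty
  nonempty_majorityIdx : (majorityIdx y).Nonempty
  pos : 0 < l
  le_norm : l ≤ ‖centerDiff μ y Z‖
  norm_le : ‖centerDiff μ y Z‖ ≤ 8 * l
  four_mul_norm_signal_le : 4 * ‖μ‖ ≤ l
  norm_mul_le_gap : ∀ i ∈ minorityIdx y, ∀ j ∈ majorityIdx y,
    ‖centerDiff μ y Z‖ * (‖centerDiff μ y Z‖ - 31 * t) ≤
      2 * inner ℝ μ (centerDiff μ y Z) + inner ℝ (Z i) (centerDiff μ y Z) -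
        inner ℝ (Z j) (centerDiff μ y Z)

namespace IsNoisy

variable {l : ℝ}

lemma norm_centerDiff_pos (h : IsNoisy t l μ y Z) : 0 < ‖centerDiff μ y Z‖ :=
  h.pos.trans_le h.le_norm

lemma abs_inner_signal_meanNoise_le (h : IsNoisy t l μ y Z) :
    |inner ℝ μ (meanNoise (minorityIdx y) Z)| ≤ t * ‖μ‖ := by
  simpa [real_inner_comm] using abs_inner_meanNoise_sub_le h.nonempty_minorityIdx (a := 0)
    fun i _ => by simpa using h.isTypical.abs_inner_signal_le i

lemma le_two_mul_norm_meanNoise (h : IsNoisy t l μ y Z) :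
    l ≤ 2 * ‖meanNoise (minorityIdx y) Z‖ := by
  have htriangle := norm_add_le ((2 : ℝ) • μ) (meanNoise (minorityIdx y) Z)
  rw [← centerDiff, norm_smul, Real.norm_ofNat] at htriangle
  linarith [h.le_norm, h.four_mul_norm_signal_le]

lemma norm_meanNoise_pos (h : IsNoisy t l μ y Z) : 0 < ‖meanNoise (minorityIdx y) Z‖ := by
  linarith [h.le_two_mul_norm_meanNoise, h.pos]

lemma norm_signal_sq_div_le (h : IsNoisy t l μ y Z) (ht : 2 * t ≤ ‖μ‖) :
    ‖μ‖ ^ 2 / (8 * l) ≤ ‖centerDiff μ y Z‖ - ‖meanNoise (minorityIdx y) Z‖ := by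
  have hsq : ‖centerDiff μ y Z‖ ^ 2 = 4 * ‖μ‖ ^ 2 +
      4 * inner ℝ μ (meanNoise (minorityIdx y) Z) + ‖meanNoise (minorityIdx y) Z‖ ^ 2 := by
    rw [centerDiff, norm_add_sq_real, real_inner_smul_left, norm_smul, Real.norm_ofNat]
    ring
  have hinner := (abs_le.1 h.abs_inner_signal_meanNoise_le).1
  have hsub : 2 * ‖μ‖ ^ 2 ≤
      ‖centerDiff μ y Z‖ ^ 2 - ‖meanNoise (minorityIdx y) Z‖ ^ 2 := by
    nlinarith [mul_le_mul_of_nonneg_left ht (norm_nonneg μ)]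
  have hle : ‖meanNoise (minorityIdx y) Z‖ ≤ ‖centerDiff μ y Z‖ :=
    abs_le_of_sq_le_sq' (by nlinarith [sq_nonneg ‖μ‖]) (norm_nonneg _) |>.2
  have hl := h.pos
  rw [div_le_iff₀ (by positivity)]
  nlinarith [mul_le_mul_of_nonneg_left h.norm_le (sub_nonneg.2 hle)]

end IsNoisy

end TrainingSet

section Solution

variable {d n : ℕ} {μ : EuclideanSpace ℝ (Fin d)} {y : Fin n → Bool}
  {Z : Fin n → EuclideanSpace ℝ (Fin d)} {t l τ β₀ κ : ℝ} {β : EuclideanSpace ℝ (Fin d)}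

lemma isFeasible_trainingSet_iff :
    IsFeasible τ (trainingSet μ y Z) β β₀ κ ↔
      (∀ i ∈ minorityIdx y, τ * κ ≤ inner ℝ μ β + inner ℝ (Z i) β + β₀) ∧
      (∀ j ∈ majorityIdx y, κ ≤ inner ℝ μ β - inner ℝ (Z j) β - β₀) ∧ ‖β‖ ≤ 1 := by
  have hmin : ∀ i, y i = true → label (y i) * (inner ℝ (label (y i) • μ + Z i) β + β₀) =
      inner ℝ μ β + inner ℝ (Z i) β + β₀ := fun i hi => by
    simp [hi, label, inner_add_left]
  have hmaj : ∀ j, y j = false → label (y j) * (inner ℝ (label (y j) • μ + Z j) β + β₀) =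
      inner ℝ μ β - inner ℝ (Z j) β - β₀ := fun j hj => by
    simp only [hj, label, Bool.false_eq_true, if_false, inner_add_left, neg_smul, one_smul,
      inner_neg_left]
    ring
  simp only [mem_minorityIdx, mem_majorityIdx]
  constructor
  · rintro ⟨hminority, hmajority, hnorm⟩
    exact ⟨fun i hi => hmin i hi ▸ hminority i hi, fun j hj => hmaj j hj ▸ hmajority j hj, hnorm⟩
  · rintro ⟨hminority, hmajority, hnorm⟩
    exact ⟨fun i hi => (hminority i hi).trans_eq (hmin i hi).symm,
      fun j hj => (hmajority j hj).trans_eq (hmaj j hj).symm, hnorm⟩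

lemma IsFeasible.le_inner_sub_of_nonempty_subset
    (h : IsFeasible τ (trainingSet μ y Z) β β₀ κ) {J : Finset (Fin n)} (hJ : J.Nonempty)
    (hsub : J ⊆ majorityIdx y) : κ ≤ inner ℝ μ β - inner ℝ (meanNoise J Z) β - β₀ := by
  have := inner_meanNoise_le (Z := Z) (u := β) hJ (a := inner ℝ μ β - β₀ - κ) fun j hj => by
    linarith [(isFeasible_trainingSet_iff.1 h).2.1 j (hsub hj)]
  linarith

lemma IsFeasible.le_inner_meanNoise_add (h : IsFeasible τ (trainingSet μ y Z) β β₀ κ)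
    (hmin : (minorityIdx y).Nonempty) :
    τ * κ ≤ inner ℝ μ β + inner ℝ (meanNoise (minorityIdx y) Z) β + β₀ := by
  have := le_inner_meanNoise (Z := Z) (u := β) hmin (a := τ * κ - inner ℝ μ β - β₀) fun i hi => by
    linarith [(isFeasible_trainingSet_iff.1 h).1 i hi]
  linarith

lemma IsFeasible.intercept_le (h : IsFeasible τ (trainingSet μ y Z) β β₀ κ)
    (hZ : IsTypical t μ y Z) (hmaj : (majorityIdx y).Nonempty) :
    β₀ ≤ inner ℝ μ β - κ + 1 := by
  have hmean := (abs_le.1 ((abs_real_inner_le_norm_of_norm_le_one _ h.norm_le_one).trans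
    hZ.norm_meanNoise_majority_le)).1
  linarith [h.le_inner_sub_of_nonempty_subset hmaj subset_rfl]

lemma IsFeasible.le_intercept (h : IsFeasible τ (trainingSet μ y Z) β β₀ κ)
    (hmin : (minorityIdx y).Nonempty) :
    τ * κ - inner ℝ μ β - ‖meanNoise (minorityIdx y) Z‖ ≤ β₀ := by
  have hmean := (abs_le.1 (abs_real_inner_le_norm_of_norm_le_one
    (meanNoise (minorityIdx y) Z) h.norm_le_one)).2
  linarith [h.le_inner_meanNoise_add hmin]

lemma IsFeasible.gap_le_inner_centerDiff (h : IsFeasible τ (trainingSet μ y Z) β β₀ κ)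
    (hZ : IsTypical t μ y Z) (hmin : (minorityIdx y).Nonempty) (hmaj : (majorityIdx y).Nonempty) :
    (1 + τ) * κ - 1 ≤ inner ℝ (centerDiff μ y Z) β := by
  rw [centerDiff, inner_add_left, real_inner_smul_left]
  linarith [h.intercept_le hZ hmaj, h.le_inner_meanNoise_add hmin]

/-- Splitting the gap `g` in the ratio `τ : 1` by the choice of the intercept gives the margin
`g / (1 + τ)`. -/
lemma IsSVMSolution.le_gap (h : IsSVMSolution τ (trainingSet μ y Z) β β₀ κ) (hτ : 0 < τ)
    (hmaj : (majorityIdx y).Nonempty) {u : EuclideanSpace ℝ (Fin d)} (hu : ‖u‖ ≤ 1) {g : ℝ}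
    (hg : ∀ i ∈ minorityIdx y, ∀ j ∈ majorityIdx y,
      g ≤ 2 * inner ℝ μ u + inner ℝ (Z i) u - inner ℝ (Z j) u) :
    g ≤ (1 + τ) * κ := by
  obtain ⟨j, hj, hmax⟩ := Finset.exists_max_image (majorityIdx y) (fun j => inner ℝ (Z j) u) hmaj
  have hfeas : IsFeasible τ (trainingSet μ y Z) u
      (inner ℝ μ u - inner ℝ (Z j) u - g / (1 + τ)) (g / (1 + τ)) := by
    refine isFeasible_trainingSet_iff.2 ⟨fun i hi => ?_, fun i hi => ?_, hu⟩
    · have hsplit : τ * (g / (1 + τ)) = g - g / (1 + τ) := by field_simp; ring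
      linarith [hg i hi j hj]
    · linarith [hmax i hi]
  have hle := h.2 _ _ _ hfeas
  rwa [div_le_iff₀ (by positivity), mul_comm] at hle

lemma IsSVMSolution.le_gap_of_norm_mul_le (h : IsSVMSolution τ (trainingSet μ y Z) β β₀ κ)
    (hτ : 0 < τ) (hmaj : (majorityIdx y).Nonempty) {u : EuclideanSpace ℝ (Fin d)} (hu : 0 < ‖u‖)
    {g : ℝ} (hg : ∀ i ∈ minorityIdx y, ∀ j ∈ majorityIdx y,
      ‖u‖ * g ≤ 2 * inner ℝ μ u + inner ℝ (Z i) u - inner ℝ (Z j) u) :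
    g ≤ (1 + τ) * κ := by
  refine h.le_gap hτ hmaj (norm_inv_norm_smul hu).le fun i hi j hj => ?_
  simp only [real_inner_smul_right]
  rw [mul_left_comm, ← mul_add, ← mul_sub, inv_mul_eq_div, le_div_iff₀ hu, mul_comm]
  exact hg i hi j hj

lemma IsSVMSolution.two_mul_norm_signal_sub_le_gap
    (h : IsSVMSolution τ (trainingSet μ y Z) β β₀ κ) (hτ : 0 < τ) (hZ : IsTypical t μ y Z)
    (hmaj : (majorityIdx y).Nonempty) (hμ : 0 < ‖μ‖) : 2 * ‖μ‖ - 2 * t ≤ (1 + τ) * κ := by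
  refine h.le_gap_of_norm_mul_le hτ hmaj hμ fun i _ j _ => ?_
  rw [real_inner_self_eq_norm_sq]
  linarith [(abs_le.1 (hZ.abs_inner_signal_le i)).1, (abs_le.1 (hZ.abs_inner_signal_le j)).2]

lemma IsSVMSolution.norm_centerDiff_sub_le_gap
    (h : IsSVMSolution τ (trainingSet μ y Z) β β₀ κ) (hτ : 0 < τ) (hZ : IsNoisy t l μ y Z) :
    ‖centerDiff μ y Z‖ - 31 * t ≤ (1 + τ) * κ :=
  h.le_gap_of_norm_mul_le hτ hZ.nonempty_majorityIdx hZ.norm_centerDiff_pos hZ.norm_mul_le_gap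

lemma IsSVMSolution.norm_centerDiff_sub_le_inner
    (h : IsSVMSolution τ (trainingSet μ y Z) β β₀ κ) (hτ : 0 < τ) (hZ : IsNoisy t l μ y Z)
    (ht : 1 ≤ t) : ‖centerDiff μ y Z‖ - 32 * t ≤ inner ℝ (centerDiff μ y Z) β := by
  linarith [h.norm_centerDiff_sub_le_gap hτ hZ, h.1.gap_le_inner_centerDiff hZ.isTypical
    hZ.nonempty_minorityIdx hZ.nonempty_majorityIdx]

/-- The direction `β` is close to that of `centerDiff μ y Z`, in which a weak signal is negligible
compared with the mean noise. -/
lemma IsSVMSolution.inner_signal_le (h : IsSVMSolution τ (trainingSet μ y Z) β β₀ κ)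
    (hτ : 0 < τ) (hZ : IsNoisy t l μ y Z) (ht : 1 ≤ t) :
    inner ℝ μ β ≤ (2 * ‖μ‖ ^ 2 + t * ‖μ‖) / l + ‖μ‖ * √(64 * t / l) := by
  have hl := hZ.pos
  have hv := hZ.norm_centerDiff_pos
  set v := centerDiff μ y Z with hvdef
  have hdist : ‖β - ‖v‖⁻¹ • v‖ ≤ √(64 * t / l) := by
    refine Real.le_sqrt_of_sq_le ((norm_sub_inv_norm_smul_sq_le h.1.norm_le_one hv
      (h.norm_centerDiff_sub_le_inner hτ hZ ht)).trans ?_)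
    rw [← mul_assoc]
    gcongr
    · norm_num
    · exact hZ.le_norm
  have hinner : inner ℝ μ v ≤ 2 * ‖μ‖ ^ 2 + t * ‖μ‖ := by
    rw [hvdef, centerDiff, inner_add_right, real_inner_smul_right, real_inner_self_eq_norm_sq]
    linarith [(abs_le.1 hZ.abs_inner_signal_meanNoise_le).2]
  calc inner ℝ μ β = inner ℝ μ v / ‖v‖ + inner ℝ μ (β - ‖v‖⁻¹ • v) := by
        rw [inner_sub_right, real_inner_smul_right]; ring
    _ ≤ (2 * ‖μ‖ ^ 2 + t * ‖μ‖) / l + ‖μ‖ * √(64 * t / l) := by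
        gcongr
        · exact hZ.le_norm
        · exact (real_inner_le_norm _ _).trans (mul_le_mul_of_nonneg_left hdist (norm_nonneg _))

lemma IsSVMSolution.norm_sub_meanNoise_direction_sq_le
    (h : IsSVMSolution τ (trainingSet μ y Z) β β₀ κ) (hτ : 0 < τ) (hZ : IsNoisy t l μ y Z)
    (ht : 1 ≤ t) :
    ‖β - ‖meanNoise (minorityIdx y) Z‖⁻¹ • meanNoise (minorityIdx y) Z‖ ^ 2 ≤
      4 * (32 * t + 4 * ‖μ‖) / l := by
  have hl := hZ.pos
  have hm := hZ.norm_meanNoise_pos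
  set m := meanNoise (minorityIdx y) Z
  have hinner : ‖m‖ - (32 * t + 4 * ‖μ‖) ≤ inner ℝ m β := by
    have hmean : m = centerDiff μ y Z - (2 : ℝ) • μ := by
      rw [centerDiff, add_sub_cancel_left]
    have htriangle := norm_sub_le (centerDiff μ y Z) ((2 : ℝ) • μ)
    rw [← hmean, norm_smul, Real.norm_ofNat] at htriangle
    rw [hmean, inner_sub_left, real_inner_smul_left, ← hmean]
    linarith [h.norm_centerDiff_sub_le_inner hτ hZ ht,
      (abs_le.1 (abs_real_inner_le_norm_of_norm_le_one μ h.1.norm_le_one)).2]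
  refine (norm_sub_inv_norm_smul_sq_le h.1.norm_le_one hm hinner).trans ?_
  rw [div_le_div_iff₀ hm hl]
  have := mul_le_mul_of_nonneg_left hZ.le_two_mul_norm_meanNoise
    (show 0 ≤ 2 * (32 * t + 4 * ‖μ‖) by positivity)
  linarith

lemma IsSVMSolution.logit_neg_add_le (h : IsSVMSolution τ (trainingSet μ y Z) β β₀ κ)
    (hτ : 0 < τ) (hZ : IsTypical t μ y Z) (hmaj : (majorityIdx y).Nonempty) {g : ℝ}
    (hg : g ≤ (1 + τ) * κ) (z : EuclideanSpace ℝ (Fin d)) :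
    logit (β, β₀) (-μ + z) ≤ |inner ℝ z β| - g / (1 + τ) + 1 := by
  have hmargin : g / (1 + τ) ≤ κ := (div_le_iff₀' (by positivity)).2 hg
  simp only [logit, inner_add_left, inner_neg_left]
  linarith [le_abs_self (inner ℝ z β), h.1.intercept_le hZ hmaj]

lemma IsSVMSolution.logit_add_le (h : IsSVMSolution τ (trainingSet μ y Z) β β₀ κ)
    (hτ : 0 < τ) (hZ : IsTypical t μ y Z) (hmaj : (majorityIdx y).Nonempty) {g : ℝ}
    (hg : g ≤ (1 + τ) * κ) (z : EuclideanSpace ℝ (Fin d)) :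
    logit (β, β₀) (μ + z) ≤ 2 * ‖μ‖ + |inner ℝ z β| - g / (1 + τ) + 1 := by
  have hneg := h.logit_neg_add_le hτ hZ hmaj hg z
  have hμ := (abs_le.1 (abs_real_inner_le_norm_of_norm_le_one μ h.1.norm_le_one)).2
  simp only [logit, inner_add_left, inner_neg_left] at hneg ⊢
  linarith

lemma IsSVMSolution.le_logit_add (h : IsSVMSolution τ (trainingSet μ y Z) β β₀ κ)
    (hτ : 0 < τ) (hmin : (minorityIdx y).Nonempty) {g : ℝ}
    (hg : g ≤ (1 + τ) * κ) (z : EuclideanSpace ℝ (Fin d)) :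
    g - g / (1 + τ) - ‖meanNoise (minorityIdx y) Z‖ - |inner ℝ z β| ≤ logit (β, β₀) (μ + z) := by
  have hmargin : g / (1 + τ) ≤ κ := (div_le_iff₀' (by positivity)).2 hg
  have hsplit : g - g / (1 + τ) = τ * (g / (1 + τ)) := by field_simp; ring
  simp only [logit, inner_add_left]
  linarith [mul_le_mul_of_nonneg_left hmargin hτ.le, neg_abs_le (inner ℝ z β),
    h.1.le_intercept hmin]

lemma IsExceeded.norm_meanNoise_exceedances_le {K p : ℝ} (hp : 0 < p)
    {s : EuclideanSpace ℝ (Fin d)} {B : Finset (Fin n)} (h : IsExceeded K p t s Z B)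
    (hB : B.Nonempty) : ‖meanNoise (exceedances K s Z B) Z‖ ≤ 2 * t / p := by
  have : (0 : ℝ) < B.card := by exact_mod_cast hB.card_pos
  have ht : 0 ≤ t * B.card := (norm_nonneg _).trans h.2
  calc ‖meanNoise (exceedances K s Z B) Z‖
      ≤ t * B.card / (p / 2 * B.card) := by
        rw [norm_meanNoise]
        exact div_le_div₀ ht h.2 (by positivity) h.1
    _ = 2 * t / p := by field_simp

lemma IsSVMSolution.logit_add_le_of_isExceeded
    (h : IsSVMSolution τ (trainingSet μ y Z) β β₀ κ) (hκ : 0 ≤ κ)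
    {s : EuclideanSpace ℝ (Fin d)} (hs : 0 < ‖s‖) {r : ℝ} (hr : ‖β - ‖s‖⁻¹ • s‖ ≤ r)
    {K p : ℝ} (hp : 0 < p) (hmaj : (majorityIdx y).Nonempty)
    (hex : IsExceeded K p t s Z (majorityIdx y)) (z : EuclideanSpace ℝ (Fin d)) :
    logit (β, β₀) (μ + z) ≤ 2 * inner ℝ μ β + |inner ℝ z β| - K + 2 * t / p * r := by
  have : (0 : ℝ) < (majorityIdx y).card := by exact_mod_cast hmaj.card_pos
  set J := exceedances K s Z (majorityIdx y)
  have hJ : J.Nonempty := by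
    rw [← Finset.card_pos, ← Nat.cast_pos (α := ℝ)]
    exact lt_of_lt_of_le (by positivity) hex.1
  have hlevel : K ≤ inner ℝ (meanNoise J Z) (‖s‖⁻¹ • s) := by
    refine le_inner_meanNoise hJ fun j hj => ?_
    rw [real_inner_smul_right, inv_mul_eq_div, le_div_iff₀ hs]
    exact (Finset.mem_filter.1 hj).2
  have hdeviation : |inner ℝ (meanNoise J Z) (β - ‖s‖⁻¹ • s)| ≤ 2 * t / p * r :=
    (abs_real_inner_le_norm _ _).trans <| by
      gcongr
      · exact (norm_nonneg _).trans (hex.norm_meanNoise_exceedances_le hp hmaj)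
      · exact hex.norm_meanNoise_exceedances_le hp hmaj
  have hmajority := h.1.le_inner_sub_of_nonempty_subset hJ (Finset.filter_subset _ _)
  rw [inner_sub_right] at hdeviation
  simp only [logit, inner_add_left]
  linarith [(abs_le.1 hdeviation).1, le_abs_self (inner ℝ z β)]

lemma exceedances_smul {ι : Type*} {c : ℝ} (hc : 0 < c) (K : ℝ) (s : EuclideanSpace ℝ (Fin d))
    (Z : ι → EuclideanSpace ℝ (Fin d)) (B : Finset ι) :
    exceedances K (c • s) Z B = exceedances K s Z B := by
  refine Finset.filter_congr fun j _ => ?_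
  rw [norm_smul, Real.norm_of_nonneg hc.le, real_inner_smul_right, mul_left_comm,
    mul_le_mul_iff_right₀ hc]

end Solution

/-! ### The law of the labels -/

section Labels

variable {n : ℕ} {π : ℝ} {y : Fin n → Bool}

lemma labelLaw_true (π : ℝ) : labelLaw π {true} = ENNReal.ofReal π := by simp [labelLaw]

lemma labelLaw_false (π : ℝ) : labelLaw π {false} = ENNReal.ofReal (1 - π) := by simp [labelLaw]

lemma isProbabilityMeasure_labelLaw (hπ₀ : 0 ≤ π) (hπ₁ : π ≤ 1) :
    IsProbabilityMeasure (labelLaw π) := by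
  refine ⟨?_⟩
  simp only [labelLaw, Measure.add_apply, Measure.smul_apply, measure_univ, smul_eq_mul, mul_one]
  rw [← ENNReal.ofReal_add hπ₀ (by linarith), add_sub_cancel, ENNReal.ofReal_one]

/-- The joint law of the labels of a training set of size `n`. -/
noncomputable abbrev labelSample (n : ℕ) (π : ℝ) : Measure (Fin n → Bool) :=
  Measure.pi fun _ => labelLaw π

/-- The size of the minority class is within a factor `2` of its mean `n * π`. -/
structure IsBalancedLabels (π : ℝ) (y : Fin n → Bool) : Prop where
  le_card : n * π / 2 ≤ (minorityIdx y).card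
  card_le : (minorityIdx y).card ≤ 3 * (n * π / 2)

lemma measureReal_not_isBalancedLabels_le (hπ₀ : 0 < π) (hπ₁ : π ≤ 1) (hn : 0 < n) :
    (labelSample n π).real {y | ¬ IsBalancedLabels π y} ≤ 4 / (n * π) := by
  have := isProbabilityMeasure_labelLaw hπ₀.le hπ₁
  have hπ : (labelLaw π).real {true} = π := by
    rw [Measure.real, labelLaw_true, ENNReal.toReal_ofReal hπ₀.le]
  have : NeZero n := ⟨hn.ne'⟩
  have hfreq := measureReal_half_le_abs_card_filter_sub_le (ρ := labelLaw π) (T := {true})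
    (measurableSet_singleton true) (hπ.symm ▸ hπ₀) (Finset.univ_nonempty (α := Fin n))
  rw [hπ, Finset.card_univ, Fintype.card_fin, mul_comm π] at hfreq
  refine (measureReal_mono fun y hy => ?_).trans hfreq
  by_contra! hlt
  rw [Set.mem_ofPred_eq, not_le, abs_lt] at hlt
  have hidx : minorityIdx y = Finset.univ.filter fun i => y i ∈ ({true} : Set Bool) := by
    ext i; simp
  exact hy ⟨by rw [hidx]; linarith [hlt.1], by rw [hidx]; linarith [hlt.2]⟩

namespace IsBalancedLabels

lemma nonempty_minorityIdx (hy : IsBalancedLabels π y) (hM : 0 < n * π) :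
    (minorityIdx y).Nonempty := by
  rw [← Finset.card_pos, ← Nat.cast_pos (α := ℝ)]
  linarith [hy.le_card]

lemma half_le_card_majorityIdx (hy : IsBalancedLabels π y) (hπ : π ≤ 1 / 3) :
    (n : ℝ) / 2 ≤ (majorityIdx y).card := by
  have hsum : ((minorityIdx y).card : ℝ) + (majorityIdx y).card = n := by
    exact_mod_cast card_minorityIdx_add_card_majorityIdx y
  linarith [hy.card_le, mul_le_mul_of_nonneg_left hπ (Nat.cast_nonneg (α := ℝ) n)]

lemma nonempty_majorityIdx (hy : IsBalancedLabels π y) (hπ : π ≤ 1 / 3) (hn : 0 < n) :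
    (majorityIdx y).Nonempty := by
  have hn' : (0 : ℝ) < n := by exact_mod_cast hn
  rw [← Finset.card_pos, ← Nat.cast_pos (α := ℝ)]
  linarith [hy.half_le_card_majorityIdx hπ]

end IsBalancedLabels

end Labels

/-! ### The test errors in terms of labels and noise -/

section Errors

variable {d n : ℕ} {C : ℝ≥0} {ν : Fin d → Measure ℝ} {π : ℝ} {μ : EuclideanSpace ℝ (Fin d)}

lemma measurable_signal_add (μ : EuclideanSpace ℝ (Fin d)) :
    Measurable fun w : Bool × EuclideanSpace ℝ (Fin d) => (label w.1 • μ + w.2, w.1) := by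
  have : Measurable label := measurable_of_finite _
  fun_prop

lemma measurable_trainingSet (μ : EuclideanSpace ℝ (Fin d)) :
    Measurable fun w : (Fin n → Bool) × (Fin n → EuclideanSpace ℝ (Fin d)) =>
      trainingSet μ w.1 w.2 := by
  refine measurable_pi_lambda _ fun i => ?_
  have hpoint : Measurable fun w : (Fin n → Bool) × (Fin n → EuclideanSpace ℝ (Fin d)) =>
      (w.1 i, w.2 i) := by fun_prop
  exact (measurable_signal_add μ).comp hpoint

lemma isProbabilityMeasure_dataLaw (hπ₀ : 0 ≤ π) (hπ₁ : π ≤ 1)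
    [IsProbabilityMeasure (noiseLaw ν)] : IsProbabilityMeasure (dataLaw π μ ν) := by
  have := isProbabilityMeasure_labelLaw hπ₀ hπ₁
  exact Measure.isProbabilityMeasure_map (measurable_signal_add μ).aemeasurable

lemma dataLaw_setOf_label_eq_and [IsProbabilityMeasure (noiseLaw ν)] (y : Bool)
    {E : Set (EuclideanSpace ℝ (Fin d))} (hE : MeasurableSet E) :
    dataLaw π μ ν {x | x.2 = y ∧ x.1 ∈ E} =
      labelLaw π {y} * noiseLaw ν {z | label y • μ + z ∈ E} := by
  have hpreimage : (fun w : Bool × EuclideanSpace ℝ (Fin d) => (label w.1 • μ + w.2, w.1)) ⁻¹'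
      {x | x.2 = y ∧ x.1 ∈ E} = {y} ×ˢ {z | label y • μ + z ∈ E} := by
    ext ⟨b, z⟩
    simp only [Set.mem_preimage, Set.mem_ofPred_eq, Set.mem_prod, Set.mem_singleton_iff]
    exact and_congr_right fun hb => by rw [hb]
  have hmeas : MeasurableSet {x : Point d | x.2 = y ∧ x.1 ∈ E} :=
    (measurable_snd (measurableSet_singleton y)).inter (measurable_fst hE)
  rw [dataLaw, Measure.map_apply (measurable_signal_add μ) hmeas, hpreimage, Measure.prod_prod]

lemma cond_jointLaw_apply [IsProbabilityMeasure (noiseLaw ν)] (hπ₀ : 0 ≤ π) (hπ₁ : π ≤ 1)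
    {y : Bool} (hy : labelLaw π {y} ≠ 0)
    {E : Set ((Fin n → Point d) × EuclideanSpace ℝ (Fin d))} (hE : MeasurableSet E) :
    cond (jointLaw n π μ ν) {w | w.2.2 = y} {w | (w.1, w.2.1) ∈ E} =
      ((Measure.pi fun _ : Fin n => dataLaw π μ ν).prod (noiseLaw ν))
        {w | (w.1, label y • μ + w.2) ∈ E} := by
  have := isProbabilityMeasure_labelLaw hπ₀ hπ₁
  have := isProbabilityMeasure_dataLaw (μ := μ) (ν := ν) hπ₀ hπ₁
  have hjoint : ∀ {F : Set ((Fin n → Point d) × EuclideanSpace ℝ (Fin d))}, MeasurableSet F →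
      jointLaw n π μ ν ({w | w.2.2 = y} ∩ {w | (w.1, w.2.1) ∈ F}) =
        labelLaw π {y} * ((Measure.pi fun _ : Fin n => dataLaw π μ ν).prod (noiseLaw ν))
          {w | (w.1, label y • μ + w.2) ∈ F} := fun {F} hF => by
    have hF' : MeasurableSet {w : (Fin n → Point d) × EuclideanSpace ℝ (Fin d) |
        (w.1, label y • μ + w.2) ∈ F} :=
      (by fun_prop : Measurable fun w : (Fin n → Point d) × EuclideanSpace ℝ (Fin d) =>
        (w.1, label y • μ + w.2)) hF
    have hF'' : MeasurableSet ({w : (Fin n → Point d) × Point d | w.2.2 = y} ∩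
        {w | (w.1, w.2.1) ∈ F}) :=
      (measurable_snd.snd (measurableSet_singleton y)).inter
        ((by fun_prop : Measurable fun w : (Fin n → Point d) × Point d => (w.1, w.2.1)) hF)
    rw [jointLaw, Measure.prod_apply hF'', Measure.prod_apply hF',
      ← lintegral_const_mul _ (measurable_measure_prodMk_left hF')]
    exact lintegral_congr fun S => dataLaw_setOf_label_eq_and y (measurable_prodMk_left hF)
  have hlabel : jointLaw n π μ ν {w | w.2.2 = y} = labelLaw π {y} := by
    simpa using hjoint MeasurableSet.univ
  have hmeas : MeasurableSet {w : (Fin n → Point d) × Point d | w.2.2 = y} :=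
    measurable_snd.snd (measurableSet_singleton y)
  rw [cond_apply hmeas, hlabel, hjoint hE, ← mul_assoc,
    ENNReal.inv_mul_cancel hy (measure_ne_top _ _), one_mul]

variable {svm : (Fin n → Point d) → EuclideanSpace ℝ (Fin d) × ℝ}

lemma measurable_logit (hsvm : Measurable svm) :
    Measurable fun w : (Fin n → Point d) × EuclideanSpace ℝ (Fin d) => logit (svm w.1) w.2 := by
  have : Measurable fun S => (svm S).1 := hsvm.fst
  have : Measurable fun S => (svm S).2 := hsvm.snd
  unfold logit
  fun_prop

lemma errPlus_eq (hπ₀ : 0 < π) (hπ₁ : π ≤ 1) [IsProbabilityMeasure (noiseLaw ν)]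
    (hsvm : Measurable svm) :
    errPlus π μ ν svm = ((Measure.pi fun _ : Fin n => dataLaw π μ ν).prod (noiseLaw ν)).real
      {w | logit (svm w.1) (μ + w.2) ≤ 0} := by
  have hcond := cond_jointLaw_apply (n := n) (μ := μ) (ν := ν) hπ₀.le hπ₁ (y := true)
    (by simpa [labelLaw_true] using hπ₀)
    (measurableSet_le (measurable_logit hsvm) (measurable_const (a := (0 : ℝ))))
  simpa [errPlus, Measure.real, label] using congrArg ENNReal.toReal hcond

lemma errMinus_eq (hπ₀ : 0 ≤ π) (hπ₁ : π < 1) [IsProbabilityMeasure (noiseLaw ν)]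
    (hsvm : Measurable svm) :
    errMinus π μ ν svm = ((Measure.pi fun _ : Fin n => dataLaw π μ ν).prod (noiseLaw ν)).real
      {w | 0 < logit (svm w.1) (-μ + w.2)} := by
  have hcond := cond_jointLaw_apply (n := n) (μ := μ) (ν := ν) hπ₀ hπ₁.le (y := false)
    (by simpa [labelLaw_false] using hπ₁)
    (measurableSet_lt (measurable_const (a := (0 : ℝ))) (measurable_logit hsvm))
  simpa [errMinus, Measure.real, label] using congrArg ENNReal.toReal hcond

lemma pi_dataLaw_eq_map (hπ₀ : 0 ≤ π) (hπ₁ : π ≤ 1) [IsProbabilityMeasure (noiseLaw ν)] :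
    (Measure.pi fun _ : Fin n => dataLaw π μ ν) =
      ((labelSample n π).prod (noiseSample n ν)).map fun w => trainingSet μ w.1 w.2 := by
  have := isProbabilityMeasure_labelLaw hπ₀ hπ₁
  have hsplit := measurePreserving_arrowProdEquivProdArrow Bool (EuclideanSpace ℝ (Fin d)) (Fin n)
    (fun _ => labelLaw π) (fun _ => noiseLaw ν)
  have : ∀ _ : Fin n, SigmaFinite (((labelLaw π).prod (noiseLaw ν)).map fun w =>
      (label w.1 • μ + w.2, w.1)) := fun _ => by
    have := isProbabilityMeasure_dataLaw (μ := μ) (ν := ν) hπ₀ hπ₁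
    exact inferInstanceAs (SigmaFinite (dataLaw π μ ν))
  rw [← hsplit.map_eq, Measure.map_map (measurable_trainingSet μ) hsplit.measurable]
  exact (Measure.pi_map_pi (μ := fun _ : Fin n => (labelLaw π).prod (noiseLaw ν))
    (f := fun _ w => (label w.1 • μ + w.2, w.1))
    fun _ => (measurable_signal_add μ).aemeasurable).symm

lemma pi_dataLaw_prod_noiseLaw_eq_map (hπ₀ : 0 ≤ π) (hπ₁ : π ≤ 1)
    [IsProbabilityMeasure (noiseLaw ν)] :
    (Measure.pi fun _ : Fin n => dataLaw π μ ν).prod (noiseLaw ν) =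
      (((labelSample n π).prod (noiseSample n ν)).prod (noiseLaw ν)).map
        fun w => (trainingSet μ w.1.1 w.1.2, w.2) := by
  have := isProbabilityMeasure_labelLaw hπ₀ hπ₁
  rw [pi_dataLaw_eq_map hπ₀ hπ₁]
  simpa only [Measure.map_id, Prod.map_def, id_eq] using
    Measure.map_prod_map ((labelSample n π).prod (noiseSample n ν)) (noiseLaw ν)
      (measurable_trainingSet μ) measurable_id

lemma IsSubGaussianNoise.measureReal_prod_lt_abs_inner_le (hν : IsSubGaussianNoise C ν)
    {Ω : Type*} [MeasurableSpace Ω] {P : Measure Ω} [IsProbabilityMeasure P]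
    {β : Ω → EuclideanSpace ℝ (Fin d)} (hβ : Measurable β) {A : ℝ} (hA : 0 < A) :
    (P.prod (noiseLaw ν)).real {w | ‖β w.1‖ ≤ 1 ∧ A < |inner ℝ w.2 (β w.1)|} ≤ 1 / A ^ 2 := by
  have := hν.isProbabilityMeasure_noiseLaw
  have hnorm : Measurable fun w : Ω × EuclideanSpace ℝ (Fin d) => ‖β w.1‖ := by fun_prop
  have hinner : Measurable fun w : Ω × EuclideanSpace ℝ (Fin d) => |inner ℝ w.2 (β w.1)| := by
    fun_prop
  refine measureReal_prod_le ((measurableSet_le hnorm measurable_const).inter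
    (measurableSet_lt measurable_const hinner)) fun ω => ?_
  by_cases hω : ‖β ω‖ ≤ 1
  · simpa [hω] using hν.measureReal_lt_abs_inner_le_inv_sq hω hA
  · simp [hω, sq_nonneg]

lemma IsSubGaussianNoise.measureReal_train_test_le (hν : IsSubGaussianNoise C ν) (hπ₀ : 0 ≤ π)
    (hπ₁ : π ≤ 1) (hsvm : Measurable svm) {A : ℝ} (hA : 0 < A)
    {bad : Set ((Fin n → Bool) × (Fin n → EuclideanSpace ℝ (Fin d)))}
    {T : Set ((Fin n → Point d) × EuclideanSpace ℝ (Fin d))} (hT : MeasurableSet T)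
    (h : ∀ y Z, (y, Z) ∉ bad → ‖(svm (trainingSet μ y Z)).1‖ ≤ 1 ∧
      ∀ z, |inner ℝ z (svm (trainingSet μ y Z)).1| ≤ A → (trainingSet μ y Z, z) ∉ T) :
    ((Measure.pi fun _ : Fin n => dataLaw π μ ν).prod (noiseLaw ν)).real T ≤
      ((labelSample n π).prod (noiseSample n ν)).real bad + 1 / A ^ 2 := by
  have := hν.isProbabilityMeasure_noiseLaw
  have := isProbabilityMeasure_labelLaw hπ₀ hπ₁
  set P := (labelSample n π).prod (noiseSample n ν)
  set β : (Fin n → Bool) × (Fin n → EuclideanSpace ℝ (Fin d)) → EuclideanSpace ℝ (Fin d) :=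
    fun w => (svm (trainingSet μ w.1 w.2)).1
  have hβ : Measurable β := (hsvm.comp (measurable_trainingSet μ)).fst
  have hmap : Measurable fun w : ((Fin n → Bool) × (Fin n → EuclideanSpace ℝ (Fin d))) ×
      EuclideanSpace ℝ (Fin d) => (trainingSet μ w.1.1 w.1.2, w.2) :=
    ((measurable_trainingSet μ).comp measurable_fst).prodMk measurable_snd
  rw [pi_dataLaw_prod_noiseLaw_eq_map hπ₀ hπ₁, map_measureReal_apply hmap hT]
  calc (P.prod (noiseLaw ν)).real ((fun w => (trainingSet μ w.1.1 w.1.2, w.2)) ⁻¹' T)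
      ≤ (P.prod (noiseLaw ν)).real
          (bad ×ˢ Set.univ ∪ {w | ‖β w.1‖ ≤ 1 ∧ A < |inner ℝ w.2 (β w.1)|}) := by
        refine measureReal_mono fun w hw => ?_
        by_cases hbad : w.1 ∈ bad
        · exact Or.inl ⟨hbad, Set.mem_univ _⟩
        · obtain ⟨hnorm, hsmall⟩ := h w.1.1 w.1.2 hbad
          exact Or.inr ⟨hnorm, not_le.1 fun hle => hsmall w.2 hle hw⟩
    _ ≤ _ := measureReal_union_le _ _
    _ ≤ P.real bad + 1 / A ^ 2 := by
        rw [measureReal_prod_prod, probReal_univ, mul_one]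
        gcongr
        exact hν.measureReal_prod_lt_abs_inner_le hβ hA

end Errors

/-! ### Probability bounds for the training sample -/

section Events

variable {d n : ℕ} {C : ℝ≥0} {ν : Fin d → Measure ℝ} {μ : EuclideanSpace ℝ (Fin d)}
  {y : Fin n → Bool} {Z : Fin n → EuclideanSpace ℝ (Fin d)} {t M π : ℝ}

/-- The union bound for the probability that one of `n` standardized linear functions of the noise
exceeds `t` in absolute value. -/
noncomputable def maxTail (C : ℝ≥0) (n : ℕ) (t : ℝ) : ℝ :=
  n * (2 * Real.exp (-t ^ 2 / (2 * varianceProxy C)))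

/-- The typical norm `√(d / M)` of the mean noise of a class with `M` points. -/
noncomputable def noiseLevel (d : ℕ) (M : ℝ) : ℝ := √(d / M)

lemma noiseLevel_sq (hM : 0 < M) : noiseLevel d M ^ 2 = d / M :=
  Real.sq_sqrt (by positivity)

lemma noiseLevel_pos (hd : 0 < d) (hM : 0 < M) : 0 < noiseLevel d M :=
  Real.sqrt_pos.2 (by positivity)

lemma pos_of_noiseLevel_pos (hL : 0 < noiseLevel d M) : 0 < d :=
  Nat.pos_of_ne_zero fun hd => by simp [noiseLevel, hd] at hL

lemma noiseLevel_mem_Icc_of_mem_Icc {N : ℝ} (hM : 0 < M) (hN : N ∈ Set.Icc (M / 2) (3 * (M / 2))) :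
    noiseLevel d N ∈ Set.Icc (4 / 5 * noiseLevel d M) (3 / 2 * noiseLevel d M) := by
  have hN₀ : 0 < N := by linarith [hN.1]
  have hL : 0 ≤ noiseLevel d M := Real.sqrt_nonneg _
  have hlow : 16 / 25 ≤ M / N := by
    rw [le_div_iff₀ hN₀]
    linarith [hN.2]
  have hupp : M / N ≤ 9 / 4 := by
    rw [div_le_iff₀ hN₀]
    linarith [hN.1]
  have hratio : d / N = noiseLevel d M ^ 2 * (M / N) := by
    rw [noiseLevel_sq hM]
    field_simp
  refine ⟨Real.le_sqrt_of_sq_le ?_, (Real.sqrt_le_left (by positivity)).2 ?_⟩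
  · rw [hratio, mul_pow, mul_comm]
    gcongr
    linarith
  · rw [hratio, mul_pow, mul_comm]
    gcongr
    linarith

lemma IsSpread.isNoisy (hsp : IsSpread t μ y Z) (htyp : IsTypical t μ y Z)
    (hy : IsBalancedLabels π y) (ht : 0 < t) (hM : 0 < n * π) (hmaj : (majorityIdx y).Nonempty)
    (htL : 160 * t ≤ noiseLevel d (n * π)) (hμL : 20 * ‖μ‖ ≤ noiseLevel d (n * π)) :
    IsNoisy t (2 / 5 * noiseLevel d (n * π)) μ y Z := by
  have hmin := hy.nonempty_minorityIdx hM
  have hlevel := noiseLevel_mem_Icc_of_mem_Icc (d := d) hM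
    (N := (minorityIdx y).card) ⟨hy.le_card, hy.card_le⟩
  have htl : 112 * t ≤ noiseLevel d (minorityIdx y).card := by linarith [hlevel.1]
  have hμl : 16 * ‖μ‖ ≤ noiseLevel d (minorityIdx y).card := by linarith [hlevel.1]
  obtain ⟨hle, hge⟩ : ‖centerDiff μ y Z‖ ∈ Set.Icc (noiseLevel d (minorityIdx y).card / 2)
    (2 * noiseLevel d (minorityIdx y).card) := hsp.norm_centerDiff_mem_Icc htyp ht.le hmin htl hμl
  exact
    { isTypical := htyp
      nonempty_minorityIdx := hmin
      nonempty_majorityIdx := hmaj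
      pos := by linarith
      le_norm := by linarith [hlevel.1]
      norm_le := by linarith [hlevel.2]
      four_mul_norm_signal_le := by linarith [norm_nonneg μ]
      norm_mul_le_gap := fun i hi j hj => hsp.norm_mul_le_gap htyp ht.le htl hμl hi hj }

lemma IsNoisy.isDelocalized {η : ℝ} (h : IsNoisy t (2 / 5 * noiseLevel d (n * π)) μ y Z)
    (hy : IsBalancedLabels π y) (hη : 0 < η) (hM : 0 < n * π) (hηt : 10 * t ≤ η * √d)
    (hcoord : ∀ l, |(∑ i ∈ minorityIdx y, Z i) l| ≤ t * √(minorityIdx y).card) :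
    IsDelocalized η (∑ i ∈ minorityIdx y, Z i) := by
  set N : ℝ := ((minorityIdx y).card : ℝ)
  set L := noiseLevel d (n * π)
  have hN : n * π / 2 ≤ N := hy.le_card
  have hN₀ : 0 < N := by linarith
  have hL : 0 ≤ L := Real.sqrt_nonneg _
  have hnorm : ‖∑ i ∈ minorityIdx y, Z i‖ = N * ‖meanNoise (minorityIdx y) Z‖ := by
    rw [norm_meanNoise, mul_div_cancel₀ _ hN₀.ne']
  have hdim : √d ≤ 2 * (√N * L) := by
    refine Real.sqrt_le_iff.2 ⟨by positivity, ?_⟩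
    rw [mul_pow, mul_pow, Real.sq_sqrt hN₀.le, noiseLevel_sq hM, ← mul_div_assoc, ← mul_div_assoc,
      le_div_iff₀ hM]
    nlinarith [Nat.cast_nonneg (α := ℝ) d]
  refine ⟨?_, fun l => (hcoord l).trans ?_⟩
  · rw [← norm_pos_iff, hnorm]
    exact mul_pos hN₀ h.norm_meanNoise_pos
  · have ht : 5 * t ≤ η * (√N * L) := by nlinarith
    calc t * √N ≤ η * (√N * L) / 5 * √N := by gcongr; linarith
      _ = η * (√N * √N * (L / 5)) := by ring
      _ = η * (N * (L / 5)) := by rw [Real.mul_self_sqrt hN₀.le]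
      _ ≤ η * ‖∑ i ∈ minorityIdx y, Z i‖ := by
        rw [hnorm]
        gcongr
        linarith [h.le_two_mul_norm_meanNoise]

lemma isExceeded_meanNoise_iff {K p : ℝ} {A B : Finset (Fin n)} (hA : A.Nonempty) :
    IsExceeded K p t (meanNoise A Z) Z B ↔ IsExceeded K p t (∑ i ∈ A, Z i) Z B := by
  rw [IsExceeded, IsExceeded, ← card_smul_meanNoise hA,
    exceedances_smul (by exact_mod_cast hA.card_pos)]

/-- A bound for the probability that the noise of a balanced sample is not typical. -/
noncomputable def typicalBound (C : ℝ≥0) (d n : ℕ) (t : ℝ) : ℝ := d / (n / 2) + maxTail C n t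

/-- A bound for the probability that a balanced sample is not noisy. -/
noncomputable def noisyBound (C : ℝ≥0) (d n : ℕ) (t : ℝ) : ℝ :=
  typicalBound C d n t + (maxTail C n t + 96 * (varianceProxy C : ℝ) ^ 2 / t ^ 2)

/-- A bound for the probability that a balanced sample is not noisy or that too few majority points
are exceedances in the direction of the mean noise of the minority class. -/
noncomputable def exceededBound (C : ℝ≥0) (p : ℝ) (d n : ℕ) (t : ℝ) : ℝ :=
  noisyBound C d n t + (maxTail C d t + (4 / (p * (n / 2)) + (d / (n / 2) + 1) / t ^ 2))

/-- The noise is typical, and the mean noise of the minority class has norm at most `r`. -/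
structure IsQuiet (t r : ℝ) (μ : EuclideanSpace ℝ (Fin d)) (y : Fin n → Bool)
    (Z : Fin n → EuclideanSpace ℝ (Fin d)) : Prop where
  isTypical : IsTypical t μ y Z
  nonempty_minorityIdx : (minorityIdx y).Nonempty
  nonempty_majorityIdx : (majorityIdx y).Nonempty
  norm_meanNoise_minority_le : ‖meanNoise (minorityIdx y) Z‖ ≤ r

namespace IsSubGaussianNoise

lemma measureReal_lt_norm_meanNoise_le (hν : IsSubGaussianNoise C ν) {A : Finset (Fin n)}
    (hA : A.Nonempty) {r : ℝ} (hr : 0 < r) :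
    (noiseSample n ν).real {Z | r < ‖meanNoise A Z‖} ≤ d / (A.card * r ^ 2) := by
  have hcard : (0 : ℝ) < A.card := by exact_mod_cast hA.card_pos
  simp only [norm_meanNoise, lt_div_iff₀ hcard]
  refine (hν.measureReal_lt_norm_sum_le A (mul_pos hr hcard)).trans_eq ?_
  field_simp

lemma measureReal_not_isTypical_le (hν : IsSubGaussianNoise C ν) (ht : 0 ≤ t)
    (hy : IsBalancedLabels π y) (hπ : π ≤ 1 / 3) (hn : 0 < n) :
    (noiseSample n ν).real {Z | ¬ IsTypical t μ y Z} ≤ typicalBound C d n t := by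
  have := hν.isProbabilityMeasure_noiseLaw
  have hmean := hν.measureReal_lt_norm_meanNoise_le (hy.nonempty_majorityIdx hπ hn) one_pos
  have hsignal := hν.measureReal_exists_lt_abs_inner_le (n := n) μ ht
  refine (measureReal_mono fun Z hZ => ?_).trans <| (measureReal_union_le _ _).trans <|
    add_le_add (hmean.trans ?_) hsignal
  · by_contra hc
    simp only [Set.mem_union, Set.mem_ofPred_eq, not_or, not_lt, not_exists] at hc
    exact hZ ⟨hc.1, hc.2⟩
  · have := hy.half_le_card_majorityIdx hπ
    rw [one_pow, mul_one]
    gcongr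

lemma measureReal_not_isSpread_le (hν : IsSubGaussianNoise C ν) (ht : 0 < t) (hd : 0 < d)
    (hmin : (minorityIdx y).Nonempty) :
    (noiseSample n ν).real {Z | ¬ IsSpread t μ y Z} ≤
      maxTail C n t + 96 * (varianceProxy C : ℝ) ^ 2 / t ^ 2 := by
  have := hν.isProbabilityMeasure_noiseLaw
  have : (0 : ℝ) < (minorityIdx y).card := by exact_mod_cast hmin.card_pos
  have horthogonal :=
    hν.measureReal_exists_lt_abs_inner_sum_erase_le ((2 : ℝ) • μ) (minorityIdx y) ht.le
  have hnorm := hν.measureReal_exists_lt_abs_norm_sq_sub_le (minorityIdx y)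
    (T := t * √((minorityIdx y).card * d)) (by positivity)
  refine (measureReal_mono fun Z hZ => ?_).trans <| (measureReal_union_le _ _).trans <|
    add_le_add horthogonal (hnorm.trans_eq ?_)
  · by_contra hc
    simp only [Set.mem_union, Set.mem_ofPred_eq, not_or, not_lt, not_exists, not_and] at hc
    exact hZ ⟨hc.1, hc.2⟩
  · rw [mul_pow, Real.sq_sqrt (by positivity)]
    field_simp

lemma measureReal_not_isQuiet_le (hν : IsSubGaussianNoise C ν) (ht : 0 < t)
    (hy : IsBalancedLabels π y) (hM : 0 < n * π) (hπ : π ≤ 1 / 3) (hn : 0 < n) (hd : 0 < d) :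
    (noiseSample n ν).real {Z | ¬ IsQuiet t (t * noiseLevel d (n * π)) μ y Z} ≤
      typicalBound C d n t + 2 / t ^ 2 := by
  have := hν.isProbabilityMeasure_noiseLaw
  have hmin := hy.nonempty_minorityIdx hM
  have hmean := hν.measureReal_lt_norm_meanNoise_le hmin (mul_pos ht (noiseLevel_pos hd hM))
  refine (measureReal_mono fun Z hZ => ?_).trans <| (measureReal_union_le _ _).trans <|
    add_le_add (hν.measureReal_not_isTypical_le (μ := μ) ht.le hy hπ hn) (hmean.trans ?_)
  · by_contra hc
    simp only [Set.mem_union, Set.mem_ofPred_eq, not_or, not_lt, not_not] at hc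
    exact hZ ⟨hc.1, hmin, hy.nonempty_majorityIdx hπ hn, hc.2⟩
  · have : (0 : ℝ) < d := by exact_mod_cast hd
    have hN := hy.le_card
    obtain ⟨hn', hπ'⟩ := mul_ne_zero_iff.1 hM.ne'
    rw [mul_pow, noiseLevel_sq hM]
    calc (d : ℝ) / ((minorityIdx y).card * (t ^ 2 * (d / (n * π))))
        ≤ d / (n * π / 2 * (t ^ 2 * (d / (n * π)))) := by gcongr
      _ = 2 / t ^ 2 := by field_simp

lemma measureReal_not_isNoisy_le (hν : IsSubGaussianNoise C ν) (ht : 0 < t)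
    (hy : IsBalancedLabels π y) (hM : 0 < n * π) (hπ : π ≤ 1 / 3) (hn : 0 < n)
    (htL : 160 * t ≤ noiseLevel d (n * π)) (hμL : 20 * ‖μ‖ ≤ noiseLevel d (n * π)) :
    (noiseSample n ν).real {Z | ¬ IsNoisy t (2 / 5 * noiseLevel d (n * π)) μ y Z} ≤
      noisyBound C d n t := by
  have := hν.isProbabilityMeasure_noiseLaw
  have hd : 0 < d := pos_of_noiseLevel_pos (by linarith : 0 < noiseLevel d (n * π))
  refine (measureReal_mono fun Z hZ => ?_).trans <| (measureReal_union_le _ _).trans <|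
    add_le_add (hν.measureReal_not_isTypical_le (μ := μ) ht.le hy hπ hn)
      (hν.measureReal_not_isSpread_le (μ := μ) ht hd (hy.nonempty_minorityIdx hM))
  by_contra hc
  simp only [Set.mem_union, Set.mem_ofPred_eq, not_or, not_not] at hc
  exact hZ (hc.2.isNoisy hc.1 hy ht hM (hy.nonempty_majorityIdx hπ hn) htL hμL)

end IsSubGaussianNoise

lemma exists_forall_measureReal_not_isNoisy_and_isExceeded_le (C : ℝ≥0) (K : ℝ) :
    ∃ p > 0, ∃ η > 0, ∀ {d n : ℕ} {ν : Fin d → Measure ℝ} {μ : EuclideanSpace ℝ (Fin d)}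
      {y : Fin n → Bool} {t π : ℝ}, IsSubGaussianNoise C ν → 0 < t → IsBalancedLabels π y →
        0 < n * π → π ≤ 1 / 3 → 0 < n → 160 * t ≤ noiseLevel d (n * π) →
        20 * ‖μ‖ ≤ noiseLevel d (n * π) → 10 * t ≤ η * √d →
        (noiseSample n ν).real {Z | ¬ (IsNoisy t (2 / 5 * noiseLevel d (n * π)) μ y Z ∧
          IsExceeded K p t (meanNoise (minorityIdx y) Z) Z (majorityIdx y))} ≤
            exceededBound C p d n t := by
  obtain ⟨p, hp, η, hη, hmain⟩ := exists_forall_measureReal_not_isExceeded_le C K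
  refine ⟨p, hp, η, hη, fun {d n ν μ y t π} hν ht hy hM hπ hn htL hμL hηt => ?_⟩
  have := hν.isProbabilityMeasure_noiseLaw
  have hmin := hy.nonempty_minorityIdx hM
  have hmaj := hy.nonempty_majorityIdx hπ hn
  have hexceeded := hmain hν (disjoint_minorityIdx_majorityIdx y) hmaj ht
  refine (measureReal_mono fun Z hZ => ?_).trans <| (measureReal_union_le _ _).trans <|
    add_le_add (hν.measureReal_not_isNoisy_le ht hy hM hπ hn htL hμL) <|
      (measureReal_union_le _ _).trans <|
        add_le_add (hν.measureReal_exists_lt_abs_sum_coord_le hmin ht.le) (hexceeded.trans ?_)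
  · by_contra hc
    simp only [Set.mem_union, Set.mem_ofPred_eq, not_or, not_not, not_exists, not_lt,
      not_and] at hc
    obtain ⟨hnoisy, hcoord, hexc⟩ := hc
    exact hZ ⟨hnoisy, (isExceeded_meanNoise_iff hmin).2
      (hexc (hnoisy.isDelocalized hy hη hM hηt hcoord))⟩
  · have := hy.half_le_card_majorityIdx hπ
    gcongr

end Events

/-! ### Comparison of sequences with powers of the dimension -/

section Powers

variable {f g : ℕ → ℝ} {p q : ℝ}

lemma isLittleO_rpow_rpow (h : p < q) :
    (fun d : ℕ => (d : ℝ) ^ p) =o[atTop] fun d : ℕ => (d : ℝ) ^ q := by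
  have hpos : ∀ᶠ d : ℕ in atTop, (0 : ℝ) < d := by
    filter_upwards [eventually_gt_atTop 0] with d hd
    exact_mod_cast hd
  refine (isLittleO_iff_tendsto' (hpos.mono fun d hd h₀ => ?_)).2 ?_
  · exact absurd h₀ (Real.rpow_pos_of_pos hd q).ne'
  · refine ((tendsto_rpow_neg_atTop (sub_pos.2 h)).comp tendsto_natCast_atTop_atTop).congr' ?_
    filter_upwards [hpos] with d hd
    rw [← Real.rpow_sub hd, Function.comp_apply, neg_sub]

lemma isLittleO_of_isBigO_rpow (hf : f =O[atTop] fun d : ℕ => (d : ℝ) ^ p)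
    (hg : (fun d : ℕ => (d : ℝ) ^ q) =O[atTop] g) (h : p < q) : f =o[atTop] g :=
  (hf.trans_isLittleO (isLittleO_rpow_rpow h)).trans_isBigO hg

lemma const_isLittleO_of_rpow_isBigO (hg : (fun d : ℕ => (d : ℝ) ^ q) =O[atTop] g) (hq : 0 < q)
    (r : ℝ) : (fun _ : ℕ => r) =o[atTop] g :=
  isLittleO_of_isBigO_rpow (p := 0)
    (by simpa using isBigO_const_const r (one_ne_zero' ℝ) atTop) hg hq

lemma isBigO_mul_rpow (hf : f =O[atTop] fun d : ℕ => (d : ℝ) ^ p)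
    (hg : g =O[atTop] fun d : ℕ => (d : ℝ) ^ q) :
    (fun d => f d * g d) =O[atTop] fun d : ℕ => (d : ℝ) ^ (p + q) :=
  hf.mul_atTop_rpow_natCast_of_isBigO_rpow p q (p + q) hg le_rfl

lemma isTheta_mul_rpow (hf : f =Θ[atTop] fun d : ℕ => (d : ℝ) ^ p)
    (hg : g =Θ[atTop] fun d : ℕ => (d : ℝ) ^ q) :
    (fun d => f d * g d) =Θ[atTop] fun d : ℕ => (d : ℝ) ^ (p + q) := by
  refine (hf.mul hg).trans_eventuallyEq ?_
  filter_upwards [eventually_gt_atTop 0] with d hd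
  rw [Real.rpow_add (by exact_mod_cast hd)]

lemma isTheta_inv_rpow (hf : f =Θ[atTop] fun d : ℕ => (d : ℝ) ^ p) :
    (fun d => (f d)⁻¹) =Θ[atTop] fun d : ℕ => (d : ℝ) ^ (-p) := by
  simpa only [Real.rpow_neg (Nat.cast_nonneg _)] using hf.inv

lemma isTheta_sqrt_rpow (hf : f =Θ[atTop] fun d : ℕ => (d : ℝ) ^ p) (hf₀ : ∀ d, 0 ≤ f d) :
    (fun d => √(f d)) =Θ[atTop] fun d : ℕ => (d : ℝ) ^ (p / 2) := by
  refine (hf.sqrt (.of_forall hf₀) (.of_forall fun d => by positivity)).trans_eventuallyEq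
    (.of_forall fun d => ?_)
  change √((d : ℝ) ^ p) = _
  rw [Real.sqrt_eq_rpow, ← Real.rpow_mul (Nat.cast_nonneg d), mul_one_div]

lemma tendsto_zero_of_isBigO_rpow (hf : f =O[atTop] fun d : ℕ => (d : ℝ) ^ p) (hp : p < 0) :
    Tendsto f atTop (𝓝 0) :=
  hf.trans_tendsto <| by
    simpa [Function.comp_def] using
      (tendsto_rpow_neg_atTop (neg_pos.2 hp)).comp tendsto_natCast_atTop_atTop

lemma eventually_mul_le_of_isLittleO (h : f =o[atTop] g) (hg : ∀ d, 0 ≤ g d) {r : ℝ}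
    (hr : 0 < r) : ∀ᶠ d in atTop, r * f d ≤ g d := by
  filter_upwards [h.bound (inv_pos.2 hr)] with d hd
  rw [Real.norm_eq_abs, Real.norm_of_nonneg (hg d), ← div_eq_inv_mul, le_div_iff₀' hr] at hd
  exact (mul_le_mul_of_nonneg_left (le_abs_self _) hr.le).trans hd

lemma natCast_isTheta_rpow : (fun d : ℕ => (d : ℝ)) =Θ[atTop] fun d : ℕ => (d : ℝ) ^ (1 : ℝ) := by
  simpa using isTheta_rfl

lemma eventually_rpow_pos (p : ℝ) : ∀ᶠ d : ℕ in atTop, 0 < (d : ℝ) ^ p := by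
  filter_upwards [eventually_gt_atTop 0] with d hd
  exact Real.rpow_pos_of_pos (by exact_mod_cast hd) p

lemma tendsto_rpow_natCast_atTop (hp : 0 < p) : Tendsto (fun d : ℕ => (d : ℝ) ^ p) atTop atTop :=
  (tendsto_rpow_atTop hp).comp tendsto_natCast_atTop_atTop

lemma tendsto_inv_sq_rpow (hp : 0 < p) :
    Tendsto (fun d : ℕ => (((d : ℝ) ^ p) ^ 2)⁻¹) atTop (𝓝 0) :=
  tendsto_inv_atTop_zero.comp
    ((tendsto_pow_atTop two_ne_zero).comp (tendsto_rpow_natCast_atTop hp))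

lemma exp_neg_mul_sq_rpow_isLittleO_rpow {r : ℝ} (hr : 0 < r) (hp : 0 < p) (q : ℝ) :
    (fun d : ℕ => Real.exp (-r * ((d : ℝ) ^ p) ^ 2)) =o[atTop] fun d : ℕ => (d : ℝ) ^ q := by
  have hexp := (isLittleO_exp_neg_mul_rpow_atTop hr (q / (p * 2))).comp_tendsto
    (tendsto_rpow_natCast_atTop (p := p * 2) (by positivity))
  refine (hexp.congr_left fun d => ?_).congr_right fun d => ?_
  · rw [Function.comp_apply, Real.rpow_mul (Nat.cast_nonneg d), Real.rpow_two]
  · rw [Function.comp_apply, ← Real.rpow_mul (Nat.cast_nonneg d), mul_div_cancel₀ _ (by positivity)]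

lemma tendsto_maxTail {m : ℕ → ℕ} (hm : (fun d => (m d : ℝ)) =O[atTop] fun d : ℕ => (d : ℝ) ^ q)
    (hp : 0 < p) (C : ℝ≥0) : Tendsto (fun d => maxTail C (m d) ((d : ℝ) ^ p)) atTop (𝓝 0) := by
  have hv : (0 : ℝ) < 1 / (2 * varianceProxy C) := by
    have := varianceProxy_pos C
    positivity
  have hexp := exp_neg_mul_sq_rpow_isLittleO_rpow hv hp (-q - 1)
  have hlim := (tendsto_zero_of_isBigO_rpow (isBigO_mul_rpow hm hexp.isBigO)
    (by linarith)).const_mul 2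
  rw [mul_zero] at hlim
  refine hlim.congr fun d => ?_
  rw [maxTail]
  ring_nf

end Powers

/-! ### The sequences of the high imbalance regime -/

section Regime

variable {a b c ε : ℝ} {π : ℕ → ℝ} {μ : (d : ℕ) → EuclideanSpace ℝ (Fin d)} {n : ℕ → ℕ}

namespace IsImbalanced

lemma isTheta_norm_signal (h : IsImbalanced a b c π μ n) :
    (fun d => ‖μ d‖) =Θ[atTop] fun d : ℕ => (d : ℝ) ^ (b / 2) := by
  simpa [Real.sqrt_sq (norm_nonneg _)] using isTheta_sqrt_rpow h.signal fun d => sq_nonneg _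

lemma isTheta_minority (h : IsImbalanced a b c π μ n) :
    (fun d => n d * π d) =Θ[atTop] fun d : ℕ => (d : ℝ) ^ (1 - (a - c)) := by
  convert! isTheta_mul_rpow h.sampleSize h.ratio using 3
  ring

lemma isTheta_noiseLevel (h : IsImbalanced a b c π μ n) (hπ : ∀ d, 0 ≤ π d) :
    (fun d => noiseLevel d (n d * π d)) =Θ[atTop] fun d : ℕ => (d : ℝ) ^ ((a - c) / 2) := by
  have hsq : (fun d : ℕ => d / (n d * π d)) =Θ[atTop] fun d : ℕ => (d : ℝ) ^ (a - c) := by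
    simpa only [div_eq_mul_inv, neg_sub, add_sub_cancel] using
      isTheta_mul_rpow natCast_isTheta_rpow (isTheta_inv_rpow h.isTheta_minority)
  exact isTheta_sqrt_rpow hsq fun d =>
    div_nonneg (by positivity) (mul_nonneg (by positivity) (hπ d))

lemma eventually_ratio_le (h : IsImbalanced a b c π μ n) (ha : 0 < a) :
    ∀ᶠ d in atTop, π d ≤ 1 / 3 :=
  (tendsto_zero_of_isBigO_rpow h.ratio.1 (by linarith)).eventually_le_const (by norm_num)

lemma eventually_sampleSize_pos (h : IsImbalanced a b c π μ n) (hc : 0 < c) :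
    ∀ᶠ d in atTop, 0 < n d := by
  have hone := const_isLittleO_of_rpow_isBigO h.sampleSize.2 (by linarith) 1
  filter_upwards [eventually_mul_le_of_isLittleO hone (fun d => by positivity) one_pos] with d hd
  rw [one_mul] at hd
  exact_mod_cast zero_lt_one.trans_le hd

lemma tendsto_dim_div (h : IsImbalanced a b c π μ n) (hc : 0 < c) :
    Tendsto (fun d : ℕ => (d : ℝ) / ((n d : ℝ) / 2)) atTop (𝓝 0) := by
  have hratio := isTheta_mul_rpow natCast_isTheta_rpow (isTheta_inv_rpow h.sampleSize)
  have hlim := (tendsto_zero_of_isBigO_rpow hratio.1 (by linarith)).const_mul 2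
  rw [mul_zero] at hlim
  refine hlim.congr fun d => ?_
  rw [div_div_eq_mul_div, div_eq_mul_inv]
  ring

lemma tendsto_typicalBound (h : IsImbalanced a b c π μ n) (hc : 0 < c) (hε : 0 < ε) (C : ℝ≥0) :
    Tendsto (fun d => typicalBound C d (n d) ((d : ℝ) ^ ε)) atTop (𝓝 0) := by
  simpa [typicalBound] using (h.tendsto_dim_div hc).add (tendsto_maxTail h.sampleSize.1 hε C)

lemma tendsto_noisyBound (h : IsImbalanced a b c π μ n) (hc : 0 < c) (hε : 0 < ε) (C : ℝ≥0) :
    Tendsto (fun d => noisyBound C d (n d) ((d : ℝ) ^ ε)) atTop (𝓝 0) := by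
  simpa [noisyBound, div_eq_mul_inv] using
    (h.tendsto_typicalBound hc hε C).add ((tendsto_maxTail h.sampleSize.1 hε C).add
      ((tendsto_inv_sq_rpow hε).const_mul (96 * (varianceProxy C : ℝ) ^ 2)))

lemma tendsto_exceededBound (h : IsImbalanced a b c π μ n) (hc : 0 < c) (hε : 0 < ε) (C : ℝ≥0)
    (p : ℝ) : Tendsto (fun d => exceededBound C p d (n d) ((d : ℝ) ^ ε)) atTop (𝓝 0) := by
  have hcoord := tendsto_maxTail (m := id) natCast_isTheta_rpow.1 hε C
  have hinv := (tendsto_zero_of_isBigO_rpow (isTheta_inv_rpow h.sampleSize).1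
    (by linarith)).const_mul (8 / p)
  have hdim := ((h.tendsto_dim_div hc).add_const 1).mul (tendsto_inv_sq_rpow hε)
  have hlim := (h.tendsto_noisyBound hc hε C).add (hcoord.add (hinv.add hdim))
  simp only [mul_zero, add_zero] at hlim
  refine hlim.congr fun d => ?_
  simp only [exceededBound, id, div_eq_mul_inv, mul_inv, inv_inv]
  ring

end IsImbalanced

end Regime

/-! ### Test errors of sequences of classifiers -/

section Limits

variable {C : ℝ≥0} {n : ℕ → ℕ} {π : ℕ → ℝ} {μ : (d : ℕ) → EuclideanSpace ℝ (Fin d)}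
  {ν : (d : ℕ) → Fin d → Measure ℝ} {τ : ℕ → ℝ}
  {svm : (d : ℕ) → (Fin (n d) → Point d) → EuclideanSpace ℝ (Fin d) × ℝ}

lemma measurable_logit_add (hsvm : ∀ d, IsSVM (τ d) (svm d)) (d : ℕ)
    (v : EuclideanSpace ℝ (Fin d)) :
    Measurable fun w : (Fin (n d) → Point d) × EuclideanSpace ℝ (Fin d) =>
      logit (svm d w.1) (v + w.2) :=
  (measurable_logit (hsvm d).measurable).comp
    (measurable_fst.prodMk (measurable_snd.const_add v))

/-- The probability that the labels and the noise of the training sample satisfy `good` tends to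
one. The sets need not be measurable, so this is stated in terms of the outer measure of the
complement. -/
def IsLikely (n : ℕ → ℕ) (π : ℕ → ℝ) (ν : (d : ℕ) → Fin d → Measure ℝ)
    (good : (d : ℕ) → (Fin (n d) → Bool) → (Fin (n d) → EuclideanSpace ℝ (Fin d)) → Prop) : Prop :=
  Tendsto (fun d => ((labelSample (n d) (π d)).prod (noiseSample (n d) (ν d))).real
    {w | ¬ good d w.1 w.2}) atTop (𝓝 0)

/-- With probability tending to one over the training sample, both classes occur and every solution
of the SVM satisfies `p` for all test noises `z` with bounded component along `β`. Since `⟪z, β⟫`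
has variance at most one, such `z` have probability close to one when the bound `A` is large. -/
def IsScoreBound (n : ℕ → ℕ) (π : ℕ → ℝ) (μ : (d : ℕ) → EuclideanSpace ℝ (Fin d))
    (ν : (d : ℕ) → Fin d → Measure ℝ) (τ : ℕ → ℝ)
    (p : (d : ℕ) → EuclideanSpace ℝ (Fin d) × ℝ → EuclideanSpace ℝ (Fin d) → Prop) : Prop :=
  ∀ A > 0, ∃ good : (d : ℕ) → (Fin (n d) → Bool) → (Fin (n d) → EuclideanSpace ℝ (Fin d)) → Prop,
    IsLikely n π ν good ∧ ∀ᶠ d in atTop, ∀ y Z, good d y Z →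
      (minorityIdx y).Nonempty ∧ (majorityIdx y).Nonempty ∧ ∀ β β₀ κ z,
      IsSVMSolution (τ d) (trainingSet (μ d) y Z) β β₀ κ → |inner ℝ z β| ≤ A → p d (β, β₀) z

namespace IsScoreBound

lemma tendsto_measureReal (hπ : ∀ d, 0 < π d ∧ π d < 1) (hν : ∀ d, IsSubGaussianNoise C (ν d))
    (hsvm : ∀ d, IsSVM (τ d) (svm d))
    {p : (d : ℕ) → EuclideanSpace ℝ (Fin d) × ℝ → EuclideanSpace ℝ (Fin d) → Prop}
    (h : IsScoreBound n π μ ν τ p)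
    {T : (d : ℕ) → Set ((Fin (n d) → Point d) × EuclideanSpace ℝ (Fin d))}
    (hT : ∀ d, MeasurableSet (T d)) (hp : ∀ d S z, p d (svm d S) z → (S, z) ∉ T d) :
    Tendsto (fun d => ((Measure.pi fun _ : Fin (n d) => dataLaw (π d) (μ d) (ν d)).prod
      (noiseLaw (ν d))).real (T d)) atTop (𝓝 0) := by
  rw [Metric.tendsto_nhds]
  intro δ hδ
  have hA : 0 < √(2 / δ) := by positivity
  obtain ⟨good, hlikely, hscore⟩ := h _ hA
  filter_upwards [hscore, hlikely.eventually_lt_const (half_pos hδ)] with d hscore hlikely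
  rw [Real.dist_eq, sub_zero, abs_of_nonneg measureReal_nonneg]
  refine ((hν d).measureReal_train_test_le (hπ d).1.le (hπ d).2.le (hsvm d).measurable hA (hT d)
    (bad := {w | ¬ good d w.1 w.2}) fun y Z hw => ?_).trans_lt ?_
  · obtain ⟨⟨i, hi⟩, ⟨j, hj⟩, hsol⟩ := hscore y Z (by simpa using hw)
    obtain ⟨κ, hκ⟩ := (hsvm d).optimal (trainingSet (μ d) y Z)
      ⟨i, by simpa [minorityIdx, trainingSet] using hi⟩
      ⟨j, by simpa [majorityIdx, trainingSet] using hj⟩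
    exact ⟨hκ.1.norm_le_one, fun z hz => hp d _ z (hsol _ _ κ z hκ hz)⟩
  · rw [Real.sq_sqrt (by positivity), one_div_div]
    linarith

lemma tendsto_errPlus_zero (hπ : ∀ d, 0 < π d ∧ π d < 1) (hν : ∀ d, IsSubGaussianNoise C (ν d))
    (hsvm : ∀ d, IsSVM (τ d) (svm d))
    (h : IsScoreBound n π μ ν τ fun d θ z => 0 < logit θ (μ d + z)) :
    Tendsto (fun d => errPlus (π d) (μ d) (ν d) (svm d)) atTop (𝓝 0) := by
  refine (h.tendsto_measureReal hπ hν hsvm (fun d => measurableSet_le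
    (measurable_logit_add hsvm d (μ d)) (measurable_const (a := (0 : ℝ))))
    fun d S z hS => not_le.2 hS).congr fun d => ?_
  have := (hν d).isProbabilityMeasure_noiseLaw
  rw [errPlus_eq (hπ d).1 (hπ d).2.le (hsvm d).measurable]

lemma tendsto_errMinus_zero (hπ : ∀ d, 0 < π d ∧ π d < 1) (hν : ∀ d, IsSubGaussianNoise C (ν d))
    (hsvm : ∀ d, IsSVM (τ d) (svm d))
    (h : IsScoreBound n π μ ν τ fun d θ z => logit θ (-μ d + z) ≤ 0) :
    Tendsto (fun d => errMinus (π d) (μ d) (ν d) (svm d)) atTop (𝓝 0) := by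
  refine (h.tendsto_measureReal hπ hν hsvm (fun d => measurableSet_lt
    (measurable_const (a := (0 : ℝ))) (measurable_logit_add hsvm d (-μ d)))
    fun d S z hS => not_lt.2 hS).congr fun d => ?_
  have := (hν d).isProbabilityMeasure_noiseLaw
  rw [errMinus_eq (hπ d).1.le (hπ d).2 (hsvm d).measurable]

lemma tendsto_errPlus_one (hπ : ∀ d, 0 < π d ∧ π d < 1) (hν : ∀ d, IsSubGaussianNoise C (ν d))
    (hsvm : ∀ d, IsSVM (τ d) (svm d))
    (h : IsScoreBound n π μ ν τ fun d θ z => logit θ (μ d + z) ≤ 0) :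
    Tendsto (fun d => errPlus (π d) (μ d) (ν d) (svm d)) atTop (𝓝 1) := by
  have hT : ∀ d, MeasurableSet {w : (Fin (n d) → Point d) × EuclideanSpace ℝ (Fin d) |
      0 < logit (svm d w.1) (μ d + w.2)} := fun d =>
    measurableSet_lt (measurable_const (a := (0 : ℝ))) (measurable_logit_add hsvm d (μ d))
  have hlim := (h.tendsto_measureReal hπ hν hsvm hT fun d S z hS => not_lt.2 hS).const_sub 1
  rw [sub_zero] at hlim
  refine hlim.congr fun d => ?_
  have := (hν d).isProbabilityMeasure_noiseLaw
  have := isProbabilityMeasure_dataLaw (μ := μ d) (ν := ν d) (hπ d).1.le (hπ d).2.le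
  rw [errPlus_eq (hπ d).1 (hπ d).2.le (hsvm d).measurable, ← probReal_compl_eq_one_sub (hT d)]
  simp only [Set.compl_ofPred, not_lt]

end IsScoreBound

end Limits

/-! ### Likely events in the high imbalance regime -/

section Likely

variable {a b c ε : ℝ} {C : ℝ≥0} {n : ℕ → ℕ} {π : ℕ → ℝ} {μ : (d : ℕ) → EuclideanSpace ℝ (Fin d)}
  {ν : (d : ℕ) → Fin d → Measure ℝ}

namespace IsImbalanced

lemma isLikely_of_eventually_le (h : IsImbalanced a b c π μ n) (ha : 0 < a) (hc : 0 < c)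
    (hac : a - c < 1) (hπ : ∀ d, 0 < π d ∧ π d < 1) (hν : ∀ d, IsSubGaussianNoise C (ν d))
    {good : (d : ℕ) → (Fin (n d) → Bool) → (Fin (n d) → EuclideanSpace ℝ (Fin d)) → Prop}
    {δ : ℕ → ℝ} (hδ : Tendsto δ atTop (𝓝 0))
    (hle : ∀ᶠ d in atTop, 0 < n d → 0 < n d * π d → π d ≤ 1 / 3 → ∀ y, IsBalancedLabels (π d) y →
      (noiseSample (n d) (ν d)).real {Z | ¬ good d y Z} ≤ δ d) : IsLikely n π ν good := by
  have hM := (tendsto_zero_of_isBigO_rpow (isTheta_inv_rpow h.isTheta_minority).1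
    (by linarith)).const_mul 4
  have hlim := hM.add hδ.abs
  rw [mul_zero, abs_zero, add_zero] at hlim
  refine squeeze_zero' (.of_forall fun d => measureReal_nonneg) ?_ hlim
  filter_upwards [h.eventually_sampleSize_pos hc, h.eventually_ratio_le ha, hle] with d hn hπ₃ hle
  have := (hν d).isProbabilityMeasure_noiseLaw
  have := isProbabilityMeasure_labelLaw (hπ d).1.le (hπ d).2.le
  have hnπ : 0 < n d * π d := mul_pos (by exact_mod_cast hn) (hπ d).1
  refine (measureReal_prod_le_add (B := {y | ¬ IsBalancedLabels (π d) y}) (abs_nonneg (δ d))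
    fun y hy => ?_).trans (add_le_add_left (measureReal_not_isBalancedLabels_le (hπ d).1
      (hπ d).2.le hn) _)
  exact (hle hn hnπ hπ₃ y (by simpa using hy)).trans (le_abs_self _)

lemma isLikely_isQuiet (h : IsImbalanced a b c π μ n) (ha : 0 < a) (hc : 0 < c)
    (hac : a - c < 1) (hπ : ∀ d, 0 < π d ∧ π d < 1) (hν : ∀ d, IsSubGaussianNoise C (ν d))
    (hε : 0 < ε) : IsLikely n π ν fun d => IsQuiet ((d : ℝ) ^ ε)
      ((d : ℝ) ^ ε * noiseLevel d (n d * π d)) (μ d) := by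
  have hδ := (h.tendsto_typicalBound hc hε C).add ((tendsto_inv_sq_rpow hε).const_mul 2)
  rw [mul_zero, add_zero] at hδ
  refine h.isLikely_of_eventually_le ha hc hac hπ hν hδ ?_
  filter_upwards [eventually_gt_atTop 0, eventually_rpow_pos ε] with d hd ht hn hnπ hπ₃ y hy
  exact (hν d).measureReal_not_isQuiet_le ht hy hnπ hπ₃ hn hd

lemma eventually_mul_le_noiseLevel (h : IsImbalanced a b c π μ n) (hπ : ∀ d, 0 < π d ∧ π d < 1)
    {f : ℕ → ℝ} {p : ℝ} (hf : f =O[atTop] fun d : ℕ => (d : ℝ) ^ p) (hp : p < (a - c) / 2)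
    {r : ℝ} (hr : 0 < r) : ∀ᶠ d in atTop, r * f d ≤ noiseLevel d (n d * π d) :=
  eventually_mul_le_of_isLittleO
    (isLittleO_of_isBigO_rpow hf (h.isTheta_noiseLevel fun d => (hπ d).1.le).2 hp)
    (fun _ => Real.sqrt_nonneg _) hr

lemma isLikely_isNoisy (h : IsImbalanced a b c π μ n) (ha : 0 < a) (hc : 0 < c)
    (hac : a - c < 1) (hπ : ∀ d, 0 < π d ∧ π d < 1) (hν : ∀ d, IsSubGaussianNoise C (ν d))
    (hε : 0 < ε) (hε' : ε < (a - c) / 2) (hb : b < a - c) :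
    IsLikely n π ν fun d => IsNoisy ((d : ℝ) ^ ε) (2 / 5 * noiseLevel d (n d * π d)) (μ d) := by
  refine h.isLikely_of_eventually_le ha hc hac hπ hν (h.tendsto_noisyBound hc hε C) ?_
  filter_upwards [eventually_rpow_pos ε,
    h.eventually_mul_le_noiseLevel hπ (isBigO_refl _ _) hε' (r := 160) (by norm_num),
    h.eventually_mul_le_noiseLevel hπ h.isTheta_norm_signal.1 (by linarith) (r := 20)
      (by norm_num)] with d ht htL hμL hn hnπ hπ₃ y hy
  exact (hν d).measureReal_not_isNoisy_le ht hy hnπ hπ₃ hn htL hμL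

lemma exists_isLikely_isNoisy_and_isExceeded (h : IsImbalanced a b c π μ n) (ha : 0 < a)
    (hc : 0 < c) (hac : a - c < 1) (hπ : ∀ d, 0 < π d ∧ π d < 1)
    (hν : ∀ d, IsSubGaussianNoise C (ν d)) (hε : 0 < ε) (hε' : ε < (a - c) / 2) (hb : b < a - c)
    (K : ℝ) : ∃ p > 0, IsLikely n π ν fun d y Z =>
      IsNoisy ((d : ℝ) ^ ε) (2 / 5 * noiseLevel d (n d * π d)) (μ d) y Z ∧
        IsExceeded K p ((d : ℝ) ^ ε) (meanNoise (minorityIdx y) Z) Z (majorityIdx y) := by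
  obtain ⟨p, hp, η, hη, hmain⟩ := exists_forall_measureReal_not_isNoisy_and_isExceeded_le C K
  have hsqrt : (fun d : ℕ => (d : ℝ) ^ ε) =o[atTop] fun d : ℕ => √d :=
    isLittleO_of_isBigO_rpow (isBigO_refl _ _)
      (isTheta_sqrt_rpow natCast_isTheta_rpow fun d => by positivity).2 (by linarith)
  refine ⟨p, hp, h.isLikely_of_eventually_le ha hc hac hπ hν (h.tendsto_exceededBound hc hε C p) ?_⟩
  filter_upwards [eventually_rpow_pos ε,
    h.eventually_mul_le_noiseLevel hπ (isBigO_refl _ _) hε' (r := 160) (by norm_num),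
    h.eventually_mul_le_noiseLevel hπ h.isTheta_norm_signal.1 (by linarith) (r := 20)
      (by norm_num),
    eventually_mul_le_of_isLittleO hsqrt (fun d => Real.sqrt_nonneg _) (r := 10 / η)
      (by positivity)] with d ht htL hμL hηt hn hnπ hπ₃ y hy
  rw [div_mul_eq_mul_div, div_le_iff₀' hη] at hηt
  exact hmain (hν d) ht hy hnπ hπ₃ hn htL hμL hηt

end IsImbalanced

end Likely

/-! ### Scores of a single noisy sample -/

section Scores

variable {d n : ℕ} {μ : EuclideanSpace ℝ (Fin d)} {y : Fin n → Bool}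
  {Z : Fin n → EuclideanSpace ℝ (Fin d)} {β : EuclideanSpace ℝ (Fin d)} {β₀ κ τ t l : ℝ}

namespace IsSVMSolution

lemma logit_add_pos_of_isNoisy (h : IsSVMSolution τ (trainingSet μ y Z) β β₀ κ) (hτ : 0 < τ)
    (hZ : IsNoisy t l μ y Z) (ht : 0 ≤ t) (htμ : 2 * t ≤ ‖μ‖) {z : EuclideanSpace ℝ (Fin d)}
    (hz : |inner ℝ z β| + 31 * t + 8 * l / τ < ‖μ‖ ^ 2 / (8 * l)) :
    0 < logit (β, β₀) (μ + z) := by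
  have hscore := h.le_logit_add hτ hZ.nonempty_minorityIdx (h.norm_centerDiff_sub_le_gap hτ hZ) z
  have hmargin : (‖centerDiff μ y Z‖ - 31 * t) / (1 + τ) ≤ 8 * l / τ := by
    have := hZ.pos
    gcongr
    · linarith [hZ.norm_le]
    · linarith
  linarith [hZ.norm_signal_sq_div_le htμ]

lemma nonneg_of_isNoisy (h : IsSVMSolution τ (trainingSet μ y Z) β β₀ κ) (hτ : 0 < τ)
    (hZ : IsNoisy t l μ y Z) (htl : 31 * t ≤ l) : 0 ≤ κ := by
  refine nonneg_of_mul_nonneg_right ?_ (by positivity : 0 < 1 + τ)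
  linarith [h.norm_centerDiff_sub_le_gap hτ hZ, hZ.le_norm]

lemma inner_signal_le_two (h : IsSVMSolution τ (trainingSet μ y Z) β β₀ κ) (hτ : 0 < τ)
    (hZ : IsNoisy t l μ y Z) (ht : 1 ≤ t) (hμl : 2 * ‖μ‖ ^ 2 + t * ‖μ‖ ≤ l)
    (htμ : 64 * (t * ‖μ‖ ^ 2) ≤ l) : inner ℝ μ β ≤ 2 := by
  have hl := hZ.pos
  have hfirst : (2 * ‖μ‖ ^ 2 + t * ‖μ‖) / l ≤ 1 := (div_le_one hl).2 hμl
  have hsecond : ‖μ‖ * √(64 * t / l) ≤ 1 := by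
    refine (sq_le_one_iff₀ (by positivity)).1 ?_
    rw [mul_pow, Real.sq_sqrt (by positivity), ← mul_div_assoc, div_le_one hl]
    linarith
  linarith [h.inner_signal_le hτ hZ ht]

lemma logit_add_nonpos_of_isExceeded (h : IsSVMSolution τ (trainingSet μ y Z) β β₀ κ) (hτ : 0 < τ)
    (hZ : IsNoisy t l μ y Z) (ht : 1 ≤ t) (htl : 31 * t ≤ l)
    (hμl : 2 * ‖μ‖ ^ 2 + t * ‖μ‖ ≤ l) (htμ : 64 * (t * ‖μ‖ ^ 2) ≤ l) {p A : ℝ} (hp : 0 < p)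
    (hdir : 512 * t ^ 3 + 64 * (t ^ 2 * ‖μ‖) ≤ p ^ 2 * l)
    (hex : IsExceeded (A + 5) p t (meanNoise (minorityIdx y) Z) Z (majorityIdx y))
    {z : EuclideanSpace ℝ (Fin d)} (hz : |inner ℝ z β| ≤ A) : logit (β, β₀) (μ + z) ≤ 0 := by
  have hl := hZ.pos
  have hdist : ‖β - ‖meanNoise (minorityIdx y) Z‖⁻¹ • meanNoise (minorityIdx y) Z‖ ≤
      p / (2 * t) := by
    refine (sq_le_sq₀ (norm_nonneg _) (by positivity)).1
      ((h.norm_sub_meanNoise_direction_sq_le hτ hZ ht).trans ?_)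
    rw [div_pow, div_le_div_iff₀ hl (by positivity)]
    linarith
  have hscore := h.logit_add_le_of_isExceeded (h.nonneg_of_isNoisy hτ hZ htl)
    hZ.norm_meanNoise_pos hdist hp hZ.nonempty_majorityIdx hex z
  have hone : 2 * t / p * (p / (2 * t)) = 1 := by field_simp
  linarith [h.inner_signal_le_two hτ hZ ht hμl htμ]

end IsSVMSolution

end Scores

/-! ### The signal regimes -/

section SignalRegimes

variable {a b c : ℝ} {C : ℝ≥0} {n : ℕ → ℕ} {π : ℕ → ℝ} {μ : (d : ℕ) → EuclideanSpace ℝ (Fin d)}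
  {ν : (d : ℕ) → Fin d → Measure ℝ} {τ : ℕ → ℝ}

namespace IsImbalanced

lemma eventually_const_le_noiseLevel (h : IsImbalanced a b c π μ n)
    (hπ : ∀ d, 0 < π d ∧ π d < 1) (hac : 0 < a - c) {r : ℝ} (hr : 0 < r) :
    ∀ᶠ d in atTop, r ≤ noiseLevel d (n d * π d) := by
  simpa using eventually_mul_le_of_isLittleO (const_isLittleO_of_rpow_isBigO
    (h.isTheta_noiseLevel fun d => (hπ d).1.le).2 (half_pos hac) 1) (fun _ => Real.sqrt_nonneg _) hr

lemma eventually_mul_le_norm_signal (h : IsImbalanced a b c π μ n) {f : ℕ → ℝ} {p : ℝ}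
    (hf : f =O[atTop] fun d : ℕ => (d : ℝ) ^ p) (hp : p < b / 2) {r : ℝ} (hr : 0 < r) :
    ∀ᶠ d in atTop, r * f d ≤ ‖μ d‖ :=
  eventually_mul_le_of_isLittleO (isLittleO_of_isBigO_rpow hf h.isTheta_norm_signal.2 hp)
    (fun _ => norm_nonneg _) hr

lemma eventually_const_le_norm_signal (h : IsImbalanced a b c π μ n) (hb : 0 < b) {r : ℝ}
    (hr : 0 < r) : ∀ᶠ d in atTop, r ≤ ‖μ d‖ := by
  simpa using eventually_mul_le_of_isLittleO (const_isLittleO_of_rpow_isBigO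
    h.isTheta_norm_signal.2 (half_pos hb) 1) (fun d => norm_nonneg _) hr

lemma isScoreBound_minority_pos_of_high_signal (h : IsImbalanced a b c π μ n) (ha : 0 < a)
    (hb : 0 < b) (hc : 0 < c) (hac : a - c < 1) (hπ : ∀ d, 0 < π d ∧ π d < 1)
    (hν : ∀ d, IsSubGaussianNoise C (ν d)) (hτ : ∀ d, 0 < τ d) (hacb : a - c < b)
    (hτ₁ : ∀ᶠ d in atTop, 1 ≤ τ d) :
    IsScoreBound n π μ ν τ fun d θ z => 0 < logit θ (μ d + z) := by
  intro A hA
  obtain ⟨ε, hε, hε'⟩ := exists_between (lt_min (half_pos hb) (half_pos (sub_pos.2 hacb)))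
  obtain ⟨hεb, hεacb⟩ := lt_min_iff.1 hε'
  have hnoise := isBigO_mul_rpow (isBigO_refl (fun d : ℕ => (d : ℝ) ^ ε) atTop)
    (h.isTheta_noiseLevel fun d => (hπ d).1.le).1
  refine ⟨_, h.isLikely_isQuiet ha hc hac hπ hν hε, ?_⟩
  filter_upwards [hτ₁, h.eventually_const_le_norm_signal hb (r := 8 * A) (by positivity),
    h.eventually_mul_le_norm_signal (isBigO_refl _ _) hεb (r := 8) (by norm_num),
    h.eventually_mul_le_norm_signal hnoise (by linarith) (r := 8) (by norm_num)]
    with d hτ₁ hAμ htμ hnoiseμ y Z hZ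
  refine ⟨hZ.nonempty_minorityIdx, hZ.nonempty_majorityIdx, fun β β₀ κ z hκ hz => ?_⟩
  have hμ : 0 < ‖μ d‖ := lt_of_lt_of_le (by positivity) hAμ
  have hgap := hκ.two_mul_norm_signal_sub_le_gap (hτ d) hZ.isTypical hZ.nonempty_majorityIdx hμ
  have hscore := hκ.le_logit_add (hτ d) hZ.nonempty_minorityIdx hgap z
  have hmargin : (2 * ‖μ d‖ - 2 * (d : ℝ) ^ ε) / (1 + τ d) ≤ (2 * ‖μ d‖ - 2 * (d : ℝ) ^ ε) / 2 :=
    div_le_div_of_nonneg_left (by linarith) two_pos (by linarith)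
  linarith [hZ.norm_meanNoise_minority_le]

lemma isScoreBound_majority_nonpos_of_high_signal (h : IsImbalanced a b c π μ n) (ha : 0 < a)
    (hb : 0 < b) (hc : 0 < c) (hac : a - c < 1) (hπ : ∀ d, 0 < π d ∧ π d < 1)
    (hν : ∀ d, IsSubGaussianNoise C (ν d)) (hτ : ∀ d, 0 < τ d)
    (hτb : τ =o[atTop] fun d : ℕ => (d : ℝ) ^ (b / 2)) :
    IsScoreBound n π μ ν τ fun d θ z => logit θ (-μ d + z) ≤ 0 := by
  intro A hA
  obtain ⟨ε, hε, hεb⟩ := exists_between (half_pos hb)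
  refine ⟨_, h.isLikely_isQuiet ha hc hac hπ hν hε, ?_⟩
  filter_upwards [h.eventually_const_le_norm_signal hb (r := 4 * (A + 1)) (by positivity),
    h.eventually_mul_le_norm_signal (isBigO_refl _ _) hεb (r := 4) (by norm_num),
    eventually_mul_le_of_isLittleO (hτb.trans_isBigO h.isTheta_norm_signal.2)
      (fun d => norm_nonneg _) (r := 4 * (A + 1)) (by positivity)] with d hAμ htμ hτμ y Z hZ
  refine ⟨hZ.nonempty_minorityIdx, hZ.nonempty_majorityIdx, fun β β₀ κ z hκ hz => ?_⟩
  have hμ : 0 < ‖μ d‖ := lt_of_lt_of_le (by positivity) hAμ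
  have hgap := hκ.two_mul_norm_signal_sub_le_gap (hτ d) hZ.isTypical hZ.nonempty_majorityIdx hμ
  have hscore := hκ.logit_neg_add_le (hτ d) hZ.isTypical hZ.nonempty_majorityIdx hgap z
  have hmargin : A + 1 ≤ (2 * ‖μ d‖ - 2 * (d : ℝ) ^ ε) / (1 + τ d) := by
    rw [le_div_iff₀ (by linarith [hτ d])]
    linarith
  linarith

lemma isScoreBound_majority_nonpos_of_noisy (h : IsImbalanced a b c π μ n) (ha : 0 < a)
    (hb : 0 < b) (hc : 0 < c) (hac : a - c < 1) (hπ : ∀ d, 0 < π d ∧ π d < 1)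
    (hν : ∀ d, IsSubGaussianNoise C (ν d)) (hτ : ∀ d, 0 < τ d) (hbac : b < a - c)
    (hτac : τ =o[atTop] fun d : ℕ => (d : ℝ) ^ ((a - c) / 2)) :
    IsScoreBound n π μ ν τ fun d θ z => logit θ (-μ d + z) ≤ 0 := by
  intro A hA
  have hac₀ := hb.trans hbac
  obtain ⟨ε, hε, hεac⟩ := exists_between (half_pos hac₀)
  refine ⟨_, h.isLikely_isNoisy ha hc hac hπ hν hε hεac hbac, ?_⟩
  filter_upwards [
    h.eventually_const_le_noiseLevel hπ hac₀ (r := 10 * (A + 1)) (by positivity),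
    h.eventually_mul_le_noiseLevel hπ (isBigO_refl _ _) hεac (r := 310) (by norm_num),
    eventually_mul_le_of_isLittleO
      (hτac.trans_isBigO (h.isTheta_noiseLevel fun d => (hπ d).1.le).2)
      (fun _ => Real.sqrt_nonneg _) (r := 10 * (A + 1)) (by positivity)]
    with d hAL htL hτL y Z hZ
  refine ⟨hZ.nonempty_minorityIdx, hZ.nonempty_majorityIdx, fun β β₀ κ z hκ hz => ?_⟩
  have hgap := hκ.norm_centerDiff_sub_le_gap (hτ d) hZ
  have hscore := hκ.logit_neg_add_le (hτ d) hZ.isTypical hZ.nonempty_majorityIdx hgap z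
  have hmargin : A + 1 ≤ (‖centerDiff (μ d) y Z‖ - 31 * (d : ℝ) ^ ε) / (1 + τ d) := by
    rw [le_div_iff₀ (by linarith [hτ d])]
    linarith [hZ.le_norm]
  linarith

lemma isScoreBound_minority_nonpos_of_bounded_ratio (h : IsImbalanced a b c π μ n) (ha : 0 < a)
    (hb : 0 < b) (hc : 0 < c) (hac : a - c < 1) (hπ : ∀ d, 0 < π d ∧ π d < 1)
    (hν : ∀ d, IsSubGaussianNoise C (ν d)) (hτ : ∀ d, 0 < τ d) (hbac : b < a - c)
    (hτ₀ : τ =O[atTop] fun d : ℕ => (d : ℝ) ^ (0 : ℝ)) :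
    IsScoreBound n π μ ν τ fun d θ z => logit θ (μ d + z) ≤ 0 := by
  intro A hA
  have hac₀ := hb.trans hbac
  obtain ⟨ε, hε, hεac⟩ := exists_between (half_pos hac₀)
  have hμ := h.isTheta_norm_signal.1
  refine ⟨_, h.isLikely_isNoisy ha hc hac hπ hν hε hεac hbac, ?_⟩
  filter_upwards [
    h.eventually_const_le_noiseLevel hπ hac₀ (r := 20 * (A + 1)) (by positivity),
    h.eventually_mul_le_noiseLevel hπ (isBigO_refl _ _) hεac (r := 310) (by norm_num),
    h.eventually_mul_le_noiseLevel hπ hτ₀ (half_pos hac₀) (r := 20 * (A + 1)) (by positivity),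
    h.eventually_mul_le_noiseLevel hπ hμ (by linarith) (r := 40) (by norm_num),
    h.eventually_mul_le_noiseLevel hπ (isBigO_mul_rpow hμ hτ₀) (by linarith) (r := 40)
      (by norm_num)] with d hAL htL hτL hμL hμτL y Z hZ
  refine ⟨hZ.nonempty_minorityIdx, hZ.nonempty_majorityIdx, fun β β₀ κ z hκ hz => ?_⟩
  have hgap := hκ.norm_centerDiff_sub_le_gap (hτ d) hZ
  have hscore := hκ.logit_add_le (hτ d) hZ.isTypical hZ.nonempty_majorityIdx hgap z
  have hmargin : 2 * ‖μ d‖ + A + 1 ≤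
      (‖centerDiff (μ d) y Z‖ - 31 * (d : ℝ) ^ ε) / (1 + τ d) := by
    rw [le_div_iff₀ (by linarith [hτ d])]
    linarith [hZ.le_norm]
  linarith

lemma isTheta_norm_signal_sq_div_noiseLevel (h : IsImbalanced a b c π μ n)
    (hπ : ∀ d, 0 < π d ∧ π d < 1) :
    (fun d => ‖μ d‖ ^ 2 / noiseLevel d (n d * π d)) =Θ[atTop]
      fun d : ℕ => (d : ℝ) ^ (b - (a - c) / 2) := by
  simpa only [div_eq_mul_inv, sub_eq_add_neg] using isTheta_mul_rpow h.signal
    (isTheta_inv_rpow (h.isTheta_noiseLevel fun d => (hπ d).1.le))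

lemma noiseLevel_div_isLittleO (h : IsImbalanced a b c π μ n) (hπ : ∀ d, 0 < π d ∧ π d < 1)
    (hτ : (fun d : ℕ => (d : ℝ) ^ (a - b - c)) =o[atTop] τ) :
    (fun d => noiseLevel d (n d * π d) / τ d) =o[atTop]
      fun d => ‖μ d‖ ^ 2 / noiseLevel d (n d * π d) := by
  have hinv : (fun d => (τ d)⁻¹) =o[atTop] fun d : ℕ => (d : ℝ) ^ (-(a - b - c)) := by
    simp only [Real.rpow_neg (Nat.cast_nonneg _)]
    refine hτ.inv_rev ?_
    filter_upwards [eventually_rpow_pos (a - b - c)] with d hd h₀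
    exact absurd h₀ hd.ne'
  have hprod := ((h.isTheta_noiseLevel fun d => (hπ d).1.le).1.mul_isLittleO hinv).trans_isTheta
    (isTheta_mul_rpow isTheta_rfl isTheta_rfl)
  have hexp : (a - c) / 2 + -(a - b - c) = b - (a - c) / 2 := by ring
  rw [hexp] at hprod
  simpa only [div_eq_mul_inv] using
    hprod.trans_isTheta (h.isTheta_norm_signal_sq_div_noiseLevel hπ).symm

lemma isScoreBound_minority_pos_of_moderate_signal (h : IsImbalanced a b c π μ n) (ha : 0 < a)
    (hc : 0 < c) (hac : a - c < 1) (hπ : ∀ d, 0 < π d ∧ π d < 1)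
    (hν : ∀ d, IsSubGaussianNoise C (ν d)) (hτ : ∀ d, 0 < τ d) (hbac : b < a - c)
    (hacb : a - c < 2 * b) (hτabc : (fun d : ℕ => (d : ℝ) ^ (a - b - c)) =o[atTop] τ) :
    IsScoreBound n π μ ν τ fun d θ z => 0 < logit θ (μ d + z) := by
  intro A hA
  have hQ := (h.isTheta_norm_signal_sq_div_noiseLevel hπ).2
  have hQ₀ : ∀ d, 0 ≤ ‖μ d‖ ^ 2 / noiseLevel d (n d * π d) := fun d =>
    div_nonneg (sq_nonneg _) (Real.sqrt_nonneg _)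
  obtain ⟨ε, hε, hε'⟩ := exists_between (show 0 < b - (a - c) / 2 by linarith)
  refine ⟨_, h.isLikely_isNoisy ha hc hac hπ hν hε (by linarith) hbac, ?_⟩
  filter_upwards [eventually_rpow_pos ε,
    eventually_mul_le_of_isLittleO (const_isLittleO_of_rpow_isBigO hQ (by linarith) A)
      hQ₀ (r := 400) (by norm_num),
    eventually_mul_le_of_isLittleO (isLittleO_of_isBigO_rpow (isBigO_refl _ _) hQ hε')
      hQ₀ (r := 400) (by norm_num),
    eventually_mul_le_of_isLittleO (h.noiseLevel_div_isLittleO hπ hτabc) hQ₀ (r := 20)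
      (by norm_num),
    h.eventually_mul_le_norm_signal (isBigO_refl _ _) (show ε < _ by linarith) (r := 2)
      (by norm_num)] with d ht hAQ htQ hτQ htμ y Z hZ
  refine ⟨hZ.nonempty_minorityIdx, hZ.nonempty_majorityIdx, fun β β₀ κ z hκ hz => ?_⟩
  refine hκ.logit_add_pos_of_isNoisy (hτ d) hZ ht.le htμ ?_
  have hsignal : ‖μ d‖ ^ 2 / (8 * (2 / 5 * noiseLevel d (n d * π d))) =
      5 / 16 * (‖μ d‖ ^ 2 / noiseLevel d (n d * π d)) := by ring
  have hmargin : 8 * (2 / 5 * noiseLevel d (n d * π d)) / τ d =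
      16 / 5 * (noiseLevel d (n d * π d) / τ d) := by ring
  linarith

lemma isScoreBound_minority_nonpos_of_low_signal (h : IsImbalanced a b c π μ n) (ha : 0 < a)
    (hb : 0 < b) (hc : 0 < c) (hac : a - c < 1) (hπ : ∀ d, 0 < π d ∧ π d < 1)
    (hν : ∀ d, IsSubGaussianNoise C (ν d)) (hτ : ∀ d, 0 < τ d) (hbac : 2 * b < a - c) :
    IsScoreBound n π μ ν τ fun d θ z => logit θ (μ d + z) ≤ 0 := by
  intro A _
  obtain ⟨ε, hε, hε'⟩ := exists_between (show 0 < ((a - c) / 2 - b) / 3 by linarith)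
  obtain ⟨p, hp, hlikely⟩ := h.exists_isLikely_isNoisy_and_isExceeded ha hc hac hπ hν hε
    (by linarith) (by linarith) (A + 5)
  have ht : (fun d : ℕ => (d : ℝ) ^ ε) =O[atTop] fun d : ℕ => (d : ℝ) ^ ε := isBigO_refl _ _
  have hμ := h.isTheta_norm_signal.1
  refine ⟨_, hlikely, ?_⟩
  filter_upwards [(tendsto_rpow_natCast_atTop hε).eventually_ge_atTop 1,
    h.eventually_mul_le_noiseLevel hπ ht (by linarith) (r := 310) (by norm_num),
    h.eventually_mul_le_noiseLevel hπ h.signal.1 (by linarith) (r := 10) (by norm_num),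
    h.eventually_mul_le_noiseLevel hπ (isBigO_mul_rpow ht hμ) (by linarith) (r := 5)
      (by norm_num),
    h.eventually_mul_le_noiseLevel hπ (isBigO_mul_rpow ht h.signal.1) (by linarith) (r := 160)
      (by norm_num),
    h.eventually_mul_le_noiseLevel hπ (isBigO_mul_rpow ht (isBigO_mul_rpow ht ht)) (by linarith)
      (r := 2560 / p ^ 2) (by positivity),
    h.eventually_mul_le_noiseLevel hπ (isBigO_mul_rpow ht (isBigO_mul_rpow ht hμ)) (by linarith)
      (r := 320 / p ^ 2) (by positivity)]
    with d ht₁ htL hμL htμL htμμL htttL httμL y Z ⟨hZ, hex⟩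
  refine ⟨hZ.nonempty_minorityIdx, hZ.nonempty_majorityIdx, fun β β₀ κ z hκ hz => ?_⟩
  rw [div_mul_eq_mul_div, div_le_iff₀' (by positivity)] at htttL httμL
  exact hκ.logit_add_nonpos_of_isExceeded (hτ d) hZ ht₁ (by linarith) (by linarith)
    (by linarith) hp (by linarith) hex hz

end IsImbalanced

end SignalRegimes

end HighImbalance

theorem mainTheorem3 (a b c : ℝ) (ha : 0 < a) (hb : 0 < b) (hc : 0 < c) (hac : a - c < 1)
    (C : ℝ≥0) (n : ℕ → ℕ) (π : ℕ → ℝ) (μ : (d : ℕ) → EuclideanSpace ℝ (Fin d))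
    (ν : (d : ℕ) → Fin d → Measure ℝ)
    (hπ : ∀ d, 0 < π d ∧ π d < 1)
    (hν : ∀ d, HighImbalance.IsSubGaussianNoise C (ν d))
    (himb : HighImbalance.IsImbalanced a b c π μ n)
    (τ : ℕ → ℝ) (hτ : ∀ d, 0 < τ d)
    (svm : (d : ℕ) → (Fin (n d) → HighImbalance.Point d) → EuclideanSpace ℝ (Fin d) × ℝ)
    (hsvm : ∀ d, HighImbalance.IsSVM (τ d) (svm d)) :
    -- high signal
    (a - c < b →
      (∀ᶠ d in atTop, 1 ≤ τ d) → τ =o[atTop] (fun d : ℕ => (d : ℝ) ^ (b / 2)) →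
        Tendsto (fun d => HighImbalance.errPlus (π d) (μ d) (ν d) (svm d)) atTop (𝓝 0) ∧
        Tendsto (fun d => HighImbalance.errMinus (π d) (μ d) (ν d) (svm d)) atTop (𝓝 0)) ∧
    -- moderate signal
    (b < a - c → a - c < 2 * b →
      ((fun d : ℕ => (d : ℝ) ^ (a - b - c)) =o[atTop] τ →
        τ =o[atTop] (fun d : ℕ => (d : ℝ) ^ ((a - c) / 2)) →
          Tendsto (fun d => HighImbalance.errPlus (π d) (μ d) (ν d) (svm d)) atTop (𝓝 0) ∧
          Tendsto (fun d => HighImbalance.errMinus (π d) (μ d) (ν d) (svm d)) atTop (𝓝 0)) ∧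
      (τ =Θ[atTop] (fun _ : ℕ => (1 : ℝ)) →
          Tendsto (fun d => HighImbalance.errPlus (π d) (μ d) (ν d) (svm d)) atTop (𝓝 1) ∧
          Tendsto (fun d => HighImbalance.errMinus (π d) (μ d) (ν d) (svm d)) atTop (𝓝 0))) ∧
    -- low signal
    (2 * b < a - c →
      ∀ ε > 0, ∀ᶠ d in atTop,
        1 / 2 - ε ≤ HighImbalance.errBal (π d) (μ d) (ν d) (svm d)) := by
  have hone : (fun _ : ℕ => (1 : ℝ)) = fun d : ℕ => (d : ℝ) ^ (0 : ℝ) := by simp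
  refine ⟨fun hacb hτ₁ hτb => ⟨?_, ?_⟩,
    fun hbac hacb => ⟨fun hτabc hτac => ⟨?_, ?_⟩, fun hτone => ⟨?_, ?_⟩⟩, fun hbac ε hε => ?_⟩
  · exact (himb.isScoreBound_minority_pos_of_high_signal ha hb hc hac hπ hν hτ hacb
      hτ₁).tendsto_errPlus_zero hπ hν hsvm
  · exact (himb.isScoreBound_majority_nonpos_of_high_signal ha hb hc hac hπ hν hτ
      hτb).tendsto_errMinus_zero hπ hν hsvm
  · exact (himb.isScoreBound_minority_pos_of_moderate_signal ha hc hac hπ hν hτ hbac hacb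
      hτabc).tendsto_errPlus_zero hπ hν hsvm
  · exact (himb.isScoreBound_majority_nonpos_of_noisy ha hb hc hac hπ hν hτ hbac
      hτac).tendsto_errMinus_zero hπ hν hsvm
  · exact (himb.isScoreBound_minority_nonpos_of_bounded_ratio ha hb hc hac hπ hν hτ hbac
      (hone ▸ hτone.1)).tendsto_errPlus_one hπ hν hsvm
  · have hτac := hτone.1.trans_isLittleO
      (hone ▸ HighImbalance.isLittleO_rpow_rpow (half_pos (hb.trans hbac)))
    exact (himb.isScoreBound_majority_nonpos_of_noisy ha hb hc hac hπ hν hτ hbac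
      hτac).tendsto_errMinus_zero hπ hν hsvm
  · have hlim := (himb.isScoreBound_minority_nonpos_of_low_signal ha hb hc hac hπ hν hτ
      hbac).tendsto_errPlus_one hπ hν hsvm
    filter_upwards [hlim.eventually_const_lt (show 1 - ε < 1 by linarith)] with d hd
    have hnonneg : 0 ≤ HighImbalance.errMinus (π d) (μ d) (ν d) (svm d) := measureReal_nonneg
    rw [HighImbalance.errBal]
    linarith
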